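/- **The dynamic QoS edge user allocation (EUA) problem.** An instance consists of $n$ users $u_1,\dots,u_n$, $m$ edge servers $s_1,\dots,s_m$, $d\ge 1$ resource dimensions, a relation "$s_j$ covers $u_i$", capacity vectors $c_j=(c_j^1,\dots,c_j^d)$ of the servers, $q$ QoS levels $W_l=(W_l^1,\dots,W_l^d)$, QoE values $E_1,\dots,E_q$ of the levels, and a threshold $Q$. An *allocation* is an array $x_{ijl}\in\{0,1\}$ ($x_{ijl}=1$: user $u_i$ is put on server $s_j$ with level $W_l$). It is *feasible* if $x_{ijl}=1$ only when $s_j$ covers $u_i$; for every user $i$ at most one of the entries $x_{ijl}$ is $1$; and $\sum_{i,l}W_l^k x_{ijl}\le c_j^k$ for all $j,k$. It is a *solution* if moreover its aggregate QoE $\sum_{i,j,l}E_l x_{ijl}$ is greater than $Q$. The decision problem asks whether a solution exists. In the *logistic QoE model* with parameters $L,\alpha,\beta\in\mathbb R$, $$E_l=\frac{L}{1+e^{-\alpha(x_l-\beta)}},\qquad x_l=\frac1d\sum_{k=1}^d W_l^k .$$ **Theorem 1.** 1. *Membership in NP.* Let the capacities, levels, pre-calculated QoE values $E_l$ and threshold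 be non-negative rational numbers, where all resource amounts are written over one common denominator and all QoE values and the threshold over another, with numerators and denominators in binary and $n,m,d,q$ in unary. The decision problem is in $\mathcal{NP}$: there are a polynomial $p$ and a Turing machine that runs in polynomial time on pairs (instance, binary string) such that an instance is a yes-instance if and only if the machine accepts it together with some string of length at most $p(\text{length of the instance})$. 2. *Exact logistic QoE.* For all $L,\alpha,\beta\in\mathbb R$, the decision problem for the exact (in general irrational) logistic QoE values is in $\mathcal{NP}$ in the same sense, on those instances as in 1 whose pre-calculated rational values are precise enough, i.e. on every feasible allocation the comparison of the aggregate QoE with $Q$ has the same outcome for the rational values as for the logistic ones. 3. *Verification in $O(mn)$ time.* On a random access machine with natural-number and real memory, in which each arithmetic operation (addition and subtraction of natural numbers; $+,-,\cdot,/,\exp$ on reals), comparison, jump and memory access takes one step, there is a program which, given any instance with real data and $m,n\ge1$, parameters $L,\alpha,\beta$ and an arbitrary array $x_{ijl}\in\{0,1\}$, decides whether $x$ is a solution for the logistic QoE (each user is on at most one server, which covers it, with one level; capacities are respected in every resource dimension; the aggregate QoE exceeds $Q$) in at most $C\,mn$ steps, where $C$ depends only on $d$ and $q$. -/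

import Mathlib

/-! ### The dynamic QoS edge user allocation problem -/

/-- An instance with `n` users, `m` edge servers, `d` resource dimensions and `q` QoS levels. -/
structure EUA (n m d q : ℕ) where
  /-- `covers j i` says that user `i` lies in the coverage area of server `j`. -/
  covers : Fin m → Fin n → Bool
  /-- available resources of each server -/
  cap : Fin m → Fin d → ℝ
  /-- resources consumed by each QoS level -/
  level : Fin q → Fin d → ℝ
  /-- the threshold that the aggregate QoE has to exceed -/
  threshold : ℝ

/-- A proposed allocation: `x i j l` says that user `i` is put on server `j` with level `l`.
Nothing is required of it; in particular it may put a user on several servers. -/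
abbrev Allocation (n m q : ℕ) : Type := Fin n → Fin m → Fin q → Bool

namespace EUA

variable {n m d q : ℕ}

structure Feasible (I : EUA n m d q) (x : Allocation n m q) : Prop where
  covered : ∀ i j l, x i j l = true → I.covers j i = true
  atMostOne : ∀ i, (Finset.univ.filter
    fun p : Fin m × Fin q => x i p.1 p.2 = true).card ≤ 1
  capacity : ∀ j k, (∑ i, ∑ l, if x i j l = true then I.level l k else 0) ≤ I.cap j k

/-- The sum of the QoE of all users, where `E l` is the QoE of a user with level `l` and
unallocated users contribute `0`. -/
noncomputable def aggregateQoE (E : Fin q → ℝ) (x : Allocation n m q) : ℝ :=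
  ∑ i, ∑ j, ∑ l, if x i j l = true then E l else 0

def IsSolution (I : EUA n m d q) (E : Fin q → ℝ) (x : Allocation n m q) : Prop :=
  I.Feasible x ∧ I.threshold < aggregateQoE E x

/-- The decision problem, for given QoE values of the levels. -/
def Decision (I : EUA n m d q) (E : Fin q → ℝ) : Prop :=
  ∃ x, I.IsSolution E x

/-- The logistic QoE of each level, evaluated at the mean of its resource amounts. -/
noncomputable def logisticQoE (I : EUA n m d q) (L α β : ℝ) (l : Fin q) : ℝ :=
  L / (1 + Real.exp (-α * ((∑ k, I.level l k) / (d : ℝ) - β)))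

end EUA

/-! ### Instances with rational data, and their encoding -/

/-- An instance with non-negative rational data and a table of pre-calculated rational QoE values.
The resource amounts are written over the common denominator `unit`; the QoE values and the
threshold over the common denominator `qoeUnit`. -/
structure RatInstance where
  n : ℕ
  m : ℕ
  d : ℕ
  q : ℕ
  unit : ℕ+
  qoeUnit : ℕ+
  covers : Fin m → Fin n → Bool
  capNum : Fin m → Fin d → ℕ
  levelNum : Fin q → Fin d → ℕ
  qoeNum : Fin q → ℕ
  thresholdNum : ℕ

namespace RatInstance

noncomputable def toEUA (I : RatInstance) : EUA I.n I.m I.d I.q where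
  covers := I.covers
  cap j k := (I.capNum j k : ℝ) / ((I.unit : ℕ) : ℝ)
  level l k := (I.levelNum l k : ℝ) / ((I.unit : ℕ) : ℝ)
  threshold := (I.thresholdNum : ℝ) / ((I.qoeUnit : ℕ) : ℝ)

noncomputable def qoe (I : RatInstance) (l : Fin I.q) : ℝ :=
  (I.qoeNum l : ℝ) / ((I.qoeUnit : ℕ) : ℝ)

/-- The QoE values have been pre-calculated precisely enough for the threshold: on feasible
allocations, the comparison with the threshold comes out as it does for the exact values `E`.
(Non-negative exact values, rounded down finely enough, always have this property.) -/
def PreciseFor (I : RatInstance) (E : Fin I.q → ℝ) : Prop :=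
  ∀ x, I.toEUA.Feasible x →
    (I.toEUA.threshold < EUA.aggregateQoE I.qoe x ↔
      I.toEUA.threshold < EUA.aggregateQoE E x)

/-- `k` in unary, with an end mark -/
def encodeUnary (k : ℕ) : List (Option Bool) :=
  List.replicate k (some true) ++ [none]

/-- `k` in binary, least significant bit first, with an end mark -/
def encodeBinary (k : ℕ) : List (Option Bool) :=
  k.bits.map some ++ [none]

/-- The description of an instance as a string over the alphabet `0`, `1`, end mark: the four
sizes in unary, the coverage matrix bit by bit, and all the numerical data in binary. -/
def encode (I : RatInstance) : List (Option Bool) :=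
  encodeUnary I.n ++ encodeUnary I.m ++ encodeUnary I.d ++ encodeUnary I.q ++
  encodeBinary I.unit ++ encodeBinary I.qoeUnit ++
  (List.finRange I.m).flatMap
    (fun j => (List.finRange I.n).map fun i => some (I.covers j i)) ++
  (List.finRange I.m).flatMap
    (fun j => (List.finRange I.d).flatMap fun k => encodeBinary (I.capNum j k)) ++
  (List.finRange I.q).flatMap
    (fun l => (List.finRange I.d).flatMap fun k => encodeBinary (I.levelNum l k)) ++
  (List.finRange I.q).flatMap (fun l => encodeBinary (I.qoeNum l)) ++
  encodeBinary I.thresholdNum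

end RatInstance

/-! ### The class NP -/

/-- An instance together with a certificate, as one string. -/
def encodeWithCertificate {α Γ : Type} (enc : α → List Γ) (p : α × List Bool) :
    List (Γ ⊕ Bool) :=
  (enc p.1).map Sum.inl ++ p.2.map Sum.inr

/-- The decision problem `P`, on instances encoded by `enc`, is in NP: some Turing machine,
running in polynomial time on an instance and an arbitrary binary string, recognizes certificates
of polynomial length. -/
def InNP {α Γ : Type} (enc : α → List Γ) (P : α → Prop) : Prop :=
  ∃ (bound : Polynomial ℕ) (V : α × List Bool → Bool),
    Nonempty (Turing.TM2ComputableInPolyTime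
      (encodeWithCertificate enc) Computability.encodeBool V) ∧
    ∀ a, P a ↔ ∃ y : List Bool, y.length ≤ bound.eval (enc a).length ∧ V (a, y) = true

/-! ### A random access machine with real arithmetic, every instruction at unit cost -/

namespace RealRAM

/-- The machine has a memory `I` of natural numbers, a memory `R` of real numbers, and two
read-only input arrays. -/
inductive Instr
  /-- `I[a] := k` -/
  | const (a k : ℕ)
  /-- `I[a] := I[b] + I[c]` -/
  | add (a b c : ℕ)
  /-- `I[a] := max (I[b] - I[c]) 0` -/
  | sub (a b c : ℕ)
  /-- `I[a] := I[I[b]]` -/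
  | load (a b : ℕ)
  /-- `I[I[a]] := I[b]` -/
  | store (a b : ℕ)
  /-- `I[a] :=` entry number `I[b]` of the integer input -/
  | read (a b : ℕ)
  /-- if `I[a] < I[b]`, go to instruction `t` -/
  | jumpLT (a b t : ℕ)
  /-- `R[a] := I[b]` -/
  | cast (a b : ℕ)
  /-- `R[a] := R[b] + R[c]` -/
  | radd (a b c : ℕ)
  /-- `R[a] := R[b] - R[c]` -/
  | rsub (a b c : ℕ)
  /-- `R[a] := R[b] * R[c]` -/
  | rmul (a b c : ℕ)
  /-- `R[a] := R[b] / R[c]` -/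
  | rdiv (a b c : ℕ)
  /-- `R[a] := exp R[b]` -/
  | rexp (a b : ℕ)
  /-- `R[a] := R[I[b]]` -/
  | rload (a b : ℕ)
  /-- `R[I[a]] := R[b]` -/
  | rstore (a b : ℕ)
  /-- `R[a] :=` entry number `I[b]` of the real input -/
  | rread (a b : ℕ)
  /-- if `R[a] < R[b]`, go to instruction `t` -/
  | rjumpLT (a b t : ℕ)
  /-- stop with the given answer -/
  | halt (answer : Bool)

structure Input where
  ints : List ℕ
  reals : List ℝ

structure State where
  pc : ℕ
  I : ℕ → ℕ
  R : ℕ → ℝ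

/-- All the memory is zero at the start. -/
def State.init : State := ⟨0, fun _ => 0, fun _ => 0⟩

/-- Write to a cell of the integer memory and go to the next instruction. -/
def State.setI (s : State) (a v : ℕ) : State := ⟨s.pc + 1, Function.update s.I a v, s.R⟩

/-- Write to a cell of the real memory and go to the next instruction. -/
def State.setR (s : State) (a : ℕ) (v : ℝ) : State := ⟨s.pc + 1, s.I, Function.update s.R a v⟩

/-- The effect of one instruction: the next state, or the answer if the machine stops. -/
noncomputable def exec (inp : Input) (s : State) : Instr → State ⊕ Bool
  | .const a k => .inl (s.setI a k)
  | .add a b c => .inl (s.setI a (s.I b + s.I c))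
  | .sub a b c => .inl (s.setI a (s.I b - s.I c))
  | .load a b => .inl (s.setI a (s.I (s.I b)))
  | .store a b => .inl (s.setI (s.I a) (s.I b))
  | .read a b => .inl (s.setI a (inp.ints.getD (s.I b) 0))
  | .jumpLT a b t => .inl { s with pc := if s.I a < s.I b then t else s.pc + 1 }
  | .cast a b => .inl (s.setR a (s.I b : ℝ))
  | .radd a b c => .inl (s.setR a (s.R b + s.R c))
  | .rsub a b c => .inl (s.setR a (s.R b - s.R c))
  | .rmul a b c => .inl (s.setR a (s.R b * s.R c))
  | .rdiv a b c => .inl (s.setR a (s.R b / s.R c))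
  | .rexp a b => .inl (s.setR a (Real.exp (s.R b)))
  | .rload a b => .inl (s.setR a (s.R (s.I b)))
  | .rstore a b => .inl (s.setR (s.I a) (s.R b))
  | .rread a b => .inl (s.setR a (inp.reals.getD (s.I b) 0))
  | .rjumpLT a b t => .inl { s with pc := if s.R a < s.R b then t else s.pc + 1 }
  | .halt answer => .inr answer

/-- One step of a program. Running off its end means rejection. -/
noncomputable def step (prog : List Instr) (inp : Input) (s : State) : State ⊕ Bool :=
  match prog[s.pc]? with
  | some instr => exec inp s instr
  | none => .inr false

/-- The answer of the program if it stops within `t` steps from the state `s`. -/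
noncomputable def runFrom (prog : List Instr) (inp : Input) : ℕ → State → Option Bool
  | 0, _ => none
  | t + 1, s =>
    match step prog inp s with
    | .inl s' => runFrom prog inp t s'
    | .inr answer => some answer

/-- The answer of the program if it stops within `t` steps. -/
noncomputable def run (prog : List Instr) (inp : Input) (t : ℕ) : Option Bool :=
  runFrom prog inp t State.init

end RealRAM

/-- The input of a verifier: the sizes, the coverage matrix and the proposed allocation as an
integer array; the threshold, the parameters of the logistic function, the capacities and the
levels as a real array. -/
def verifierInput {n m d q : ℕ} (I : EUA n m d q) (L α β : ℝ) (x : Allocation n m q) :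
    RealRAM.Input where
  ints := [n, m, d, q] ++
    (List.finRange n).flatMap
      (fun i => (List.finRange m).map fun j => (I.covers j i).toNat) ++
    (List.finRange n).flatMap
      (fun i => (List.finRange m).flatMap fun j =>
        (List.finRange q).map fun l => (x i j l).toNat)
  reals := [I.threshold, L, α, β] ++
    (List.finRange m).flatMap (fun j => (List.finRange d).map fun k => I.cap j k) ++
    (List.finRange q).flatMap (fun l => (List.finRange d).map fun k => I.level l k)

/-! ### A structured language for machines with finitely many stacks -/

namespace StackProgram

/-- The memory of a stack program: a finite register and stacks with a common alphabet. -/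
structure Store (K A σ : Type) where
  reg : σ
  stk : K → List A

/-- Structured programs on stacks indexed by `K`. -/
inductive Cmd (K A σ : Type)
  /-- change the register -/
  | load (f : σ → σ)
  /-- push a symbol computed from the register -/
  | push (k : K) (g : σ → A)
  /-- pop a symbol, if there is one, and tell the register -/
  | pop (k : K) (f : σ → Option A → σ)
  /-- move a symbol, if there is one, from stack `k` to stack `k'` and tell the register -/
  | mv (k k' : K) (f : σ → Option A → σ)
  | seq (c₁ c₂ : Cmd K A σ)
  | ite (p : σ → Bool) (c₁ c₂ : Cmd K A σ)
  /-- as long as the register satisfies `p` and stack `k` is non-empty, pop a symbol from `k`,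
  tell the register, and execute the body -/
  | loop (k : K) (p : σ → Bool) (f : σ → A → σ) (body : Cmd K A σ)

namespace Cmd

infixr:60 " ;; " => Cmd.seq

variable {K A σ : Type}

/-- The program pushes nothing on stack `k`. -/
def NoPush (k : K) : Cmd K A σ → Prop
  | load _ => True
  | push k' _ => k' ≠ k
  | pop _ _ => True
  | mv _ k' _ => k' ≠ k
  | seq c₁ c₂ => c₁.NoPush k ∧ c₂.NoPush k
  | ite _ c₁ c₂ => c₁.NoPush k ∧ c₂.NoPush k
  | loop _ _ _ body => body.NoPush k

/-- A bound for the growth of the total length of the stacks. -/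
def growth : Cmd K A σ → ℕ
  | load _ => 0
  | push _ _ => 1
  | pop _ _ => 0
  | mv _ _ _ => 0
  | seq c₁ c₂ => c₁.growth + c₂.growth
  | ite _ c₁ c₂ => max c₁.growth c₂.growth
  | loop _ _ _ _ => 0

/-- Loops do not push on the stack that controls them, and a round of a loop pushes at most
one symbol more than it pops. -/
def Tame : Cmd K A σ → Prop
  | load _ => True
  | push _ _ => True
  | pop _ _ => True
  | mv _ _ _ => True
  | seq c₁ c₂ => c₁.Tame ∧ c₂.Tame
  | ite _ c₁ c₂ => c₁.Tame ∧ c₂.Tame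
  | loop k _ _ body => body.Tame ∧ body.NoPush k ∧ body.growth ≤ 1

/-- A bound for the running time on stacks of total length `S`. -/
def time : Cmd K A σ → ℕ → ℕ
  | load _, _ => 1
  | push _ _, _ => 1
  | pop _ _, _ => 1
  | mv _ _ _, _ => 1
  | seq c₁ c₂, S => c₁.time S + c₂.time (S + c₁.growth)
  | ite _ c₁ c₂, S => 1 + (c₁.time S + c₂.time S)
  | loop _ _ _ body, S => (S + 1) * (body.time S + 1)

/-! ### Running-time bounds are monotone and polynomial. -/

theorem time_mono (c : Cmd K A σ) : Monotone c.time := by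
  induction c with
  | seq c₁ c₂ h₁ h₂ =>
    intro a b h
    exact add_le_add (h₁ h) (h₂ (by omega))
  | ite p c₁ c₂ h₁ h₂ =>
    intro a b h
    have := h₁ h
    have := h₂ h
    simp only [time]
    omega
  | loop k p f body ih =>
    intro a b h
    exact Nat.mul_le_mul (by omega) (by have := ih h; omega)
  | _ => intro a b _; exact le_rfl

/-- The bound for a conditional adds the two branches instead of taking their maximum, so that it
stays a polynomial. The degree depends on the nesting of the loops, which is fixed with the program.
-/
theorem exists_polynomial_time (c : Cmd K A σ) :
    ∃ p : Polynomial ℕ, ∀ S, c.time S = p.eval S := by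
  induction c with
  | seq c₁ c₂ h₁ h₂ =>
    obtain ⟨p₁, h₁⟩ := h₁
    obtain ⟨p₂, h₂⟩ := h₂
    exact ⟨p₁ + p₂.comp (Polynomial.X + Polynomial.C c₁.growth), fun S => by
      simp [time, h₁, h₂]⟩
  | ite p c₁ c₂ h₁ h₂ =>
    obtain ⟨p₁, h₁⟩ := h₁
    obtain ⟨p₂, h₂⟩ := h₂
    exact ⟨1 + (p₁ + p₂), fun S => by simp [time, h₁, h₂]⟩
  | loop k p f body ih =>
    obtain ⟨p, h⟩ := ih
    exact ⟨(Polynomial.X + 1) * (p + 1), fun S => by simp [time, h]⟩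
  | _ => exact ⟨1, fun S => by simp [time]⟩

/-- The total length of the stacks. -/
def totalLength [Fintype K] (S : K → List A) : ℕ := ∑ k, (S k).length

theorem length_le_totalLength [Fintype K] (S : K → List A) (k : K) : (S k).length ≤ totalLength S :=
  Finset.single_le_sum (f := fun k => (S k).length) (fun _ _ => Nat.zero_le _) (Finset.mem_univ k)

/-- Empty the given stacks. -/
def clear : List K → Cmd K A σ
  | [] => load id
  | k :: ks => loop k (fun _ => true) (fun v _ => v) (load id) ;; clear ks

theorem tame_clear (ks : List K) : (clear ks : Cmd K A σ).Tame := by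
  induction ks with
  | nil => trivial
  | cons k ks ih => exact ⟨⟨trivial, trivial, Nat.zero_le _⟩, ih⟩

/-- The positions in a program at which a machine step starts. -/
def Label : Cmd K A σ → Type
  | load _ => Unit
  | push _ _ => Unit
  | pop _ _ => Unit
  | mv _ _ _ => Unit
  | seq c₁ c₂ => c₁.Label ⊕ c₂.Label
  | ite _ c₁ c₂ => Unit ⊕ (c₁.Label ⊕ c₂.Label)
  | loop _ _ _ body => Unit ⊕ body.Label

/-- The position at which a program starts. -/
def entry : (c : Cmd K A σ) → c.Label
  | load _ => ()
  | push _ _ => ()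
  | pop _ _ => ()
  | mv _ _ _ => ()
  | seq c₁ _ => .inl c₁.entry
  | ite _ _ _ => .inl ()
  | loop _ _ _ _ => .inl ()

@[reducible]
noncomputable def labelFintype : (c : Cmd K A σ) → Fintype c.Label
  | load _ => inferInstanceAs (Fintype Unit)
  | push _ _ => inferInstanceAs (Fintype Unit)
  | pop _ _ => inferInstanceAs (Fintype Unit)
  | mv _ _ _ => inferInstanceAs (Fintype Unit)
  | seq c₁ c₂ =>
    have := c₁.labelFintype
    have := c₂.labelFintype
    inferInstanceAs (Fintype (c₁.Label ⊕ c₂.Label))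
  | ite _ c₁ c₂ =>
    have := c₁.labelFintype
    have := c₂.labelFintype
    inferInstanceAs (Fintype (Unit ⊕ (c₁.Label ⊕ c₂.Label)))
  | loop _ _ _ body =>
    have := body.labelFintype
    inferInstanceAs (Fintype (Unit ⊕ body.Label))

/-- The stacks of the machine: those of the program, and one for the output. -/
abbrev Alphabet (K A : Type) : Option K → Type
  | none => Bool
  | some _ => A

/-- The stacks of the machine when the output stack is empty. -/
def extend (S : K → List A) : ∀ k, List (Alphabet K A k)
  | none => []
  | some k => S k

variable [DecidableEq K]

/-- At most `fuel` rounds of a loop with the given body. -/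
def loopRun (k : K) (p : σ → Bool) (f : σ → A → σ) (body : Store K A σ → Store K A σ) :
    ℕ → Store K A σ → Store K A σ
  | 0, s => s
  | fuel + 1, s =>
    if p s.reg then
      match s.stk k with
      | [] => s
      | a :: rest => loopRun k p f body fuel (body ⟨f s.reg a, Function.update s.stk k rest⟩)
    else s

/-- The effect of a program. A loop makes at most as many rounds as its stack has symbols. -/
def run : Cmd K A σ → Store K A σ → Store K A σ
  | load f, s => ⟨f s.reg, s.stk⟩
  | push k g, s => ⟨s.reg, Function.update s.stk k (g s.reg :: s.stk k)⟩
  | pop k f, s => ⟨f s.reg (s.stk k).head?, Function.update s.stk k (s.stk k).tail⟩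
  | mv k k' f, s =>
    match s.stk k with
    | [] => ⟨f s.reg none, s.stk⟩
    | a :: rest =>
      ⟨f s.reg (some a),
        Function.update (Function.update s.stk k rest) k'
          (a :: Function.update s.stk k rest k')⟩
  | seq c₁ c₂, s => c₂.run (c₁.run s)
  | ite p c₁ c₂, s => if p s.reg then c₁.run s else c₂.run s
  | loop k p f body, s => loopRun k p f body.run (s.stk k).length s

/-! ### Growth of the stacks. -/

theorem length_loopRun_le {k k₁ : K} {p : σ → Bool} {f : σ → A → σ}
    {body : Store K A σ → Store K A σ}
    (hb : ∀ s, ((body s).stk k₁).length ≤ (s.stk k₁).length) (fuel : ℕ) (s : Store K A σ) :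
    ((loopRun k p f body fuel s).stk k₁).length ≤ (s.stk k₁).length := by
  induction fuel generalizing s with
  | zero => exact le_rfl
  | succ fuel ih =>
    rw [loopRun]
    split
    · split
      · exact le_rfl
      · next a rest h =>
        refine (ih _).trans ((hb _).trans ?_)
        by_cases hk : k₁ = k
        · subst hk; simp [h]
        · simp [hk]
    · exact le_rfl

/-- Needed for the controlling stack of a loop: its initial length is then enough fuel, and the
bounded iteration `loopRun` agrees with the unbounded loop of the machine. -/
theorem length_run_le {k : K} {c : Cmd K A σ} (hc : c.NoPush k) (s : Store K A σ) :
    ((c.run s).stk k).length ≤ (s.stk k).length := by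
  induction c generalizing s with
  | load f => exact le_rfl
  | push k' g => simp [run, Function.update_of_ne (Ne.symm hc)]
  | pop k' f =>
    by_cases h : k = k'
    · subst h; simp [run]
    · simp [run, h]
  | mv k₁ k₂ f =>
    rw [run]
    split
    · exact le_rfl
    · next a rest h =>
      simp only [Function.update_of_ne (Ne.symm hc)]
      by_cases hk : k = k₁
      · subst hk; simp [h]
      · simp [hk]
  | seq c₁ c₂ h₁ h₂ => exact (h₂ hc.2 _).trans (h₁ hc.1 _)
  | ite p c₁ c₂ h₁ h₂ =>
    rw [run]
    split
    · exact h₁ hc.1 _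
    · exact h₂ hc.2 _
  | loop k' p f body ih => exact length_loopRun_le (ih hc) _ _

theorem totalLength_update [Fintype K] (S : K → List A) (k : K) (l : List A) :
    totalLength (Function.update S k l) + (S k).length = totalLength S + l.length := by
  have h₁ := Finset.add_sum_erase Finset.univ (fun k => (S k).length) (Finset.mem_univ k)
  have h₂ := Finset.add_sum_erase Finset.univ (fun j => (Function.update S k l j).length)
    (Finset.mem_univ k)
  have h₃ : ∑ x ∈ Finset.univ.erase k, (Function.update S k l x).length =
      ∑ x ∈ Finset.univ.erase k, (S x).length :=
    Finset.sum_congr rfl fun x hx => by rw [Function.update_of_ne (Finset.ne_of_mem_erase hx)]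
  simp only [Function.update_self] at h₂
  unfold totalLength
  omega

/-- Every round pops one symbol before the body adds at most one. -/
theorem totalLength_loopRun_le [Fintype K] {k : K} {p : σ → Bool} {f : σ → A → σ}
    {body : Store K A σ → Store K A σ}
    (hb : ∀ s, totalLength (body s).stk ≤ totalLength s.stk + 1) (fuel : ℕ) (s : Store K A σ) :
    totalLength (loopRun k p f body fuel s).stk ≤ totalLength s.stk := by
  induction fuel generalizing s with
  | zero => exact le_rfl
  | succ fuel ih =>
    rw [loopRun]
    split
    · split
      · exact le_rfl
      · next a rest h =>
        refine (ih _).trans ((hb _).trans ?_)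
        have := totalLength_update s.stk k rest
        simp only [h, List.length_cons] at this ⊢
        omega
    · exact le_rfl

theorem totalLength_run_le [Fintype K] {c : Cmd K A σ} (hc : c.Tame) (s : Store K A σ) :
    totalLength (c.run s).stk ≤ totalLength s.stk + c.growth := by
  induction c generalizing s with
  | load f => exact le_rfl
  | push k g =>
    have := totalLength_update s.stk k (g s.reg :: s.stk k)
    simp only [run, growth, List.length_cons] at this ⊢
    omega
  | pop k f =>
    have := totalLength_update s.stk k (s.stk k).tail
    simp only [run, growth, List.length_tail] at this ⊢
    omega
  | mv k k' f =>
    rw [run]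
    split
    · exact le_rfl
    · next a rest h =>
      have h₁ := totalLength_update s.stk k rest
      have h₂ := totalLength_update (Function.update s.stk k rest) k'
        (a :: Function.update s.stk k rest k')
      simp only [h, growth, List.length_cons] at h₁ h₂ ⊢
      omega
  | seq c₁ c₂ h₁ h₂ =>
    have := h₁ hc.1 s
    have := h₂ hc.2 (c₁.run s)
    simp only [run, growth]
    omega
  | ite p c₁ c₂ h₁ h₂ =>
    rw [run, growth]
    split
    · exact (h₁ hc.1 s).trans (by omega)
    · exact (h₂ hc.2 s).trans (by omega)
  | loop k p f body ih =>
    exact totalLength_loopRun_le (fun s => (ih hc.1 s).trans (by have := hc.2.2; omega)) _ _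

/-! #### Translation to Turing machines -/

theorem update_extend (S : K → List A) (k : K) (l : List A) :
    Function.update (extend S) (some k) l = extend (Function.update S k l) := by
  funext j
  cases j with
  | none => rfl
  | some j =>
    by_cases h : j = k
    · subst h; simp [extend]
    · simp [extend, h]

open Turing.TM2 in
/-- The machine code of a program that continues at `exit`. The register of the machine has a
buffer for one symbol. -/
def code [Inhabited A] {Λ : Type} : (c : Cmd K A σ) → (c.Label → Λ) → Λ → c.Label →
    Stmt (Alphabet K A) Λ (σ × Option A)
  | load f, _, exit, _ => .load (fun v => (f v.1, v.2)) (.goto fun _ => exit)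
  | push k g, _, exit, _ => .push (some k) (fun v => g v.1) (.goto fun _ => exit)
  | pop k f, _, exit, _ => .pop (some k) (fun v a => (f v.1 a, v.2)) (.goto fun _ => exit)
  | mv k k' f, _, exit, _ =>
    .pop (some k) (fun v a => (f v.1 a, a))
      (.branch (fun v => v.2.isSome)
        -- The default is never used: this branch is taken only when the buffer is full.
        (.push (some k') (fun v => v.2.getD default) (.goto fun _ => exit))
        (.goto fun _ => exit))
  | seq c₁ c₂, emb, exit, l =>
    match l with
    | .inl l => c₁.code (fun l => emb (.inl l)) (emb (.inr c₂.entry)) l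
    | .inr l => c₂.code (fun l => emb (.inr l)) exit l
  | ite p c₁ c₂, emb, exit, l =>
    match l with
    | .inl _ => .goto fun v =>
        if p v.1 then emb (.inr (.inl c₁.entry)) else emb (.inr (.inr c₂.entry))
    | .inr (.inl l) => c₁.code (fun l => emb (.inr (.inl l))) exit l
    | .inr (.inr l) => c₂.code (fun l => emb (.inr (.inr l))) exit l
  | loop k p f body, emb, exit, l =>
    match l with
    | .inl _ =>
      -- The symbol must stay on the stack if the test fails, so it is inspected before it is
      -- popped.
      .peek (some k) (fun v a => (v.1, a))
        (.branch (fun v => p v.1 && v.2.isSome)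
          (.pop (some k) (fun v a => (f v.1 (a.getD default), a))
            (.goto fun _ => emb (.inr body.entry)))
          (.goto fun _ => exit))
    | .inr l => body.code (fun l => emb (.inr l)) (emb (.inl ())) l

/-- The machine gets from the position `l` with memory `s` to the position `l'` with memory `s'`
in at most `t` steps. -/
def Reaches {Λ : Type} (M : Λ → Turing.TM2.Stmt (Alphabet K A) Λ (σ × Option A)) (t : ℕ)
    (l : Λ) (s : Store K A σ) (l' : Λ) (s' : Store K A σ) : Prop :=
  ∀ b, ∃ b', ∃ t' ≤ t, (flip bind (Turing.TM2.step M))^[t']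
    (some ⟨some l, (s.reg, b), extend s.stk⟩) = some ⟨some l', (s'.reg, b'), extend s'.stk⟩

section Reaches

variable {Λ : Type} {M : Λ → Turing.TM2.Stmt (Alphabet K A) Λ (σ × Option A)}

theorem Reaches.trans {t₁ t₂ : ℕ} {l₁ l₂ l₃ : Λ} {s₁ s₂ s₃ : Store K A σ}
    (h₁ : Reaches M t₁ l₁ s₁ l₂ s₂) (h₂ : Reaches M t₂ l₂ s₂ l₃ s₃) :
    Reaches M (t₁ + t₂) l₁ s₁ l₃ s₃ := by
  intro b
  obtain ⟨b₁, n₁, hn₁, e₁⟩ := h₁ b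
  obtain ⟨b₂, n₂, hn₂, e₂⟩ := h₂ b₁
  refine ⟨b₂, n₂ + n₁, by omega, ?_⟩
  rw [Function.iterate_add_apply, e₁, e₂]

theorem Reaches.mono {t t' : ℕ} (h : t ≤ t') {l₁ l₂ : Λ} {s₁ s₂ : Store K A σ}
    (h₁ : Reaches M t l₁ s₁ l₂ s₂) : Reaches M t' l₁ s₁ l₂ s₂ := by
  intro b
  obtain ⟨b₁, n₁, hn₁, e₁⟩ := h₁ b
  exact ⟨b₁, n₁, by omega, e₁⟩

/-- The whole statement at a label, up to its `goto`, is a single machine step; so every primitive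
command and every test costs one. -/
theorem Reaches.step {l l' : Λ} {s s' : Store K A σ}
    (h : ∀ b, ∃ b', Turing.TM2.stepAux (M l) (s.reg, b) (extend s.stk) =
      ⟨some l', (s'.reg, b'), extend s'.stk⟩) : Reaches M 1 l s l' s' := by
  intro b
  obtain ⟨b', h⟩ := h b
  exact ⟨b', 1, le_rfl, by simp [flip, h]⟩

end Reaches

/-- The induction is on the fuel and not on the length of the controlling stack, because the body
may pop from that stack too. Each round costs one test and one execution of the body; the leaving
test is covered by the additional `1` in `fuel + 1`. -/
theorem reaches_loopRun [Fintype K] [Inhabited A] {Λ : Type}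
    {M : Λ → Turing.TM2.Stmt (Alphabet K A) Λ (σ × Option A)}
    {k : K} {p : σ → Bool} {f : σ → A → σ} {body : Cmd K A σ} {emb : (loop k p f body).Label → Λ}
    {exit : Λ} (hM : ∀ l, M (emb l) = (loop k p f body).code emb exit l)
    (htame : (loop k p f body).Tame)
    (hbody : ∀ s, Reaches M (body.time (totalLength s.stk)) (emb (.inr body.entry)) s
      (emb (.inl ())) (body.run s))
    (S fuel : ℕ) (s : Store K A σ) (hfuel : (s.stk k).length ≤ fuel)
    (hS : totalLength s.stk ≤ S) :
    Reaches M ((fuel + 1) * (body.time S + 1)) (emb (.inl ())) s exit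
      (loopRun k p f body.run fuel s) := by
  have hentry : M (emb (.inl ())) = (loop k p f body).code emb exit (.inl ()) := hM _
  have hexit (s : Store K A σ) : (p s.reg = false ∨ s.stk k = []) → Reaches M 1 (emb (.inl ())) s exit s := by
    refine fun h => .step fun b => ⟨(s.stk k).head?, ?_⟩
    rw [hentry]
    rcases h with h | h <;> simp [code, h, extend]
  induction fuel generalizing s with
  | zero =>
    exact (hexit s (.inr (List.length_eq_zero_iff.1 (by omega)))).mono
      (by simp)
  | succ fuel ih =>
    rw [loopRun]
    have hle : 1 ≤ (fuel + 1 + 1) * (body.time S + 1) := Nat.mul_pos (by omega) (by omega)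
    split
    · next hp =>
      split
      · next h => exact (hexit s (.inr h)).mono hle
      · next a rest h =>
        set s' : Store K A σ := ⟨f s.reg a, Function.update s.stk k rest⟩ with hs'
        have hlen := totalLength_update s.stk k rest
        simp only [h, List.length_cons] at hlen
        have htot : totalLength s'.stk + 1 = totalLength s.stk := by simp only [hs']; omega
        have h₁ : Reaches M 1 (emb (.inl ())) s (emb (.inr body.entry)) s' := by
          refine .step fun b => ⟨some a, ?_⟩
          rw [hentry]
          simp [code, h, extend, hp, hs', update_extend]
        have h₂ := (hbody s').mono (body.time_mono (show totalLength s'.stk ≤ S by omega))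
        have hk := length_run_le htame.2.1 s'
        have hk' : (s'.stk k).length ≤ fuel := by
          simp only [hs', Function.update_self, h, List.length_cons] at hfuel ⊢
          omega
        -- The symbol popped pays for the one that the body may add, so the bound `S` survives into
        -- the next round.
        have hg := totalLength_run_le htame.1 s'
        have hg' := htame.2.2
        have h₃ := ih (body.run s') (by omega) (by omega)
        refine ((h₁.trans h₂).trans h₃).mono (le_of_eq ?_)
        ring
    · next hp => exact (hexit s (.inl (by simpa using hp))).mono hle

theorem reaches_run [Fintype K] [Inhabited A] {Λ : Type}
    {M : Λ → Turing.TM2.Stmt (Alphabet K A) Λ (σ × Option A)} {c : Cmd K A σ} (hc : c.Tame)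
    {emb : c.Label → Λ} {exit : Λ} (hM : ∀ l, M (emb l) = c.code emb exit l) (s : Store K A σ) :
    Reaches M (c.time (totalLength s.stk)) (emb c.entry) s exit (c.run s) := by
  induction c generalizing exit s with
  | load f => exact .step fun b => ⟨b, by rw [hM]; simp [code, run]⟩
  | push k g => exact .step fun b => ⟨b, by rw [hM]; simp [code, run, extend, update_extend]⟩
  | pop k f => exact .step fun b => ⟨b, by rw [hM]; simp [code, run, extend, update_extend]⟩
  | mv k k' f =>
    refine .step fun b => ⟨(s.stk k).head?, ?_⟩
    rw [hM, run]
    split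
    · next h =>
      have h' : Function.update s.stk k [] = s.stk := by rw [← h, Function.update_eq_self]
      simp only [code, Turing.TM2.stepAux, extend, h, List.tail_nil, update_extend, h']
      simp
    · next a rest h =>
      simp only [code, Turing.TM2.stepAux, update_extend]
      simp [h, extend]
  | seq c₁ c₂ h₁ h₂ =>
    have r₁ := h₁ hc.1 (emb := fun l => emb (.inl l)) (fun l => hM (.inl l)) s
    have r₂ := h₂ hc.2 (emb := fun l => emb (.inr l)) (fun l => hM (.inr l)) (c₁.run s)
    -- The second command starts on stacks that the first may have lengthened by its growth.
    exact r₁.trans (r₂.mono (c₂.time_mono (totalLength_run_le hc.1 s)))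
  | ite p c₁ c₂ h₁ h₂ =>
    have r₁ := h₁ hc.1 (emb := fun l => emb (.inr (.inl l))) (fun l => hM (.inr (.inl l))) s
    have r₂ := h₂ hc.2 (emb := fun l => emb (.inr (.inr l))) (fun l => hM (.inr (.inr l))) s
    have hentry : M (emb (.inl ())) = (ite p c₁ c₂).code emb exit (.inl ()) := hM _
    rw [run]
    split
    · next h =>
      have r₀ : Reaches M 1 (emb (.inl ())) s (emb (.inr (.inl c₁.entry))) s :=
        .step fun b => ⟨b, by rw [hentry]; simp [code, h]⟩
      exact (r₀.trans r₁).mono (by simp only [time]; omega)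
    · next h =>
      have r₀ : Reaches M 1 (emb (.inl ())) s (emb (.inr (.inr c₂.entry))) s :=
        .step fun b => ⟨b, by rw [hentry]; simp [code, h]⟩
      exact (r₀.trans r₂).mono (by simp only [time]; omega)
  | loop k p f body ih =>
    exact (reaches_loopRun hM hc
      (fun s => ih hc.1 (emb := fun l => emb (.inr l)) (fun l => hM (.inr l)) s)
      _ _ s le_rfl le_rfl).mono
      (Nat.mul_le_mul (Nat.succ_le_succ (length_le_totalLength _ _)) le_rfl)

/-! ### Clearing the stacks, and the complete machine. -/

theorem loopRun_clear (k : K) (s : Store K A σ) (l : List A) (h : s.stk k = l) :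
    loopRun k (fun _ => true) (fun v _ => v) (run (load id)) l.length s =
      ⟨s.reg, Function.update s.stk k []⟩ := by
  induction l generalizing s with
  | nil =>
    have h' : Function.update s.stk k [] = s.stk := by rw [← h, Function.update_eq_self]
    simp [loopRun, h']
  | cons a l ih =>
    simp only [List.length_cons, loopRun, h, if_true]
    rw [ih _ (by simp [run])]
    simp [run]

theorem run_clear (ks : List K) (s : Store K A σ) :
    (clear ks).run s = ⟨s.reg, fun k => if k ∈ ks then [] else s.stk k⟩ := by
  induction ks generalizing s with
  | nil => simp [clear, run]
  | cons k ks ih =>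
    rw [clear, run, ih, run, loopRun_clear k s _ rfl]
    congr 1
    funext j
    by_cases hj : j = k
    · subst hj; simp
    · simp [hj]

/-- The machine of a program: it starts with its input on stack `k₀`, empties the stacks in the
end, and outputs `out` of the register. -/
noncomputable def machine [Fintype K] [Inhabited A] [Fintype A] [Fintype σ] (c : Cmd K A σ) (k₀ : K) (v₀ : σ)
    (out : σ → Bool) : Turing.FinTM2 where
  K := Option K
  k₀ := some k₀
  k₁ := none
  Γ := Alphabet K A
  Λ := Option (c ;; clear Finset.univ.toList).Label
  main := some (c ;; clear Finset.univ.toList).entry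
  ΛFin :=
    have := labelFintype (c ;; clear Finset.univ.toList)
    inferInstance
  σ := σ × Option A
  initialState := (v₀, none)
  Γk₀Fin := inferInstanceAs (Fintype A)
  m
    -- A final configuration must have the initial register and nothing but the output on its
    -- stacks; hence the reset here and the clearing before.
    | none => .push none (fun v => out v.1) (.load (fun _ => (v₀, none)) .halt)
    | some l => (c ;; clear Finset.univ.toList).code some none l

/-- Functions computed by tame programs are computable in polynomial time. -/
theorem nonempty_computableInPolyTime [Fintype K] [Inhabited A] [Fintype A] [Fintype σ] {c : Cmd K A σ}
    (hc : c.Tame) (k₀ : K) (v₀ : σ) (out : σ → Bool) {α : Type} (enc : α → List A) (f : α → Bool)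
    (h : ∀ a, out (c.run ⟨v₀, Function.update (fun _ => []) k₀ (enc a)⟩).reg = f a) :
    Nonempty (Turing.TM2ComputableInPolyTime enc Computability.encodeBool f) := by
  set c' := c ;; clear Finset.univ.toList with hc'
  have htame : c'.Tame := ⟨hc, tame_clear _⟩
  obtain ⟨p, hp⟩ := exists_polynomial_time c'
  refine ⟨{
    tm := c.machine k₀ v₀ out
    inputAlphabet := Equiv.refl A
    outputAlphabet := Equiv.refl Bool
    -- The additional step is the one at the exit label, which outputs and halts.
    time := p + 1
    outputsFun := fun a => Classical.choice ?_ }⟩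
  set s : Store K A σ := ⟨v₀, Function.update (fun _ => []) k₀ (enc a)⟩ with hs
  have hinit : Turing.initList (c.machine k₀ v₀ out) (List.map (Equiv.refl A).invFun (enc a)) =
      ⟨some (some c'.entry), (v₀, none), extend s.stk⟩ := by
    unfold Turing.initList
    congr 1
    funext k
    cases k with
    | none => rfl
    | some k =>
      by_cases hk : k = k₀
      · subst hk
        simp [extend, hs, machine]
        rfl
      · simp [extend, hs, machine, hk]
  have hlen : totalLength s.stk = (enc a).length := by
    have := totalLength_update (fun _ : K => ([] : List A)) k₀ (enc a)
    simpa [totalLength, hs] using this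
  obtain ⟨b, t, ht, hrun⟩ := reaches_run (M := (c.machine k₀ v₀ out).m) htame (emb := some)
    (exit := none) (fun l => rfl) s none
  refine ⟨⟨⟨t + 1, ?_⟩, ?_⟩⟩
  · rw [hinit, add_comm, Function.iterate_add_apply]
    erw [hrun]
    have hfin : (c'.run s) = ⟨(c.run s).reg, fun _ => []⟩ := by
      rw [hc', run, run_clear]
      simp
    rw [hfin]
    simp only [Function.iterate_one, flip, Option.map_some]
    refine congrArg some ?_
    unfold Turing.haltList
    rw [← h a]
    simp only [machine, Turing.TM2.stepAux]
    congr 1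
    funext k
    cases k with
    | none => rfl
    | some k => simp [extend]; rfl
  · rw [hlen, hp] at ht
    simpa using ht

end Cmd

end StackProgram

/-! ### Stack programs for numbers in binary -/

namespace StackProgram

open Cmd

/-- The symbols of an instance with a certificate. -/
abbrev Sym : Type := Option Bool ⊕ Bool

/-- The stacks of the verifier: the input, four counters, the data of the instance, and for each
of them a second stack for the part that has been read. -/
inductive Stack
  | inp | usr | usr' | srv | srv' | dim | dim' | lvl | lvl'
  | cov | cov' | cap | cap' | req | req' | qoe | qoe' | thr | thr' | trash
  deriving DecidableEq

instance : Fintype Stack where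
  elems := {.inp, .usr, .usr', .srv, .srv', .dim, .dim', .lvl, .lvl', .cov, .cov', .cap, .cap',
    .req, .req', .qoe, .qoe', .thr, .thr', .trash}
  complete k := by cases k <;> decide

/-- The part of the register that is used inside the processing of a single number. -/
structure Scratch where
  sym : Sym := .inl none
  ended : Bool := false
  ended' : Bool := false
  bit : Bool := false
  sub : Bool := false
  borrow : Bool := false

/-- The results of the checks, and the data of the user and the level under consideration. -/
structure Flags where
  x : Bool := false
  cov : Bool := false
  used : Bool := false
  badCov : Bool := false
  badOnce : Bool := false
  badCap : Bool := false
  exceeded : Bool := false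

structure Reg where
  tmp : Scratch := {}
  flags : Flags := {}

noncomputable instance : Fintype Reg :=
  have h₁ : Function.Injective fun v : Scratch =>
      (v.sym, v.ended, v.ended', v.bit, v.sub, v.borrow) := fun v w h => by
    cases v; cases w; simpa using h
  have h₂ : Function.Injective fun v : Flags =>
      (v.x, v.cov, v.used, v.badCov, v.badOnce, v.badCap, v.exceeded) := fun v w h => by
    cases v; cases w; simpa using h
  have h₃ : Function.Injective fun v : Reg => (v.tmp, v.flags) := fun v w h => by
    cases v; cases w; simpa using h
  have := Fintype.ofInjective _ h₁
  have := Fintype.ofInjective _ h₂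
  Fintype.ofInjective _ h₃

abbrev Prog : Type := Cmd Stack Sym Reg

/-- Clear the scratch part of the register. -/
def Reg.reset (v : Reg) : Reg := ⟨{}, v.flags⟩

/-- Keep a symbol, and notice an end mark. -/
def Reg.keep (v : Reg) (a : Sym) : Reg :=
  ⟨{ v.tmp with sym := a, ended := v.tmp.ended || decide (a = .inl none) }, v.flags⟩

/-- The mark of one unit in a counter -/
abbrev tick : Sym := .inl (some false)

/-- A number in binary, least significant bit first, with an end mark -/
def encodeBits (bs : List Bool) : List Sym := bs.map (fun b => .inl (some b)) ++ [.inl none]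

theorem map_inl_encodeBinary (k : ℕ) :
    (RatInstance.encodeBinary k).map Sum.inl = encodeBits k.bits := by
  simp [RatInstance.encodeBinary, encodeBits, Function.comp_def]

/-! ### Copying and reading numbers. -/

section Loop

variable {K A σ : Type} [DecidableEq K] {k : K} {p : σ → Bool} {f : σ → A → σ}
  {body : Store K A σ → Store K A σ}

theorem loopRun_of_cons {s : Store K A σ} {a : A} {rest : List A} (fuel : ℕ)
    (hp : p s.reg = true) (h : s.stk k = a :: rest) :
    loopRun k p f body (fuel + 1) s =
      loopRun k p f body fuel (body ⟨f s.reg a, Function.update s.stk k rest⟩) := by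
  rw [loopRun, if_pos hp, h]

theorem loopRun_of_false {s : Store K A σ} (fuel : ℕ) (hp : p s.reg = false) :
    loopRun k p f body fuel s = s := by
  cases fuel <;> simp [loopRun, hp]

end Loop

section Copy

/-- Move symbols from stack `k` to stack `k'`: a whole number, if `p` stops at end marks. -/
def copy (p : Reg → Bool) (k k' : Stack) : Prog :=
  loop k p Reg.keep (push k' fun v => v.tmp.sym) ;; load Reg.reset

variable {p : Reg → Bool} {k k' : Stack}

/-- The condition `p` is required only before each symbol of `l`, and fuel is left over. This serves
both for emptying a stack and for stopping behind an end mark with `r` untouched. -/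
theorem loopRun_copy (h : k' ≠ k) (l r : List Sym) (fuel : ℕ) (v : Reg) (S : Stack → List Sym)
    (hS : S k = l ++ r) (hp : ∀ l₁ a l₂, l = l₁ ++ a :: l₂ → p (l₁.foldl Reg.keep v) = true) :
    loopRun k p Reg.keep (run (push k' fun v => v.tmp.sym)) (l.length + fuel) ⟨v, S⟩ =
      loopRun k p Reg.keep (run (push k' fun v => v.tmp.sym)) fuel
        ⟨l.foldl Reg.keep v, Function.update (Function.update S k r) k' (l.reverse ++ S k')⟩ := by
  induction l generalizing v S with
  | nil =>
    have hS' : Function.update S k r = S := by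
      rw [← List.nil_append r, ← hS, Function.update_eq_self]
    simp [hS']
  | cons a l ih =>
    rw [List.length_cons, show l.length + 1 + fuel = l.length + fuel + 1 by ring,
      loopRun_of_cons _ (hp [] a l rfl) (by simpa using hS), run,
      ih _ _ (by simp [h.symm]) (fun l₁ b l₂ hl => hp (a :: l₁) b l₂ (by rw [hl]; rfl))]
    simp only [List.foldl_cons, Function.update_of_ne h]
    congr 2
    funext j
    by_cases hj : j = k'
    · subst hj; simp [Reg.keep]
    · by_cases hj' : j = k
      · subst hj'; simp [hj]
      · simp [hj, hj']

theorem flags_foldl_keep (l : List Sym) (v : Reg) : (l.foldl Reg.keep v).flags = v.flags := by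
  induction l generalizing v with
  | nil => rfl
  | cons a l ih => exact ih _

theorem stop_foldl_keep (l : List Sym) (v : Reg) :
    (l.foldl Reg.keep v).tmp.ended = (v.tmp.ended || l.any fun a => decide (a = .inl none)) := by
  induction l generalizing v with
  | nil => simp
  | cons a l ih =>
    rw [List.foldl_cons, ih]
    simp only [Reg.keep, List.any_cons, Bool.or_assoc]

end Copy

/-- Empty stack `k` onto stack `k'`. -/
def pour (k k' : Stack) : Prog := copy (fun _ => true) k k'

theorem run_pour {k k' : Stack} (h : k' ≠ k) (fl : Flags) (S : Stack → List Sym) :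
    (pour k k').run ⟨⟨{}, fl⟩, S⟩ =
      ⟨⟨{}, fl⟩, Function.update (Function.update S k []) k' ((S k).reverse ++ S k')⟩ := by
  have := loopRun_copy (p := fun _ => true) h (S k) [] 0 ⟨{}, fl⟩ S (by simp) (by simp)
  rw [pour, copy, run, run.eq_7]
  simp only [add_zero] at this
  rw [this]
  simp [loopRun, run, Reg.reset, flags_foldl_keep]

/-- Move a number from stack `k` to stack `k'`, in reverse order. -/
def moveNumber (k k' : Stack) : Prog := copy (fun v => !v.tmp.ended) k k'

theorem run_moveNumber {k k' : Stack} (h : k' ≠ k) {c : List Bool} {r : List Sym}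
    {S : Stack → List Sym} (hS : S k = encodeBits c ++ r) (fl : Flags) :
    (moveNumber k k').run ⟨⟨{}, fl⟩, S⟩ =
      ⟨⟨{}, fl⟩,
        Function.update (Function.update S k r) k' ((encodeBits c).reverse ++ S k')⟩ := by
  have := loopRun_copy (p := fun v => !v.tmp.ended) h (encodeBits c) r r.length ⟨{}, fl⟩ S hS (by
    -- The only end mark is the last symbol, so none has been seen before any symbol of the number.
    intro l₁ a l₂ hl
    rw [stop_foldl_keep]
    rcases List.eq_nil_or_concat l₂ with rfl | ⟨l₃, b, rfl⟩
    · have := List.append_inj_left' hl rfl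
      simp [← this]
    · rw [List.concat_eq_append, ← List.cons_append, ← List.append_assoc] at hl
      have := List.append_inj_left' hl rfl
      have hn : ((l₁ ++ a :: l₃).any fun a => decide (a = .inl none)) = false := by simp [← this]
      rw [List.any_append, Bool.or_eq_false_iff] at hn
      simp [hn.1])
  rw [loopRun_of_false (s := ⟨List.foldl Reg.keep _ _, _⟩) _
    (by rw [stop_foldl_keep]; simp [encodeBits])] at this
  rw [moveNumber, copy, run, run.eq_7]
  simp only [hS, List.length_append]
  rw [this]
  simp [run, Reg.reset, flags_foldl_keep]

/-- Turn a number in unary on the input stack into a counter. -/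
def readUnary (k : Stack) : Prog :=
  loop .inp (fun v => !v.tmp.ended) Reg.keep
    (ite (fun v => v.tmp.ended) (load id) (push k fun _ => tick)) ;;
  load Reg.reset

/-- The end mark is consumed without being pushed. Flags and stacks are described separately, and
the scratch register not at all, because it is reset afterwards. -/
theorem loopRun_readUnary {k : Stack} (h : k ≠ .inp) {n : ℕ} {r : List Sym} (fuel : ℕ)
    {S : Stack → List Sym} (hS : S .inp = (RatInstance.encodeUnary n).map Sum.inl ++ r)
    (v : Reg) (hv : v.tmp.ended = false) :
    (loopRun Stack.inp (fun v : Reg => !v.tmp.ended) Reg.keep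
      (run (ite (fun v => v.tmp.ended) (load id) (push k fun _ => tick))) (n + 1 + fuel)
      ⟨v, S⟩).reg.flags = v.flags ∧
    (loopRun Stack.inp (fun v : Reg => !v.tmp.ended) Reg.keep
      (run (ite (fun v => v.tmp.ended) (load id) (push k fun _ => tick))) (n + 1 + fuel)
      ⟨v, S⟩).stk = Function.update (Function.update S .inp r) k
        (List.replicate n tick ++ S k) := by
  induction n generalizing S v with
  | zero =>
    rw [show 0 + 1 + fuel = fuel + 1 by ring,
      loopRun_of_cons (a := .inl none) (rest := r) _ (by simp [hv])
        (by simpa [RatInstance.encodeUnary] using hS),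
      loopRun_of_false _ (by simp [run, Reg.keep])]
    simp [run, Reg.keep, Function.update_of_ne h]
  | succ n ih =>
    have hk : (v.keep (.inl (some true))).tmp.ended = false := by simp [Reg.keep, hv]
    rw [show n + 1 + 1 + fuel = (n + 1 + fuel) + 1 by ring,
      loopRun_of_cons (a := .inl (some true))
        (rest := (RatInstance.encodeUnary n).map Sum.inl ++ r) _ (by simp [hv])
        (by simpa [RatInstance.encodeUnary, List.replicate_succ] using hS),
      run.eq_6, hk]
    simp only [Bool.false_eq_true, if_false]
    rw [run.eq_2]
    obtain ⟨h₁, h₂⟩ := ih (S := Function.update (Function.update S .inp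
      ((RatInstance.encodeUnary n).map Sum.inl ++ r)) k (tick :: S k)) (by simp [h.symm]) _ hk
    simp only [Function.update_of_ne h]
    rw [h₁, h₂]
    refine ⟨rfl, ?_⟩
    funext j
    by_cases hj : j = k
    · subst hj; simp [List.replicate_succ']
    · by_cases hj' : j = .inp
      · subst hj'; simp [hj]
      · simp [hj, hj']

theorem run_readUnary {k : Stack} (h : k ≠ .inp) {n : ℕ} {r : List Sym}
    {S : Stack → List Sym} (hS : S .inp = (RatInstance.encodeUnary n).map Sum.inl ++ r)
    (fl : Flags) :
    (readUnary k).run ⟨⟨{}, fl⟩, S⟩ =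
      ⟨⟨{}, fl⟩, Function.update (Function.update S .inp r) k
        (List.replicate n tick ++ S k)⟩ := by
  obtain ⟨h₁, h₂⟩ := loopRun_readUnary h r.length hS ⟨{}, fl⟩ rfl
  rw [readUnary, run, run.eq_7]
  simp only [hS]
  rw [show ((RatInstance.encodeUnary n).map (Sum.inl : Option Bool → Sym) ++ r).length = n + 1 + r.length by
    simp [RatInstance.encodeUnary]; ring, run.eq_1, h₂, Reg.reset, h₁]

/-! #### Subtraction -/

/-- Subtract the second number, or `0` if `x` is false, and the borrowed bit from the first one:
the difference, with as many bits as the first number, and the final borrow. -/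
def subBits (x : Bool) : Bool → List Bool → List Bool → List Bool × Bool
  | b, [], ws => ([], b || (x && ws.any id))
  | b, c :: cs, ws =>
    let w := x && ws.headD false
    let r := subBits x (bif c then w && b else w || b) cs ws.tail
    ((c ^^ (w ^^ b)) :: r.1, r.2)

/-- Read a bit of the first number. -/
def Reg.readBit (v : Reg) : Sym → Reg
  | .inl (some b) => ⟨{ v.tmp with bit := b }, v.flags⟩
  | _ => ⟨{ v.tmp with ended := true }, v.flags⟩

/-- Read a bit of the second number. -/
def Reg.readSub (v : Reg) : Option Sym → Reg
  | some (.inl (some b)) => ⟨{ v.tmp with sub := v.flags.x && b }, v.flags⟩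
  | _ => ⟨{ v.tmp with sub := false, ended' := true }, v.flags⟩

/-- Treat the second number as having a zero bit. -/
def Reg.noSub (v : Reg) : Reg := ⟨{ v.tmp with sub := false }, v.flags⟩

/-- The bit of the difference -/
def Reg.diff (v : Reg) : Sym := .inl (some (v.tmp.bit ^^ (v.tmp.sub ^^ v.tmp.borrow)))

/-- The next bit to borrow -/
def Reg.nextBorrow (v : Reg) : Reg :=
  ⟨{ v.tmp with borrow := bif v.tmp.bit then v.tmp.sub && v.tmp.borrow
    else v.tmp.sub || v.tmp.borrow }, v.flags⟩

/-- Read a bit of the second number that lies beyond the end of the first one. -/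
def Reg.readExcess (v : Reg) (a : Sym) : Reg :=
  match a with
  | .inl (some b) => ⟨{ v.tmp with sym := a, borrow := v.tmp.borrow || (v.flags.x && b) }, v.flags⟩
  | _ => ⟨{ v.tmp with sym := a, ended' := true }, v.flags⟩

/-- One step of the subtraction, after a symbol of the first number has been read -/
def subtractBit (C' L L' : Stack) : Prog :=
  ite (fun v => v.tmp.ended) (push C' fun _ => .inl none)
    (ite (fun v => v.tmp.ended') (load Reg.noSub) (mv L L' Reg.readSub) ;;
      push C' Reg.diff ;; load Reg.nextBorrow)

/-- The end of the subtraction, after the first number has been read -/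
def subtractExcess (L L' : Stack) (record : Flags → Bool → Flags) : Prog :=
  loop L (fun v => !v.tmp.ended') Reg.readExcess (push L' fun v => v.tmp.sym) ;;
  load fun v => ⟨{}, record v.flags v.tmp.borrow⟩

/-- Subtract the number on `L`, if the register says `x`, from the number on `C`. Both stacks are
read onto their partners, and `record` notes the final borrow. -/
def subtract (C C' L L' : Stack) (record : Flags → Bool → Flags) : Prog :=
  loop C (fun v => !v.tmp.ended) Reg.readBit (subtractBit C' L L') ;; subtractExcess L L' record

section Subtract

variable {C C' L L' : Stack}

/-- `S` with the contents of four stacks replaced -/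
def put (C C' L L' : Stack) (S : Stack → List Sym) (a b c e : List Sym) : Stack → List Sym :=
  Function.update (Function.update (Function.update (Function.update S C a) C' b) L c) L' e

theorem put_self (S : Stack → List Sym) : put C C' L L' S (S C) (S C') (S L) (S L') = S := by
  funext j
  simp only [put, Function.update_apply]
  split_ifs <;> simp_all

variable (hd : [C, C', L, L'].Nodup) (S : Stack → List Sym)
include hd

theorem put_apply (a b c e : List Sym) : put C C' L L' S a b c e C = a ∧
    put C C' L L' S a b c e C' = b ∧ put C C' L L' S a b c e L = c ∧
    put C C' L L' S a b c e L' = e := by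
  simp only [List.nodup_cons, List.mem_cons, List.not_mem_nil, or_false, not_or] at hd
  obtain ⟨⟨h₁, h₂, h₃⟩, ⟨h₄, h₅⟩, h₆, -⟩ := hd
  simp [put, h₁, h₂, h₃, h₄, h₅, h₆]

theorem update_put (a b c e u : List Sym) :
    Function.update (put C C' L L' S a b c e) C u = put C C' L L' S u b c e ∧
    Function.update (put C C' L L' S a b c e) C' u = put C C' L L' S a u c e ∧
    Function.update (put C C' L L' S a b c e) L u = put C C' L L' S a b u e ∧
    Function.update (put C C' L L' S a b c e) L' u = put C C' L L' S a b c u := by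
  simp only [List.nodup_cons, List.mem_cons, List.not_mem_nil, or_false, not_or] at hd
  obtain ⟨⟨h₁, h₂, h₃⟩, ⟨h₄, h₅⟩, h₆, -⟩ := hd
  refine ⟨?_, ?_, ?_, ?_⟩ <;> funext j <;> simp only [put, Function.update_apply] <;>
    split_ifs <;> simp_all

variable {S}

/-- A nonzero bit beyond the end of the first number forces a borrow. The last symbol `y` is left
open since the scratch register is wiped next. -/
theorem loopRun_readExcess (ws : List Bool) (r : List Sym) (fuel : ℕ) (v : Reg)
    (hv : v.tmp.ended' = false) (a b e : List Sym) :
    ∃ y, loopRun L (fun v : Reg => !v.tmp.ended') Reg.readExcess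
      (run (push L' fun v => v.tmp.sym)) (ws.length + 1 + fuel)
      ⟨v, put C C' L L' S a b (encodeBits ws ++ r) e⟩ =
      ⟨⟨{ v.tmp with
          sym := y, ended' := true, borrow := v.tmp.borrow || (v.flags.x && ws.any id) }, v.flags⟩,
        put C C' L L' S a b r ((encodeBits ws).reverse ++ e)⟩ := by
  induction ws generalizing v e with
  | nil =>
    refine ⟨.inl none, ?_⟩
    rw [show ([] : List Bool).length + 1 + fuel = fuel + 1 by simp [add_comm],
      loopRun_of_cons (a := .inl none) (rest := r) _ (by simp [hv])
        (by simp [put_apply hd, encodeBits]),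
      loopRun_of_false _ (by simp [run, Reg.readExcess])]
    simp [run, encodeBits, update_put hd, put_apply hd, Reg.readExcess]
  | cons w ws ih =>
    obtain ⟨y, ih⟩ := ih (v.readExcess (.inl (some w))) hv (.inl (some w) :: e)
    refine ⟨y, ?_⟩
    rw [show (w :: ws).length + 1 + fuel = (ws.length + 1 + fuel) + 1 by simp; ring,
      loopRun_of_cons (a := .inl (some w)) (rest := encodeBits ws ++ r) _ (by simp [hv])
        (by simp [put_apply hd, encodeBits]), run.eq_2]
    simp only [update_put hd, put_apply hd]
    refine ih.trans ?_
    simp [encodeBits, Bool.and_or_distrib_left, Bool.or_assoc, Reg.readExcess]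

/-- The second number may be the shorter one. Once its end mark has been read, `ended'` is set, its
remaining bits count as zeros and `L` is not touched any more. The equation between reversed lists
is the invariant that unread and read parts together make up the same number on `L'`. -/
theorem run_subtractBit (c : Bool) (ws : List Bool) (r' : List Sym) (v : Reg)
    (hv : v.tmp.ended = false) (hv' : v.tmp.ended' = true → ws = []) (a b e : List Sym) :
    ∃ v' : Reg, ∃ e', v'.tmp.ended = false ∧ (v'.tmp.ended' = true → ws.tail = []) ∧
      v'.flags = v.flags ∧
      v'.tmp.borrow = (bif c then (v.flags.x && ws.headD false) && v.tmp.borrow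
        else (v.flags.x && ws.headD false) || v.tmp.borrow) ∧
      (if v'.tmp.ended' then [] else encodeBits ws.tail).reverse ++ e' =
        (if v.tmp.ended' then [] else encodeBits ws).reverse ++ e ∧
      (subtractBit C' L L').run ⟨v.readBit (.inl (some c)), put C C' L L' S a b
        ((if v.tmp.ended' then [] else encodeBits ws) ++ r') e⟩ =
      ⟨v', put C C' L L' S a
        (.inl (some (c ^^ ((v.flags.x && ws.headD false) ^^ v.tmp.borrow))) :: b)
        ((if v'.tmp.ended' then [] else encodeBits ws.tail) ++ r') e'⟩ := by
  have hb : (v.readBit (.inl (some c))).tmp.ended = false := hv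
  by_cases hs : v.tmp.ended' = true
  · have hb' : (v.readBit (.inl (some c))).tmp.ended' = true := hs
    obtain rfl := hv' hs
    refine ⟨(v.readBit (.inl (some c))).noSub.nextBorrow, e, hb, fun _ => rfl, rfl,
      by simp [Reg.nextBorrow, Reg.noSub, Reg.readBit], by simp [Reg.nextBorrow, Reg.noSub,
        Reg.readBit, hs], ?_⟩
    simp only [subtractBit, run, hb, hb', Bool.false_eq_true, if_false, if_true, update_put hd,
      put_apply hd]
    simp [Reg.nextBorrow, Reg.noSub, Reg.readBit, hs, Reg.diff]
  · have hs' : v.tmp.ended' = false := by simpa using hs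
    have hb' : (v.readBit (.inl (some c))).tmp.ended' = false := hs'
    cases ws with
    | nil =>
      refine ⟨((v.readBit (.inl (some c))).readSub (some (.inl none))).nextBorrow, .inl none :: e,
        hb, fun _ => rfl, rfl, by simp [Reg.nextBorrow, Reg.readSub, Reg.readBit],
        by simp [Reg.nextBorrow, Reg.readSub, Reg.readBit, hs', encodeBits], ?_⟩
      simp only [subtractBit, run, hb, hb', hs', Bool.false_eq_true, if_false,
        update_put hd, put_apply hd, encodeBits, List.map_nil, List.nil_append, List.cons_append]
      simp [Reg.nextBorrow, Reg.readSub, Reg.readBit, Reg.diff]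
    | cons w ws =>
      refine ⟨((v.readBit (.inl (some c))).readSub (some (.inl (some w)))).nextBorrow,
        .inl (some w) :: e,
        hb, fun h => by simp [Reg.nextBorrow, Reg.readSub, Reg.readBit, hs'] at h, rfl,
        by simp [Reg.nextBorrow, Reg.readSub, Reg.readBit],
        by simp [Reg.nextBorrow, Reg.readSub, Reg.readBit, hs', encodeBits], ?_⟩
      simp only [subtractBit, run, hb, hb', hs', Bool.false_eq_true, if_false,
        update_put hd, put_apply hd, encodeBits, List.map_cons, List.cons_append]
      simp [Reg.nextBorrow, Reg.readSub, Reg.readBit, Reg.diff, hs']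

theorem run_subtract_aux (record : Flags → Bool → Flags) (cs ws : List Bool) (r r' : List Sym)
    (fuel : ℕ) (v : Reg) (hv : v.tmp.ended = false) (hv' : v.tmp.ended' = true → ws = [])
    (b e : List Sym) :
    (subtractExcess L L' record).run
      (loopRun C (fun v => !v.tmp.ended) Reg.readBit (run (subtractBit C' L L'))
        (cs.length + 1 + fuel)
        ⟨v, put C C' L L' S (encodeBits cs ++ r) b
          ((if v.tmp.ended' then [] else encodeBits ws) ++ r') e⟩) =
    ⟨⟨{}, record v.flags (subBits v.flags.x v.tmp.borrow cs ws).2⟩,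
      put C C' L L' S r ((encodeBits (subBits v.flags.x v.tmp.borrow cs ws).1).reverse ++ b) r'
        ((if v.tmp.ended' then [] else encodeBits ws).reverse ++ e)⟩ := by
  induction cs generalizing v ws b e with
  | nil =>
    rw [show ([] : List Bool).length + 1 + fuel = fuel + 1 by simp [add_comm],
      loopRun_of_cons (a := .inl none) (rest := r) _ (by simp [hv])
        (by simp [put_apply hd, encodeBits])]
    have hbit : (subtractBit C' L L').run ⟨v.readBit (.inl none), put C C' L L' S r b
          ((if v.tmp.ended' then [] else encodeBits ws) ++ r') e⟩ =
        ⟨v.readBit (.inl none), put C C' L L' S r (.inl none :: b)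
          ((if v.tmp.ended' then [] else encodeBits ws) ++ r') e⟩ := by
      simp only [subtractBit, run, Reg.readBit, if_true, update_put hd, put_apply hd]
    simp only [update_put hd]
    rw [hbit, loopRun_of_false _ (by simp [Reg.readBit]), subtractExcess, run.eq_5, run.eq_7]
    simp only [put_apply hd]
    -- Either the end mark of the second number is already gone and the excess loop makes no round,
    -- or the bits still unread decide the final borrow.
    by_cases hs : v.tmp.ended' = true
    · rw [loopRun_of_false _ (by simp [Reg.readBit, hs])]
      simp [hs, hv' hs, subBits, encodeBits, run, Reg.readBit]
    · simp only [hs, Bool.false_eq_true, if_false]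
      rw [show (encodeBits ws ++ r').length = ws.length + 1 + r'.length by
        simp [encodeBits]; ring]
      obtain ⟨y, hy⟩ := loopRun_readExcess hd (S := S) ws r' r'.length
        (v.readBit (.inl none)) (by simpa [Reg.readBit] using hs) r (.inl none :: b) e
      rw [hy]
      simp [subBits, encodeBits, run, Reg.readBit]
  | cons c cs ih =>
    rw [show (c :: cs).length + 1 + fuel = (cs.length + 1 + fuel) + 1 by simp; ring,
      loopRun_of_cons (a := .inl (some c)) (rest := encodeBits cs ++ r) _ (by simp [hv])
        (by simp [put_apply hd, encodeBits])]
    simp only [update_put hd]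
    obtain ⟨v', e', h₁, h₂, h₃, h₄, h₅, h₆⟩ := run_subtractBit hd (S := S) c ws r' v hv hv'
      (encodeBits cs ++ r) b e
    rw [h₆, ih ws.tail v' h₁ h₂ _ e', h₅, h₃, h₄]
    simp [subBits, encodeBits]

theorem run_subtract (record : Flags → Bool → Flags) {cs ws : List Bool} {r r' : List Sym}
    (hC : S C = encodeBits cs ++ r) (hL : S L = encodeBits ws ++ r') (fl : Flags) :
    (subtract C C' L L' record).run ⟨⟨{}, fl⟩, S⟩ =
      ⟨⟨{}, record fl (subBits fl.x false cs ws).2⟩,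
        put C C' L L' S r ((encodeBits (subBits fl.x false cs ws).1).reverse ++ S C') r'
          ((encodeBits ws).reverse ++ S L')⟩ := by
  have := run_subtract_aux hd (S := S) record cs ws r r' r.length ⟨{}, fl⟩ rfl (by simp)
    (S C') (S L')
  simp only [Bool.false_eq_true, if_false] at this
  rw [← hC, ← hL, put_self] at this
  rw [← this, subtract, run, run.eq_7]
  simp only [hC]
  rw [show (encodeBits cs ++ r).length = cs.length + 1 + r.length by simp [encodeBits]; ring]

end Subtract

end StackProgram

/-! ### The verifier as a stack program -/

namespace StackProgram

open Cmd

/-! ### Values of bit strings, and correctness of subtraction. -/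

/-- The number with the given bits, least significant bit first -/
def bitsVal : List Bool → ℕ
  | [] => 0
  | b :: bs => b.toNat + 2 * bitsVal bs

theorem bitsVal_bits (k : ℕ) : bitsVal k.bits = k := by
  induction k using Nat.binaryRec' with
  | zero => simp [bitsVal]
  | bit b n hn ih =>
    rw [Nat.bits_append_bit n b hn, bitsVal, ih, Nat.bit_val]
    cases b <;> simp [add_comm]

theorem bitsVal_pos_of_any {ws : List Bool} (h : ws.any id = true) : 0 < bitsVal ws := by
  induction ws with
  | nil => simp at h
  | cons w ws ih =>
    cases w with
    | true => simp [bitsVal]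
    | false =>
      have := ih (by simpa using h)
      simp [bitsVal]; omega

theorem bitsVal_eq_zero_of_not_any {ws : List Bool} (h : ws.any id = false) : bitsVal ws = 0 := by
  induction ws with
  | nil => rfl
  | cons w ws ih =>
    simp only [List.any_cons, Bool.or_eq_false_iff, id] at h
    simp [bitsVal, h.1, ih h.2]

theorem bitsVal_eq_headD_add (ws : List Bool) :
    bitsVal ws = (ws.headD false).toNat + 2 * bitsVal ws.tail := by
  cases ws <;> simp [bitsVal]

/-- In each column, with `b'` the next borrow, `c + 2 b' = difference + w + b`. The difference is
meaningful only without a final borrow; with one, all that is kept is the strict inequality. -/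
theorem subBits_spec (x b : Bool) (cs ws : List Bool) :
    ((subBits x b cs ws).2 = false →
      bitsVal (subBits x b cs ws).1 + (x.toNat * bitsVal ws + b.toNat) = bitsVal cs) ∧
    ((subBits x b cs ws).2 = true → bitsVal cs < x.toNat * bitsVal ws + b.toNat) := by
  induction cs generalizing b ws with
  | nil =>
    simp only [subBits, bitsVal, Bool.or_eq_false_iff, Bool.or_eq_true, Bool.and_eq_false_iff,
      Bool.and_eq_true]
    refine ⟨?_, ?_⟩
    · rintro ⟨rfl, rfl | h⟩
      · simp
      · simp [bitsVal_eq_zero_of_not_any h]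
    · rintro (rfl | ⟨rfl, h⟩)
      · simp
      · have := bitsVal_pos_of_any h
        simp; omega
  | cons c cs ih =>
    obtain ⟨h₁, h₂⟩ := ih (bif c then (x && ws.headD false) && b else (x && ws.headD false) || b)
      ws.tail
    rw [bitsVal_eq_headD_add ws]
    simp only [subBits, bitsVal]
    refine ⟨fun h => ?_, fun h => ?_⟩
    · have := h₁ h
      rw [← this]
      cases x <;> cases b <;> cases c <;> cases ws.headD false <;> simp <;> ring
    · have := h₂ h
      revert this
      cases x <;> cases b <;> cases c <;> cases ws.headD false <;> simp <;> omega

/-! #### Loops over counters -/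

/-- For each symbol on stack `k`: note the symbol, execute the body, and write a new symbol. -/
def visit (k k' : Stack) (f : Flags → Sym → Flags) (g : Flags → Sym) (h : Flags → Flags)
    (body : Prog) : Prog :=
  loop k (fun _ => true) (fun v a => ⟨v.tmp, f v.flags a⟩)
    (body ;; push k' (fun v => g v.flags) ;; load fun v => ⟨v.tmp, h v.flags⟩) ;;
  pour k' k

/-- The invariant `F pre suf` is the state when `pre` has been treated and `suf` is still to come.
Its values on `k` and `k'` are overwritten by arbitrary `u` and `u'`, so `H` also requires that the
body leave these two stacks alone. -/
theorem loopRun_visit {β : Type} {k k' : Stack} (hk : k' ≠ k) {f : Flags → Sym → Flags}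
    {g : Flags → Sym} {h : Flags → Flags} {body : Prog} {bs : List β} (a a' : β → Sym)
    (F : List β → List β → Flags × (Stack → List Sym))
    (H : ∀ pre b suf u u', pre ++ b :: suf = bs → ∃ fl, g fl = a' b ∧
      h fl = (F (pre ++ [b]) suf).1 ∧
      body.run ⟨⟨{}, f (F pre (b :: suf)).1 (a b)⟩,
        Function.update (Function.update (F pre (b :: suf)).2 k u) k' u'⟩ =
      ⟨⟨{}, fl⟩, Function.update (Function.update (F (pre ++ [b]) suf).2 k u) k' u'⟩)
    (pre suf : List β) (hbs : pre ++ suf = bs) (u' : List Sym) :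
    loopRun k (fun _ => true) (fun v a => ⟨v.tmp, f v.flags a⟩)
      (run (body ;; push k' (fun v => g v.flags) ;; load fun v => ⟨v.tmp, h v.flags⟩)) suf.length
      ⟨⟨{}, (F pre suf).1⟩, Function.update (Function.update (F pre suf).2 k (suf.map a)) k' u'⟩ =
    ⟨⟨{}, (F bs []).1⟩, Function.update (Function.update (F bs []).2 k []) k'
      ((suf.map a').reverse ++ u')⟩ := by
  induction suf generalizing pre u' with
  | nil =>
    obtain rfl : pre = bs := by simpa using hbs
    simp [loopRun]
  | cons b suf ih =>
    rw [List.length_cons, loopRun_of_cons (a := a b) (rest := suf.map a) _ rfl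
      (by simp [hk.symm])]
    have hu : Function.update (Function.update (Function.update (F pre (b :: suf)).2 k
        ((b :: suf).map a)) k' u') k (suf.map a) =
        Function.update (Function.update (F pre (b :: suf)).2 k (suf.map a)) k' u' := by
      rw [Function.update_comm hk, Function.update_idem]
    obtain ⟨fl, hg, hh, hrun⟩ := H pre b suf (suf.map a) u' hbs
    simp only [hu]
    rw [run.eq_5, hrun, run.eq_5, run.eq_2, run.eq_1]
    simp only [Function.update_self, Function.update_idem, hg, hh]
    rw [ih (pre ++ [b]) (by simpa using hbs)]
    simp

theorem run_visit {β : Type} {k k' : Stack} (hk : k' ≠ k) {f : Flags → Sym → Flags}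
    {g : Flags → Sym} {h : Flags → Flags} {body : Prog} (bs : List β) (a a' : β → Sym)
    (F : List β → List β → Flags × (Stack → List Sym))
    (H : ∀ pre b suf u u', pre ++ b :: suf = bs → ∃ fl, g fl = a' b ∧
      h fl = (F (pre ++ [b]) suf).1 ∧
      body.run ⟨⟨{}, f (F pre (b :: suf)).1 (a b)⟩,
        Function.update (Function.update (F pre (b :: suf)).2 k u) k' u'⟩ =
      ⟨⟨{}, fl⟩, Function.update (Function.update (F (pre ++ [b]) suf).2 k u) k' u'⟩) :
    (visit k k' f g h body).run
      ⟨⟨{}, (F [] bs).1⟩, Function.update (Function.update (F [] bs).2 k (bs.map a)) k' []⟩ =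
    ⟨⟨{}, (F bs []).1⟩, Function.update (Function.update (F bs []).2 k (bs.map a')) k' []⟩ := by
  have := loopRun_visit hk a a' F H [] bs rfl []
  rw [visit, run, run.eq_7]
  simp only [Function.update_of_ne hk.symm, Function.update_self, List.length_map]
  rw [this, run_pour hk.symm]
  congr 1
  funext j
  by_cases hj : j = k
  · subst hj; simp [hk.symm]
  · by_cases hj' : j = k'
    · subst hj'; simp [hj]
    · simp [hj, hj']

/-- Execute the body as often as the counter `k` says. -/
def each (k k' : Stack) (body : Prog) : Prog :=
  visit k k' (fun v _ => v) (fun _ => tick) id body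

/-- The counter contains only ticks; the list `bs` of objects that the rounds stand for exists only
in the proof. -/
theorem run_each {β : Type} {k k' : Stack} (hk : k' ≠ k) {body : Prog} (bs : List β)
    (F : List β → List β → Flags × (Stack → List Sym))
    (H : ∀ pre b suf u u', pre ++ b :: suf = bs →
      body.run ⟨⟨{}, (F pre (b :: suf)).1⟩,
        Function.update (Function.update (F pre (b :: suf)).2 k u) k' u'⟩ =
      ⟨⟨{}, (F (pre ++ [b]) suf).1⟩,
        Function.update (Function.update (F (pre ++ [b]) suf).2 k u) k' u'⟩)
    {fl fl' : Flags} {S S' : Stack → List Sym} (h₁ : (F [] bs).1 = fl) (h₂ : (F bs []).1 = fl')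
    (h₃ : Function.update (Function.update (F [] bs).2 k
      (List.replicate bs.length tick)) k' [] = S)
    (h₄ : Function.update (Function.update (F bs []).2 k
      (List.replicate bs.length tick)) k' [] = S') :
    (each k k' body).run ⟨⟨{}, fl⟩, S⟩ = ⟨⟨{}, fl'⟩, S'⟩ := by
  have := run_visit hk (f := fun v _ => v) (g := fun _ => tick) (h := id) (body := body) bs
    (fun _ => tick) (fun _ => tick) F
    (fun pre b suf u u' hb => ⟨_, rfl, rfl, H pre b suf u u' hb⟩)
  simp only [List.map_const', h₁, h₂, h₃, h₄] at this
  exact this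

/-! #### The program -/

/-- Note whether the user under consideration is put on the server under consideration with the
level under consideration. -/
def Flags.readChoice (fl : Flags) (x : Bool) : Flags :=
  { fl with
    x := x
    used := fl.used || x
    badCov := fl.badCov || (x && !fl.cov)
    badOnce := fl.badOnce || (x && fl.used) }

def Flags.recordCap (fl : Flags) (b : Bool) : Flags := { fl with badCap := fl.badCap || b }

def Flags.recordQoE (fl : Flags) (b : Bool) : Flags :=
  { fl with x := false, exceeded := fl.exceeded || b }

/-- Consider one level for one user on one server. -/
def levelProg : Prog :=
  pop .inp (fun v a => ⟨v.tmp, v.flags.readChoice (decide (a = some (.inr true)))⟩) ;;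
  each .dim .dim' (subtract .cap .cap' .req .req' Flags.recordCap) ;;
  pour .cap' .cap ;;
  subtract .thr .thr' .qoe .qoe' Flags.recordQoE ;;
  pour .thr' .thr

/-- Consider one user on one server. -/
def userProg : Prog :=
  pop .cov (fun v a => ⟨v.tmp, { v.flags with cov := decide (a = some (.inl (some true))) }⟩) ;;
  each .lvl .lvl' levelProg ;;
  pour .req' .req ;;
  pour .qoe' .qoe

/-- Consider one server. -/
def serverProg : Prog :=
  visit .usr .usr' (fun fl a => { fl with used := decide (a = .inl (some true)) })
    (fun fl => .inl (some fl.used)) (fun fl => { fl with used := false, cov := false }) userProg ;;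
  each .dim .dim' (moveNumber .cap .trash) ;;
  clear [.trash]

/-- Distribute the input over the stacks. -/
def parseProg : Prog :=
  readUnary .usr ;; readUnary .srv ;; readUnary .dim ;; readUnary .lvl ;;
  moveNumber .inp .trash ;; moveNumber .inp .trash ;; clear [.trash] ;;
  each .srv .srv' (each .usr .usr' (mv .inp .cov' fun v _ => v)) ;; pour .cov' .cov ;;
  each .srv .srv' (each .dim .dim' (moveNumber .inp .cap')) ;; pour .cap' .cap ;;
  each .lvl .lvl' (each .dim .dim' (moveNumber .inp .req')) ;; pour .req' .req ;;
  each .lvl .lvl' (moveNumber .inp .qoe') ;; pour .qoe' .qoe ;;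
  moveNumber .inp .thr' ;; pour .thr' .thr

def verifier : Prog := parseProg ;; each .srv .srv' serverProg

/-- A loop counts as growth zero, so each body here is made of pieces without growth and at most one
push per branch. Counters are refilled only after their loop, from the partner stack. -/
theorem tame_verifier : verifier.Tame := by
  simp [verifier, parseProg, serverProg, userProg, levelProg, each, visit, readUnary, moveNumber,
    pour, copy, clear, subtract, subtractBit, subtractExcess, Tame, NoPush, growth]

end StackProgram

namespace StackProgram

open Cmd

/-! #### The effect of the verifier -/

/-- The data that change in the course of the verification: the remaining resources of the server
under consideration, the remaining threshold, and the flags. -/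
structure Ledger (δ : Type) where
  caps : δ → List Bool
  thr : List Bool
  flags : Flags

section Effect

variable {δ ι υ ς : Type}

/-- The effect of considering one level -/
def Ledger.level (ks : List δ) (x : Bool) (w : δ → List Bool) (e : List Bool) (G : Ledger δ) :
    Ledger δ where
  caps k := (subBits x false (G.caps k) (w k)).1
  thr := (subBits x false G.thr e).1
  flags := ((G.flags.readChoice x).recordCap
    (ks.any fun k => (subBits x false (G.caps k) (w k)).2)).recordQoE (subBits x false G.thr e).2

/-- The effect of considering all levels for one user on one server -/
def Ledger.user (ks : List δ) (ls : List ι) (w : ι → δ → List Bool) (e : ι → List Bool)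
    (x : ι → Bool) (G : Ledger δ) : Ledger δ :=
  ls.foldl (fun G l => G.level ks (x l) (w l) (e l)) G

/-- Note the data of a user. -/
def Ledger.enter (cov used : Bool) (G : Ledger δ) : Ledger δ :=
  { G with flags := { G.flags with cov := cov, used := used } }

/-- The effect of considering all users on one server -/
def Ledger.server (ks : List δ) (ls : List ι) (w : ι → δ → List Bool) (e : ι → List Bool)
    (is : List υ) (cov used : υ → Bool) (x : υ → ι → Bool) (G : Ledger δ) : Ledger δ :=
  is.foldl (fun G i =>
    ((G.enter (cov i) (used i)).user ks ls w e (x i)).enter false false) G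

/-- The effect of considering one more server; the second component says which users have been
allocated. -/
def serverStep (ks : List δ) (ls : List ι) (w : ι → δ → List Bool) (e : ι → List Bool)
    (is : List υ) (c : ς → δ → List Bool) (cov : ς → υ → Bool) (x : ς → υ → ι → Bool)
    (p : Ledger δ × (υ → Bool)) (j : ς) : Ledger δ × (υ → Bool) :=
  (Ledger.server ks ls w e is (cov j) p.2 (x j) { p.1 with caps := c j },
    fun i => p.2 i || ls.any (x j i))

/-- This is the bit that is written back on the counter of users, where the next server finds it. -/
theorem used_user (ks : List δ) (ls : List ι) (w : ι → δ → List Bool) (e : ι → List Bool)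
    (x : ι → Bool) (G : Ledger δ) :
    (G.user ks ls w e x).flags.used = (G.flags.used || ls.any x) := by
  induction ls generalizing G with
  | nil => simp [Ledger.user]
  | cons l ls ih =>
    have := ih (G.level ks (x l) (w l) (e l))
    simp only [Ledger.user, List.foldl_cons, List.any_cons] at this ⊢
    rw [this]
    simp [Ledger.level, Flags.readChoice, Flags.recordCap, Flags.recordQoE, Bool.or_assoc]

/-- The string `y`, followed by zeros, starts with the values of `x` on `bs`. -/
def Reads {β : Type} (y : List Bool) (bs : List β) (x : β → Bool) : Prop :=
  ∀ pre b suf, pre ++ b :: suf = bs → y.getD pre.length false = x b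

/-- Capacities and demands are consumed in parallel and pile up in reverse on the partner stacks. In
the use below, `cr` holds the capacities of later servers and `rr` the demands of later levels. -/
theorem run_each_subtract (ks : List δ) (c w : δ → List Bool) (cr rr : List Sym)
    (fl : Flags) (S : Stack → List Sym) (hdim : S .dim = List.replicate ks.length tick)
    (hdim' : S .dim' = []) (hcap : S .cap = ks.flatMap (fun k => encodeBits (c k)) ++ cr)
    (hreq : S .req = ks.flatMap (fun k => encodeBits (w k)) ++ rr) :
    (each .dim .dim' (subtract .cap .cap' .req .req' Flags.recordCap)).run ⟨⟨{}, fl⟩, S⟩ =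
    ⟨⟨{}, fl.recordCap (ks.any fun k => (subBits fl.x false (c k) (w k)).2)⟩, fun
      | .cap => cr
      | .cap' => (ks.flatMap fun k => encodeBits (subBits fl.x false (c k) (w k)).1).reverse ++
        S .cap'
      | .req => rr
      | .req' => (ks.flatMap fun k => encodeBits (w k)).reverse ++ S .req'
      | j => S j⟩ := by
  refine run_each (by decide) ks (fun pre suf =>
    (fl.recordCap (pre.any fun k => (subBits fl.x false (c k) (w k)).2), fun
      | .cap => suf.flatMap (fun k => encodeBits (c k)) ++ cr
      | .cap' => (pre.flatMap fun k => encodeBits (subBits fl.x false (c k) (w k)).1).reverse ++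
        S .cap'
      | .req => suf.flatMap (fun k => encodeBits (w k)) ++ rr
      | .req' => (pre.flatMap fun k => encodeBits (w k)).reverse ++ S .req'
      | j => S j)) ?_ ?_ rfl ?_ ?_
  · intro pre b suf u u' _
    rw [run_subtract (by decide) Flags.recordCap (cs := c b) (ws := w b)
      (r := suf.flatMap (fun k => encodeBits (c k)) ++ cr)
      (r' := suf.flatMap (fun k => encodeBits (w k)) ++ rr) (by simp) (by simp)]
    congr 1
    · simp [Flags.recordCap, Bool.or_assoc]
    · funext j
      cases j <;> simp [put, Flags.recordCap]
  · simp [Flags.recordCap]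
  · funext j
    cases j <;> simp [hcap, hreq, hdim, hdim']
  · funext j
    cases j <;> simp [hdim, hdim']

theorem run_levelProg (ks : List δ) (x : Bool) (w : δ → List Bool) (e : List Bool) (G : Ledger δ)
    (y : List Bool) (cr rr er : List Sym) (S : Stack → List Sym)
    (hx : y.headD false = x) (hinp : S .inp = y.map .inr)
    (hdim : S .dim = List.replicate ks.length tick) (hdim' : S .dim' = [])
    (hcap : S .cap = ks.flatMap (fun k => encodeBits (G.caps k)) ++ cr) (hcap' : S .cap' = [])
    (hreq : S .req = ks.flatMap (fun k => encodeBits (w k)) ++ rr)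
    (hthr : S .thr = encodeBits G.thr) (hthr' : S .thr' = [])
    (hqoe : S .qoe = encodeBits e ++ er) :
    levelProg.run ⟨⟨{}, G.flags⟩, S⟩ = ⟨⟨{}, (G.level ks x w e).flags⟩, fun
      | .inp => y.tail.map .inr
      | .cap => ks.flatMap (fun k => encodeBits ((G.level ks x w e).caps k)) ++ cr
      | .req => rr
      | .req' => (ks.flatMap fun k => encodeBits (w k)).reverse ++ S .req'
      | .thr => encodeBits (G.level ks x w e).thr
      | .qoe => er
      | .qoe' => (encodeBits e).reverse ++ S .qoe'
      | j => S j⟩ := by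
  -- Past the end of the certificate the pop yields nothing, which counts as the bit `false`;
  -- certificates of every length thus describe an allocation.
  have hx' : decide ((S .inp).head? = some (.inr true)) = x := by
    subst hx
    rw [hinp]
    cases y with
    | nil => simp
    | cons b y => cases b <;> simp
  rw [levelProg, run.eq_5, run.eq_3]
  simp only [hx']
  rw [run.eq_5, run_each_subtract ks G.caps w cr rr _ _ (by simpa) (by simpa) (by simpa)
    (by simpa), run.eq_5, run_pour (by decide), run.eq_5,
    run_subtract (by decide) Flags.recordQoE (cs := G.thr) (ws := e) (r := []) (r' := er)
      (by simpa) (by simpa), run_pour (by decide)]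
  congr 1
  funext j
  cases j <;> simp [put, hinp, hcap', hthr', Ledger.level, Flags.readChoice, Flags.recordCap]

theorem run_each_levelProg (ks : List δ) (ls : List ι) (w : ι → δ → List Bool)
    (e : ι → List Bool) (x : ι → Bool) (G : Ledger δ)
    (y : List Bool) (cr rr er : List Sym) (S : Stack → List Sym)
    (hx : Reads y ls x) (hinp : S .inp = y.map .inr)
    (hdim : S .dim = List.replicate ks.length tick) (hdim' : S .dim' = [])
    (hlvl : S .lvl = List.replicate ls.length tick) (hlvl' : S .lvl' = [])
    (hcap : S .cap = ks.flatMap (fun k => encodeBits (G.caps k)) ++ cr) (hcap' : S .cap' = [])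
    (hreq : S .req = ls.flatMap (fun l => ks.flatMap fun k => encodeBits (w l k)) ++ rr)
    (hthr : S .thr = encodeBits G.thr) (hthr' : S .thr' = [])
    (hqoe : S .qoe = ls.flatMap (fun l => encodeBits (e l)) ++ er) :
    (each .lvl .lvl' levelProg).run ⟨⟨{}, G.flags⟩, S⟩ =
    ⟨⟨{}, (G.user ks ls w e x).flags⟩, fun
      | .inp => (y.drop ls.length).map .inr
      | .cap => ks.flatMap (fun k => encodeBits ((G.user ks ls w e x).caps k)) ++ cr
      | .req => rr
      | .req' => (ls.flatMap fun l => ks.flatMap fun k => encodeBits (w l k)).reverse ++ S .req'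
      | .thr => encodeBits (G.user ks ls w e x).thr
      | .qoe => er
      | .qoe' => (ls.flatMap fun l => encodeBits (e l)).reverse ++ S .qoe'
      | j => S j⟩ := by
  refine run_each (by decide) ls (fun pre suf => ((G.user ks pre w e x).flags, fun
      | .inp => (y.drop pre.length).map .inr
      | .cap => ks.flatMap (fun k => encodeBits ((G.user ks pre w e x).caps k)) ++ cr
      | .req => suf.flatMap (fun l => ks.flatMap fun k => encodeBits (w l k)) ++ rr
      | .req' => (pre.flatMap fun l => ks.flatMap fun k => encodeBits (w l k)).reverse ++ S .req'
      | .thr => encodeBits (G.user ks pre w e x).thr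
      | .qoe => suf.flatMap (fun l => encodeBits (e l)) ++ er
      | .qoe' => (pre.flatMap fun l => encodeBits (e l)).reverse ++ S .qoe'
      | j => S j)) ?_ rfl rfl ?_ ?_
  · intro pre b suf u u' hb
    rw [run_levelProg ks (x b) (w b) (e b) (G.user ks pre w e x) (y.drop pre.length) cr
      (suf.flatMap (fun l => ks.flatMap fun k => encodeBits (w l k)) ++ rr)
      (suf.flatMap (fun l => encodeBits (e l)) ++ er) _ ?_ (by simp) (by simpa) (by simpa)
      (by simp) (by simpa) (by simp) (by simp) (by simpa) (by simp)]
    · have hstep : G.user ks (pre ++ [b]) w e x =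
          (G.user ks pre w e x).level ks (x b) (w b) (e b) := by simp [Ledger.user]
      rw [hstep]
      congr 1
      funext j
      cases j <;> simp
    · rw [← hx pre b suf hb]
      simp [List.headD_eq_head?_getD]
  · funext j
    cases j <;> simp [hinp, hcap, hreq, hdim, hdim', hlvl, hlvl', hthr, hqoe, Ledger.user]
  · funext j
    cases j <;> simp [hlvl, hlvl']

/-- The demands and QoE values are poured back, so that every user finds the data of all levels
intact; the reduced capacities and threshold stay. -/
theorem run_userProg (ks : List δ) (ls : List ι) (w : ι → δ → List Bool)
    (e : ι → List Bool) (x : ι → Bool) (cov : Bool) (G : Ledger δ)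
    (y : List Bool) (cr covr : List Sym) (S : Stack → List Sym)
    (hx : Reads y ls x) (hinp : S .inp = y.map .inr)
    (hdim : S .dim = List.replicate ks.length tick) (hdim' : S .dim' = [])
    (hlvl : S .lvl = List.replicate ls.length tick) (hlvl' : S .lvl' = [])
    (hcov : S .cov = .inl (some cov) :: covr)
    (hcap : S .cap = ks.flatMap (fun k => encodeBits (G.caps k)) ++ cr) (hcap' : S .cap' = [])
    (hreq : S .req = ls.flatMap (fun l => ks.flatMap fun k => encodeBits (w l k)))
    (hreq' : S .req' = [])
    (hthr : S .thr = encodeBits G.thr) (hthr' : S .thr' = [])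
    (hqoe : S .qoe = ls.flatMap (fun l => encodeBits (e l))) (hqoe' : S .qoe' = []) :
    userProg.run ⟨⟨{}, G.flags⟩, S⟩ =
    ⟨⟨{}, ((G.enter cov G.flags.used).user ks ls w e x).flags⟩, fun
      | .inp => (y.drop ls.length).map .inr
      | .cov => covr
      | .cap => ks.flatMap (fun k =>
          encodeBits (((G.enter cov G.flags.used).user ks ls w e x).caps k)) ++ cr
      | .thr => encodeBits ((G.enter cov G.flags.used).user ks ls w e x).thr
      | j => S j⟩ := by
  have hc : decide ((S .cov).head? = some (.inl (some true))) = cov := by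
    rw [hcov]
    cases cov <;> simp
  rw [userProg, run.eq_5, run.eq_3]
  simp only [hc]
  rw [run.eq_5]
  have := run_each_levelProg ks ls w e x (G.enter cov G.flags.used) y cr [] []
    (Function.update S .cov (S .cov).tail) hx (by simpa) (by simpa) (by simpa) (by simpa)
    (by simpa) (by simpa) (by simpa) (by simpa) (by simpa) (by simpa) (by simpa)
  simp only [Ledger.enter] at this ⊢
  rw [this, run.eq_5, run_pour (by decide), run_pour (by decide)]
  congr 1
  funext j
  cases j <;> simp [hcov, hreq, hreq', hqoe, hqoe']

theorem run_each_moveNumber {k k' src dst : Stack} (hd : [k, k', src, dst].Nodup)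
    (ks : List δ) (c : δ → List Bool) (r : List Sym) (fl : Flags) {S : Stack → List Sym}
    (hk : S k = List.replicate ks.length tick) (hk' : S k' = [])
    (hsrc : S src = ks.flatMap (fun k => encodeBits (c k)) ++ r) :
    (each k k' (moveNumber src dst)).run ⟨⟨{}, fl⟩, S⟩ =
      ⟨⟨{}, fl⟩, put k k' src dst S (S k) (S k') r
        ((ks.flatMap fun k => encodeBits (c k)).reverse ++ S dst)⟩ := by
  have hne : k' ≠ k := by rintro rfl; simp at hd
  have hne' : dst ≠ src := by rintro rfl; simp at hd
  refine run_each hne ks (fun pre suf => (fl, put k k' src dst S [] []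
    (suf.flatMap (fun k => encodeBits (c k)) ++ r)
    ((pre.flatMap fun k => encodeBits (c k)).reverse ++ S dst))) ?_ rfl rfl ?_ ?_
  · intro pre b suf u u' _
    simp only [update_put hd]
    rw [run_moveNumber hne' (c := c b) (r := suf.flatMap (fun k => encodeBits (c k)) ++ r)
      (by simp [put_apply hd])]
    simp [update_put hd, put_apply hd]
  · simp only [update_put hd, ← hk, ← hsrc, ← hk']
    simpa using put_self S
  · simp only [update_put hd, hk, hk', List.flatMap_nil, List.nil_append]

theorem run_serverProg (ks : List δ) (ls : List ι) (w : ι → δ → List Bool)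
    (e : ι → List Bool) (is : List υ) (cov used : υ → Bool) (x : υ → ι → Bool) (G : Ledger δ)
    (y : List Bool) (cr covr : List Sym) (S : Stack → List Sym)
    (hx : ∀ pre i suf, pre ++ i :: suf = is →
      Reads (y.drop (pre.length * ls.length)) ls (x i))
    (hinp : S .inp = y.map .inr)
    (husr : S .usr = is.map fun i => .inl (some (used i))) (husr' : S .usr' = [])
    (hdim : S .dim = List.replicate ks.length tick) (hdim' : S .dim' = [])
    (hlvl : S .lvl = List.replicate ls.length tick) (hlvl' : S .lvl' = [])
    (hcov : S .cov = is.map (fun i => .inl (some (cov i))) ++ covr)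
    (hcap : S .cap = ks.flatMap (fun k => encodeBits (G.caps k)) ++ cr) (hcap' : S .cap' = [])
    (hreq : S .req = ls.flatMap (fun l => ks.flatMap fun k => encodeBits (w l k)))
    (hreq' : S .req' = [])
    (hthr : S .thr = encodeBits G.thr) (hthr' : S .thr' = [])
    (hqoe : S .qoe = ls.flatMap (fun l => encodeBits (e l))) (hqoe' : S .qoe' = [])
    (htrash : S .trash = []) :
    serverProg.run ⟨⟨{}, G.flags⟩, S⟩ =
    ⟨⟨{}, (G.server ks ls w e is cov used x).flags⟩, fun
      | .inp => (y.drop (is.length * ls.length)).map .inr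
      | .usr => is.map fun i => .inl (some (used i || ls.any (x i)))
      | .cov => covr
      | .cap => cr
      | .thr => encodeBits (G.server ks ls w e is cov used x).thr
      | j => S j⟩ := by
  have hvisit := run_visit (k := .usr) (k' := .usr') (by decide)
    (f := fun fl a => { fl with used := decide (a = .inl (some true)) })
    (g := fun fl => .inl (some fl.used)) (h := fun fl => { fl with used := false, cov := false })
    (body := userProg) is (fun i => .inl (some (used i)))
    (fun i => .inl (some (used i || ls.any (x i))))
    (fun pre suf => ((G.server ks ls w e pre cov used x).flags, fun
      | .inp => (y.drop (pre.length * ls.length)).map .inr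
      | .cov => suf.map (fun i => .inl (some (cov i))) ++ covr
      | .cap => ks.flatMap (fun k =>
          encodeBits ((G.server ks ls w e pre cov used x).caps k)) ++ cr
      | .thr => encodeBits (G.server ks ls w e pre cov used x).thr
      | j => S j)) (by
    intro pre i suf u u' hi
    have hstep : G.server ks ls w e (pre ++ [i]) cov used x =
        (((G.server ks ls w e pre cov used x).enter (cov i) (used i)).user ks ls w e
          (x i)).enter false false := by simp [Ledger.server]
    refine ⟨(((G.server ks ls w e pre cov used x).enter (cov i) (used i)).user ks ls w e
      (x i)).flags, ?_, ?_, ?_⟩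
    · simp [used_user, Ledger.enter]
    · rw [hstep]; rfl
    -- When the body starts, `used` has been read off the counter while `cov` is still the old flag,
    -- so the ledger is entered with just the former changed.
    · have := run_userProg ks ls w e (x i) (cov i)
        ((G.server ks ls w e pre cov used x).enter
          (G.server ks ls w e pre cov used x).flags.cov (used i))
        (y.drop (pre.length * ls.length)) cr
        (suf.map (fun i => .inl (some (cov i))) ++ covr)
        (Function.update (Function.update (fun
          | .inp => (y.drop (pre.length * ls.length)).map .inr
          | .cov => (i :: suf).map (fun i => .inl (some (cov i))) ++ covr
          | .cap => ks.flatMap (fun k =>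
              encodeBits ((G.server ks ls w e pre cov used x).caps k)) ++ cr
          | .thr => encodeBits (G.server ks ls w e pre cov used x).thr
          | j => S j) .usr u) .usr' u') (hx pre i suf hi) (by simp) (by simpa) (by simpa)
        (by simpa) (by simpa) (by simp) (by simp [Ledger.enter]) (by simpa) (by simpa) (by simpa)
        (by simp [Ledger.enter]) (by simpa) (by simpa) (by simpa)
      have hused : decide ((.inl (some (used i)) : Sym) = .inl (some true)) = used i := by
        cases used i <;> simp
      rw [hstep, hused]
      refine Eq.trans this ?_
      congr 1
      funext j
      cases j <;> simp [Ledger.enter, add_mul, Ledger.enter])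
  have hS : Function.update (Function.update (fun
      | .inp => (y.drop (([] : List υ).length * ls.length)).map .inr
      | .cov => is.map (fun i => .inl (some (cov i))) ++ covr
      | .cap => ks.flatMap (fun k =>
          encodeBits ((G.server ks ls w e ([] : List υ) cov used x).caps k)) ++ cr
      | .thr => encodeBits (G.server ks ls w e ([] : List υ) cov used x).thr
      | j => S j) Stack.usr (is.map fun i => (.inl (some (used i)) : Sym))) .usr' [] = S := by
    funext j
    cases j <;> simp [hinp, hcov, hcap, hthr, husr, husr', Ledger.server]
  rw [hS] at hvisit
  rw [serverProg, run.eq_5]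
  refine (congrArg _ hvisit).trans ?_
  -- What is left of this server's capacities is discarded, which exposes those of the next one.
  rw [run.eq_5, run_each_moveNumber (by decide) ks
    (G.server ks ls w e is cov used x).caps cr _ (by simpa) (by simpa) (by simp), run_clear]
  congr 1
  funext j
  cases j <;> simp [put, htrash, husr']

/-- Only the flags are needed in the end. The offsets in `hx` reflect the order in which certificate
bits are used: by server, then user, then level. -/
theorem run_each_serverProg (ks : List δ) (ls : List ι) (w : ι → δ → List Bool)
    (e : ι → List Bool) (is : List υ) (js : List ς) (c : ς → δ → List Bool)
    (cov : ς → υ → Bool) (x : ς → υ → ι → Bool) (G : Ledger δ)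
    (y : List Bool) (S : Stack → List Sym)
    (hx : ∀ pre' j suf', pre' ++ j :: suf' = js → ∀ pre i suf, pre ++ i :: suf = is →
      Reads (y.drop ((pre'.length * is.length + pre.length) * ls.length)) ls (x j i))
    (hinp : S .inp = y.map .inr)
    (hsrv : S .srv = List.replicate js.length tick) (hsrv' : S .srv' = [])
    (husr : S .usr = List.replicate is.length tick) (husr' : S .usr' = [])
    (hdim : S .dim = List.replicate ks.length tick) (hdim' : S .dim' = [])
    (hlvl : S .lvl = List.replicate ls.length tick) (hlvl' : S .lvl' = [])
    (hcov : S .cov = js.flatMap fun j => is.map fun i => .inl (some (cov j i)))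
    (hcap : S .cap = js.flatMap fun j => ks.flatMap fun k => encodeBits (c j k))
    (hcap' : S .cap' = [])
    (hreq : S .req = ls.flatMap (fun l => ks.flatMap fun k => encodeBits (w l k)))
    (hreq' : S .req' = [])
    (hthr : S .thr = encodeBits G.thr) (hthr' : S .thr' = [])
    (hqoe : S .qoe = ls.flatMap (fun l => encodeBits (e l))) (hqoe' : S .qoe' = [])
    (htrash : S .trash = []) :
    ((each .srv .srv' serverProg).run ⟨⟨{}, G.flags⟩, S⟩).reg.flags =
      (js.foldl (serverStep ks ls w e is c cov x) (G, fun _ => false)).1.flags := by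
  refine congrArg (fun s : Store Stack Sym Reg => s.reg.flags) (run_each (by decide) js
    (fun pre suf =>
      ((pre.foldl (serverStep ks ls w e is c cov x) (G, fun _ => false)).1.flags, fun
      | .inp => (y.drop (pre.length * is.length * ls.length)).map .inr
      | .usr => is.map fun i => .inl (some
          ((pre.foldl (serverStep ks ls w e is c cov x) (G, fun _ => false)).2 i))
      | .cov => suf.flatMap fun j => is.map fun i => .inl (some (cov j i))
      | .cap => suf.flatMap fun j => ks.flatMap fun k => encodeBits (c j k)
      | .thr => encodeBits
          (pre.foldl (serverStep ks ls w e is c cov x) (G, fun _ => false)).1.thr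
      | j => S j)) ?_ rfl rfl ?_ rfl)
  · intro pre j suf u u' hj
    set p := pre.foldl (serverStep ks ls w e is c cov x) (G, fun _ => false) with hp
    have hstep : (pre ++ [j]).foldl (serverStep ks ls w e is c cov x) (G, fun _ => false) =
        serverStep ks ls w e is c cov x p j := by simp [hp]
    rw [hstep]
    have := run_serverProg ks ls w e is (cov j) p.2 (x j) { p.1 with caps := c j }
      (y.drop (pre.length * is.length * ls.length))
      (suf.flatMap fun j => ks.flatMap fun k => encodeBits (c j k))
      (suf.flatMap fun j => is.map fun i => .inl (some (cov j i)))
      (Function.update (Function.update (fun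
      | .inp => (y.drop (pre.length * is.length * ls.length)).map .inr
      | .usr => is.map fun i => .inl (some (p.2 i))
      | .cov => (j :: suf).flatMap fun j => is.map fun i => .inl (some (cov j i))
      | .cap => (j :: suf).flatMap fun j => ks.flatMap fun k => encodeBits (c j k)
      | .thr => encodeBits p.1.thr
      | j => S j) .srv u) .srv' u')
      (fun pre' i suf' hi => by
        have := hx pre j suf hj pre' i suf' hi
        rwa [List.drop_drop, ← add_mul])
      (by simp) (by simp) (by simpa) (by simpa) (by simpa) (by simpa) (by simpa) (by simp)
      (by simp) (by simpa) (by simpa) (by simpa) (by simp) (by simpa) (by simpa) (by simpa)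
      (by simpa)
    refine Eq.trans this ?_
    congr 1
    funext k
    cases k <;> simp [serverStep, add_mul]
  -- Initially no user is allocated, and the list of these `false` bits is the unary counter itself,
  -- since `tick` carries the bit `false`.
  · funext k
    cases k <;> simp [hinp, husr, hcov, hcap, hthr, hsrv, hsrv']

end Effect

end StackProgram

namespace StackProgram

open Cmd

/-! #### Reading the instance -/

section Parse

variable {δ ι υ ς : Type}

theorem run_each_each_mv (js : List ς) (is : List υ) (cov : ς → υ → Bool) (r : List Sym)
    (fl : Flags) (S : Stack → List Sym)
    (hsrv : S .srv = List.replicate js.length tick) (hsrv' : S .srv' = [])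
    (husr : S .usr = List.replicate is.length tick) (husr' : S .usr' = [])
    (hinp : S .inp = js.flatMap (fun j => is.map fun i => .inl (some (cov j i))) ++ r) :
    (each .srv .srv' (each .usr .usr' (mv .inp .cov' fun v _ => v))).run ⟨⟨{}, fl⟩, S⟩ =
    ⟨⟨{}, fl⟩, fun
      | .inp => r
      | .cov' => (js.flatMap (fun j => is.map fun i => .inl (some (cov j i)))).reverse ++ S .cov'
      | j => S j⟩ := by
  refine run_each (by decide) js (fun pre suf => (fl, fun
      | .inp => suf.flatMap (fun j => is.map fun i => .inl (some (cov j i))) ++ r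
      | .cov' => (pre.flatMap (fun j => is.map fun i => .inl (some (cov j i)))).reverse ++ S .cov'
      | j => S j)) ?_ rfl rfl ?_ ?_
  · intro pre j suf u u' _
    refine run_each (by decide) is (fun pre' suf' => (fl, Function.update (Function.update (fun
      | .inp => suf'.map (fun i => .inl (some (cov j i))) ++
          suf.flatMap (fun j => is.map fun i => .inl (some (cov j i))) ++ r
      | .cov' => (pre'.map (fun i => .inl (some (cov j i)))).reverse ++
          (pre.flatMap (fun j => is.map fun i => .inl (some (cov j i)))).reverse ++ S .cov'
      | j => S j) .srv u) .srv' u')) ?_ rfl rfl ?_ ?_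
    · intro pre' i suf' u u' _
      simp only [run]
      simp only [ne_eq, reduceCtorEq, not_false_eq_true, Function.update_of_ne, List.map_cons,
        List.cons_append]
      congr 1
      funext k
      cases k <;> simp
    · funext k
      cases k <;> simp [husr, husr']
    · funext k
      cases k <;> simp [husr, husr']
  · funext k
    cases k <;> simp [hinp, hsrv, hsrv']
  · funext k
    cases k <;> simp [hsrv, hsrv']

theorem run_each_each_moveNumber {k₁ k₁' dst : Stack}
    (hd : [k₁, k₁', .dim, .dim', .inp, dst].Nodup) (js : List ς) (ks : List δ)
    (c : ς → δ → List Bool) (r : List Sym) (fl : Flags) (S : Stack → List Sym)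
    (hk₁ : S k₁ = List.replicate js.length tick) (hk₁' : S k₁' = [])
    (hdim : S .dim = List.replicate ks.length tick) (hdim' : S .dim' = [])
    (hinp : S .inp = js.flatMap (fun j => ks.flatMap fun k => encodeBits (c j k)) ++ r) :
    (each k₁ k₁' (each .dim .dim' (moveNumber .inp dst))).run ⟨⟨{}, fl⟩, S⟩ =
    ⟨⟨{}, fl⟩, Function.update (Function.update S .inp r) dst
      ((js.flatMap (fun j => ks.flatMap fun k => encodeBits (c j k))).reverse ++ S dst)⟩ := by
  have hd' : [Stack.dim, .dim', .inp, dst].Nodup := by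
    simp only [List.nodup_cons, List.mem_cons, not_or] at hd ⊢
    tauto
  simp only [List.nodup_cons, List.mem_cons, List.not_mem_nil, or_false, not_or] at hd
  obtain ⟨⟨h₁, h₂, h₃, h₄, h₅⟩, ⟨h₆, h₇, h₈, h₉⟩, ⟨-, -, h₁₀⟩, ⟨-, h₁₁⟩, h₁₂, -⟩ := hd
  refine run_each (Ne.symm h₁) js (fun pre suf => (fl, Function.update (Function.update S .inp
    (suf.flatMap (fun j => ks.flatMap fun k => encodeBits (c j k)) ++ r)) dst
      ((pre.flatMap (fun j => ks.flatMap fun k => encodeBits (c j k))).reverse ++ S dst)))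
    ?_ rfl rfl ?_ ?_
  · intro pre j suf u u' _
    rw [run_each_moveNumber hd' ks (c j)
      (suf.flatMap (fun j => ks.flatMap fun k => encodeBits (c j k)) ++ r)]
    · congr 1
      funext k
      simp only [put, Function.update_apply]
      split_ifs <;> simp_all
    · simp [Ne.symm h₂, Ne.symm h₆, h₁₀, hdim]
    · simp [Ne.symm h₃, Ne.symm h₇, h₁₁, hdim']
    · simp [Ne.symm h₄, Ne.symm h₈, h₁₂]
  · funext k
    simp only [Function.update_apply]
    split_ifs <;> simp_all
  · funext k
    simp only [Function.update_apply]
    split_ifs <;> simp_all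

/-- Moving a block reverses it, and pouring it from the primed stack restores the order. The numbers
`a` and `b` are the two denominators, which are thrown away because no comparison depends on them.
-/
theorem run_parseProg (is : List υ) (js : List ς) (ks : List δ) (ls : List ι) (a b : List Bool)
    (cov : ς → υ → Bool) (c : ς → δ → List Bool) (w : ι → δ → List Bool) (e : ι → List Bool)
    (t : List Bool) (r : List Sym) (fl : Flags) :
    parseProg.run ⟨⟨{}, fl⟩, Function.update (fun _ => []) .inp
      ((RatInstance.encodeUnary is.length).map .inl ++
        ((RatInstance.encodeUnary js.length).map .inl ++
        ((RatInstance.encodeUnary ks.length).map .inl ++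
        ((RatInstance.encodeUnary ls.length).map .inl ++
        (encodeBits a ++ (encodeBits b ++
        (js.flatMap (fun j => is.map fun i => .inl (some (cov j i))) ++
        (js.flatMap (fun j => ks.flatMap fun k => encodeBits (c j k)) ++
        (ls.flatMap (fun l => ks.flatMap fun k => encodeBits (w l k)) ++
        (ls.flatMap (fun l => encodeBits (e l)) ++ (encodeBits t ++ r)))))))))))⟩ =
    ⟨⟨{}, fl⟩, fun
      | .inp => r
      | .usr => List.replicate is.length tick
      | .srv => List.replicate js.length tick
      | .dim => List.replicate ks.length tick
      | .lvl => List.replicate ls.length tick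
      | .cov => js.flatMap (fun j => is.map fun i => .inl (some (cov j i)))
      | .cap => js.flatMap (fun j => ks.flatMap fun k => encodeBits (c j k))
      | .req => ls.flatMap (fun l => ks.flatMap fun k => encodeBits (w l k))
      | .qoe => ls.flatMap (fun l => encodeBits (e l))
      | .thr => encodeBits t
      | _ => []⟩ := by
  -- Naming the tails of the input keeps each parsing step a rewrite of a single block.
  generalize hr₁ : encodeBits t ++ r = r₁
  generalize hr₂ : ls.flatMap (fun l => encodeBits (e l)) ++ r₁ = r₂
  generalize hr₃ : ls.flatMap (fun l => ks.flatMap fun k => encodeBits (w l k)) ++ r₂ = r₃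
  generalize hr₄ : js.flatMap (fun j => ks.flatMap fun k => encodeBits (c j k)) ++ r₃ = r₄
  generalize hr₅ : js.flatMap (fun j => is.map fun i => (.inl (some (cov j i)) : Sym)) ++ r₄ = r₅
  rw [parseProg, run.eq_5, run_readUnary (by decide) (by simp; rfl),
    run.eq_5, run_readUnary (by decide) (by simp; rfl),
    run.eq_5, run_readUnary (by decide) (by simp; rfl),
    run.eq_5, run_readUnary (by decide) (by simp; rfl),
    run.eq_5, run_moveNumber (by decide) (by simp; rfl),
    run.eq_5, run_moveNumber (by decide) (by simp; rfl),
    run.eq_5, run_clear,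
    run.eq_5, run_each_each_mv js is cov r₄ _ _ (by simp) (by simp) (by simp) (by simp)
      (by simp [hr₅]),
    run.eq_5, run_pour (by decide),
    run.eq_5, run_each_each_moveNumber (by decide) js ks c r₃ _ _ (by simp) (by simp) (by simp)
      (by simp) (by simp [hr₄]),
    run.eq_5, run_pour (by decide),
    run.eq_5, run_each_each_moveNumber (by decide) ls ks w r₂ _ _ (by simp) (by simp) (by simp)
      (by simp) (by simp [hr₃]),
    run.eq_5, run_pour (by decide),
    run.eq_5, run_each_moveNumber (by decide) ls e r₁ _ (by simp) (by simp) (by simp [hr₂]),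
    run.eq_5, run_pour (by decide),
    run.eq_5, run_moveNumber (by decide) (c := t) (r := r) (by simp [put, hr₁]),
    run_pour (by decide)]
  congr 1
  funext k
  cases k <;> simp [put]

end Parse

end StackProgram

/-- Row-major addressing: in a concatenation of blocks of width `w`, position `i * w + r` is entry
`r` of block `i`. -/
theorem List.getElem?_flatMap_of_length {α β : Type*} {f : α → List β} {w : ℕ}
    (hf : ∀ a, (f a).length = w) (l : List α) (i : ℕ) {r : ℕ} (hr : r < w) :
    (l.flatMap f)[i * w + r]? = l[i]?.bind fun a => (f a)[r]? := by
  induction l generalizing i with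
  | nil => simp
  | cons a l ih =>
    rw [List.flatMap_cons]
    cases i with
    | zero => rw [List.getElem?_append_left (by simp [hf, hr])]; simp
    | succ i =>
      rw [List.getElem?_append_right (by rw [hf]; nlinarith), hf,
        show (i + 1) * w + r - w = i * w + r by rw [add_mul]; omega, ih]
      simp

namespace StackProgram

open Cmd

/-! #### The results of the checks -/

section Checks

variable {δ ι υ ς : Type} (ks : List δ) (ls : List ι) (w : ι → δ → List Bool)
  (e : ι → List Bool) (is : List υ)

/-- The answer of the verifier -/
def Flags.accept (fl : Flags) : Bool :=
  !fl.badCov && !fl.badOnce && !fl.badCap && fl.exceeded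

/-- The flag is never lowered, and `cov` is constant while the levels of one user are scanned. -/
theorem badCov_user (x : ι → Bool) (G : Ledger δ) :
    (G.user ks ls w e x).flags.badCov = false ↔
      G.flags.badCov = false ∧ ∀ l ∈ ls, x l = true → G.flags.cov = true := by
  induction ls generalizing G with
  | nil => simp [Ledger.user]
  | cons l ls ih =>
    have := ih (G.level ks (x l) (w l) (e l))
    simp only [Ledger.user, List.foldl_cons, List.forall_mem_cons] at this ⊢
    rw [this]
    simp only [Ledger.level, Flags.readChoice, Flags.recordCap, Flags.recordQoE]
    cases G.flags.badCov <;> cases x l <;> cases G.flags.cov <;> simp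

theorem badCov_server (cov used : υ → Bool) (x : υ → ι → Bool) (G : Ledger δ) :
    (G.server ks ls w e is cov used x).flags.badCov = false ↔
      G.flags.badCov = false ∧ ∀ i ∈ is, ∀ l ∈ ls, x i l = true → cov i = true := by
  induction is generalizing G with
  | nil => simp [Ledger.server]
  | cons i is ih =>
    have := ih (((G.enter (cov i) (used i)).user ks ls w e (x i)).enter false false)
    simp only [Ledger.server, List.foldl_cons, List.forall_mem_cons] at this ⊢
    rw [this]
    have := badCov_user ks ls w e (x i) (G.enter (cov i) (used i))
    simp only [Ledger.enter] at this ⊢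
    rw [this, and_assoc]

theorem badCov_foldl (js : List ς) (c : ς → δ → List Bool) (cov : ς → υ → Bool)
    (x : ς → υ → ι → Bool) (p : Ledger δ × (υ → Bool)) :
    (js.foldl (serverStep ks ls w e is c cov x) p).1.flags.badCov = false ↔
      p.1.flags.badCov = false ∧
        ∀ j ∈ js, ∀ i ∈ is, ∀ l ∈ ls, x j i l = true → cov j i = true := by
  induction js generalizing p with
  | nil => simp
  | cons j js ih =>
    rw [List.foldl_cons, ih, List.forall_mem_cons, ← and_assoc]
    simp only [serverStep, badCov_server]

/-- The flag is raised by a choice made when `used` is already set. Counting `used` as one earlier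
choice turns this into a bound for a sum. -/
theorem badOnce_user (x : ι → Bool) (G : Ledger δ) :
    (G.user ks ls w e x).flags.badOnce = false ↔
      G.flags.badOnce = false ∧
        G.flags.used.toNat + (ls.map fun l => (x l).toNat).sum ≤ 1 := by
  induction ls generalizing G with
  | nil => simp [Ledger.user, Bool.toNat_le]
  | cons l ls ih =>
    have := ih (G.level ks (x l) (w l) (e l))
    simp only [Ledger.user, List.foldl_cons, List.map_cons, List.sum_cons] at this ⊢
    rw [this]
    simp only [Ledger.level, Flags.readChoice, Flags.recordCap, Flags.recordQoE]
    cases G.flags.badOnce <;> cases x l <;> cases G.flags.used <;> simp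

theorem badOnce_server (cov used : υ → Bool) (x : υ → ι → Bool) (G : Ledger δ) :
    (G.server ks ls w e is cov used x).flags.badOnce = false ↔
      G.flags.badOnce = false ∧
        ∀ i ∈ is, (used i).toNat + (ls.map fun l => (x i l).toNat).sum ≤ 1 := by
  induction is generalizing G with
  | nil => simp [Ledger.server]
  | cons i is ih =>
    have := ih (((G.enter (cov i) (used i)).user ks ls w e (x i)).enter false false)
    simp only [Ledger.server, List.foldl_cons, List.forall_mem_cons] at this ⊢
    rw [this]
    have := badOnce_user ks ls w e (x i) (G.enter (cov i) (used i))
    simp only [Ledger.enter] at this ⊢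
    rw [this, and_assoc]

/-- As long as there is at most one choice, a disjunction is as good as the count; this is why one
bit per user can carry the count from server to server. -/
theorem toNat_any_of_sum_le_one (ls : List ι) (x : ι → Bool) (u : Bool)
    (h : u.toNat + (ls.map fun l => (x l).toNat).sum ≤ 1) :
    (u || ls.any x).toNat = u.toNat + (ls.map fun l => (x l).toNat).sum := by
  induction ls generalizing u with
  | nil => simp
  | cons l ls ih =>
    have := ih (u || x l)
    simp only [List.any_cons, List.map_cons, List.sum_cons, ← Bool.or_assoc] at this h ⊢
    cases hu : u <;> cases hl : x l <;> simp_all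

theorem badOnce_foldl (js : List ς) (c : ς → δ → List Bool) (cov : ς → υ → Bool)
    (x : ς → υ → ι → Bool) (p : Ledger δ × (υ → Bool)) :
    (js.foldl (serverStep ks ls w e is c cov x) p).1.flags.badOnce = false ↔
      p.1.flags.badOnce = false ∧ ∀ i ∈ is, (p.2 i).toNat +
        (js.map fun j => (ls.map fun l => (x j i l).toNat).sum).sum ≤ 1 := by
  induction js generalizing p with
  | nil => simp [Bool.toNat_le]
  | cons j js ih =>
    rw [List.foldl_cons, ih]
    simp only [serverStep, badOnce_server, List.map_cons, List.sum_cons]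
    constructor
    · rintro ⟨⟨h₁, h₂⟩, h₃⟩
      refine ⟨h₁, fun i hi => ?_⟩
      have := h₃ i hi
      rw [toNat_any_of_sum_le_one ls _ _ (h₂ i hi)] at this
      omega
    · rintro ⟨h₁, h₂⟩
      have h₃ : ∀ i ∈ is, (p.2 i).toNat + (ls.map fun l => (x j i l).toNat).sum ≤ 1 :=
        fun i hi => by have := h₂ i hi; omega
      refine ⟨⟨h₁, h₃⟩, fun i hi => ?_⟩
      rw [toNat_any_of_sum_le_one ls _ _ (h₃ i hi)]
      have := h₂ i hi
      omega

/-- Between the two ledgers, the amounts `W` have been subtracted from the capacities. -/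
def CapRel (G : Ledger δ) (W : δ → ℕ) (G' : Ledger δ) : Prop :=
  (G'.flags.badCap = false → G.flags.badCap = false ∧
    ∀ k ∈ ks, bitsVal (G'.caps k) + W k = bitsVal (G.caps k)) ∧
  (G'.flags.badCap = true → G.flags.badCap = true ∨ ∃ k ∈ ks, bitsVal (G.caps k) < W k)

variable {ks} in
-- If the first stage overdraws, the larger total does so too; if it is exact, an overdraft in the
-- second stage is one of the total. Amounts left after a borrow are never used.
theorem CapRel.trans {G G' G'' : Ledger δ} {W W' : δ → ℕ} (h : CapRel ks G W G')
    (h' : CapRel ks G' W' G'') : CapRel ks G (fun k => W k + W' k) G'' := by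
  refine ⟨fun hb => ?_, fun hb => ?_⟩
  · obtain ⟨h₁, h₂⟩ := h'.1 hb
    obtain ⟨h₃, h₄⟩ := h.1 h₁
    exact ⟨h₃, fun k hk => by have := h₂ k hk; have := h₄ k hk; simp only; omega⟩
  · cases hG : G'.flags.badCap with
    | true =>
      rcases h.2 hG with h₁ | ⟨k, hk, h₁⟩
      · exact .inl h₁
      · exact .inr ⟨k, hk, by simp only; omega⟩
    | false =>
      obtain ⟨h₃, h₄⟩ := h.1 hG
      rcases h'.2 hb with h₁ | ⟨k, hk, h₁⟩
      · simp [h₁] at hG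
      · exact .inr ⟨k, hk, by have := h₄ k hk; simp only; omega⟩

theorem CapRel.refl (G : Ledger δ) : CapRel ks G (fun _ => 0) G :=
  ⟨fun h => ⟨h, fun _ _ => rfl⟩, fun h => .inl h⟩

theorem capRel_level (x : Bool) (w : δ → List Bool) (e : List Bool) (G : Ledger δ) :
    CapRel ks G (fun k => x.toNat * bitsVal (w k)) (G.level ks x w e) := by
  refine ⟨fun h => ?_, fun h => ?_⟩
  · simp only [Ledger.level, Flags.readChoice, Flags.recordCap, Flags.recordQoE,
      Bool.or_eq_false_iff, List.any_eq_false, Bool.not_eq_true] at h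
    exact ⟨h.1, fun k hk => by
      simpa [Ledger.level] using (subBits_spec x false (G.caps k) (w k)).1 (h.2 k hk)⟩
  · simp only [Ledger.level, Flags.readChoice, Flags.recordCap, Flags.recordQoE,
      Bool.or_eq_true, List.any_eq_true] at h
    refine h.imp_right fun ⟨k, hk, h⟩ => ⟨k, hk, ?_⟩
    simpa using (subBits_spec x false (G.caps k) (w k)).2 h

theorem capRel_user (x : ι → Bool) (G : Ledger δ) :
    CapRel ks G (fun k => (ls.map fun l => (x l).toNat * bitsVal (w l k)).sum)
      (G.user ks ls w e x) := by
  induction ls generalizing G with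
  | nil => exact .refl ks G
  | cons l ls ih =>
    simpa [Ledger.user] using (capRel_level ks (x l) (w l) (e l) G).trans (ih _)

theorem capRel_server (cov used : υ → Bool) (x : υ → ι → Bool) (G : Ledger δ) :
    CapRel ks G
      (fun k => (is.map fun i => (ls.map fun l => (x i l).toNat * bitsVal (w l k)).sum).sum)
      (G.server ks ls w e is cov used x) := by
  induction is generalizing G with
  | nil => exact .refl ks G
  | cons i is ih =>
    have h : CapRel ks G (fun k => (ls.map fun l => (x i l).toNat * bitsVal (w l k)).sum)
        (((G.enter (cov i) (used i)).user ks ls w e (x i)).enter false false) :=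
      capRel_user ks ls w e (x i) (G.enter (cov i) (used i))
    simpa [Ledger.server] using h.trans (ih _)

/-- Each server starts with its own fresh capacities, and only the flag is passed on, so the
conditions of the servers are independent. -/
theorem badCap_foldl (js : List ς) (c : ς → δ → List Bool) (cov : ς → υ → Bool)
    (x : ς → υ → ι → Bool) (p : Ledger δ × (υ → Bool)) :
    (js.foldl (serverStep ks ls w e is c cov x) p).1.flags.badCap = false ↔
      p.1.flags.badCap = false ∧ ∀ j ∈ js, ∀ k ∈ ks,
        (is.map fun i => (ls.map fun l => (x j i l).toNat * bitsVal (w l k)).sum).sum ≤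
          bitsVal (c j k) := by
  induction js generalizing p with
  | nil => simp
  | cons j js ih =>
    rw [List.foldl_cons, ih, List.forall_mem_cons, ← and_assoc]
    refine and_congr_left fun _ => ?_
    obtain ⟨h₁, h₂⟩ := capRel_server ks ls w e is (cov j) p.2 (x j) { p.1 with caps := c j }
    simp only [serverStep]
    constructor
    · intro h
      obtain ⟨h₃, h₄⟩ := h₁ h
      exact ⟨h₃, fun k hk => by have := h₄ k hk; simp only at this; omega⟩
    · rintro ⟨h₃, h₄⟩
      by_contra hb
      rcases h₂ (by simpa using hb) with h | ⟨k, hk, h⟩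
      · exact absurd (h₃.symm.trans h) Bool.false_ne_true
      · exact absurd (h₄ k hk) (not_le.2 h)

/-- The amount `W` has been subtracted from the threshold `t`. -/
def ThrRel (t W : ℕ) (G : Ledger δ) : Prop :=
  (G.flags.exceeded = false → bitsVal G.thr + W = t) ∧ (G.flags.exceeded = true → t < W)

variable {t W : ℕ}

/-- Once `t < W` holds it persists, as `W` only grows; what is then left of the threshold no longer
matters. -/
theorem ThrRel.level {G : Ledger δ} (h : ThrRel t W G) (x : Bool) (w : δ → List Bool)
    (e : List Bool) : ThrRel t (W + x.toNat * bitsVal e) (G.level ks x w e) := by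
  obtain ⟨h₁, h₂⟩ := subBits_spec x false G.thr e
  simp only [ThrRel, Ledger.level, Flags.readChoice, Flags.recordCap, Flags.recordQoE,
    Bool.or_eq_false_iff, Bool.or_eq_true, Bool.toNat_false, add_zero] at h₁ h₂ ⊢
  refine ⟨fun ⟨h₃, h₄⟩ => ?_, fun h₃ => ?_⟩
  · have := h.1 h₃
    have := h₁ h₄
    omega
  · cases hG : G.flags.exceeded with
    | true => have := h.2 hG; omega
    | false =>
      have := h.1 hG
      have := h₂ (h₃.resolve_left (by simp [hG]))
      omega

theorem ThrRel.user {G : Ledger δ} (h : ThrRel t W G) (x : ι → Bool) :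
    ThrRel t (W + (ls.map fun l => (x l).toNat * bitsVal (e l)).sum)
      (G.user ks ls w e x) := by
  induction ls generalizing G W with
  | nil => simpa [Ledger.user] using h
  | cons l ls ih =>
    simpa [Ledger.user, add_assoc] using ih (h.level ks (x l) (w l) (e l))

theorem ThrRel.server {G : Ledger δ} (h : ThrRel t W G) (cov used : υ → Bool)
    (x : υ → ι → Bool) :
    ThrRel t (W + (is.map fun i => (ls.map fun l => (x i l).toNat * bitsVal (e l)).sum).sum)
      (G.server ks ls w e is cov used x) := by
  induction is generalizing G W with
  | nil => simpa [Ledger.server] using h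
  | cons i is ih =>
    have h' : ThrRel t (W + (ls.map fun l => (x i l).toNat * bitsVal (e l)).sum)
        (((G.enter (cov i) (used i)).user ks ls w e (x i)).enter false false) :=
      ThrRel.user ks ls w e (G := G.enter (cov i) (used i)) h (x i)
    simpa [Ledger.server, add_assoc] using ih h'

theorem ThrRel.foldl (js : List ς) (c : ς → δ → List Bool) (cov : ς → υ → Bool)
    (x : ς → υ → ι → Bool) {p : Ledger δ × (υ → Bool)} (h : ThrRel t W p.1) :
    ThrRel t (W + (js.map fun j => (is.map fun i =>
      (ls.map fun l => (x j i l).toNat * bitsVal (e l)).sum).sum).sum)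
      (js.foldl (serverStep ks ls w e is c cov x) p).1 := by
  induction js generalizing p W with
  | nil => simpa using h
  | cons j js ih =>
    have h' : ThrRel t W { p.1 with caps := c j } := h
    have := ih (p := serverStep ks ls w e is c cov x p j)
      (h'.server ks ls w e is (cov j) p.2 (x j))
    simpa [add_assoc] using this

end Checks

end StackProgram

/-! ### Membership in NP -/

namespace RatInstance

open StackProgram

/-- The allocation that a certificate describes -/
def decodeAllocation (I : RatInstance) (y : List Bool) : Allocation I.n I.m I.q :=
  fun i j l => y.getD ((j * I.n + i) * I.q + l) false

/-- Both denominators are positive and cancel. The sums are arranged as the stack program forms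
them, with the server outermost in the QoE. -/
theorem isSolution_iff (I : RatInstance) (x : Allocation I.n I.m I.q) :
    I.toEUA.IsSolution I.qoe x ↔
      (∀ i j l, x i j l = true → I.covers j i = true) ∧
      (∀ i, ∑ j, ∑ l, (x i j l).toNat ≤ 1) ∧
      (∀ j k, ∑ i, ∑ l, (x i j l).toNat * I.levelNum l k ≤ I.capNum j k) ∧
      I.thresholdNum < ∑ j, ∑ i, ∑ l, (x i j l).toNat * I.qoeNum l := by
  have hu : (0 : ℝ) < ((I.unit : ℕ) : ℝ) := by exact_mod_cast I.unit.pos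
  have hq : (0 : ℝ) < ((I.qoeUnit : ℕ) : ℝ) := by exact_mod_cast I.qoeUnit.pos
  have hite (b : Bool) (a : ℕ) (u : ℝ) :
      (if b = true then (a : ℝ) / u else 0) = ((b.toNat * a : ℕ) : ℝ) / u := by
    cases b <;> simp
  have hcard (i : Fin I.n) : (Finset.univ.filter
      fun p : Fin I.m × Fin I.q => x i p.1 p.2 = true).card = ∑ j, ∑ l, (x i j l).toNat := by
    rw [Finset.card_filter, Fintype.sum_prod_type]
    refine Finset.sum_congr rfl fun j _ => Finset.sum_congr rfl fun l _ => ?_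
    cases x i j l <;> rfl
  have hcap (j : Fin I.m) (k : Fin I.d) :
      (∑ i, ∑ l, if x i j l = true then I.toEUA.level l k else 0) ≤ I.toEUA.cap j k ↔
        ∑ i, ∑ l, (x i j l).toNat * I.levelNum l k ≤ I.capNum j k := by
    simp only [toEUA, hite]
    simp only [← Finset.sum_div, ← Nat.cast_sum]
    rw [div_le_div_iff_of_pos_right hu, Nat.cast_le]
  have hthr : I.toEUA.threshold < EUA.aggregateQoE I.qoe x ↔
      I.thresholdNum < ∑ j, ∑ i, ∑ l, (x i j l).toNat * I.qoeNum l := by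
    rw [Finset.sum_comm]
    simp only [toEUA, EUA.aggregateQoE, qoe, hite]
    simp only [← Finset.sum_div, ← Nat.cast_sum]
    rw [div_lt_div_iff_of_pos_right hq, Nat.cast_lt]
  constructor
  · rintro ⟨⟨h₁, h₂, h₃⟩, h₄⟩
    exact ⟨h₁, fun i => (hcard i) ▸ h₂ i, fun j k => (hcap j k).1 (h₃ j k), hthr.1 h₄⟩
  · rintro ⟨h₁, h₂, h₃, h₄⟩
    exact ⟨⟨h₁, fun i => (hcard i).symm ▸ h₂ i, fun j k => (hcap j k).2 (h₃ j k)⟩, hthr.2 h₄⟩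

theorem length_of_append_eq_finRange {n : ℕ} {pre suf : List (Fin n)} {b : Fin n}
    (h : pre ++ b :: suf = List.finRange n) : pre.length = b := by
  have h₁ : (List.finRange n)[pre.length]? = some b := by
    rw [← h, List.getElem?_append_right le_rfl]
    simp
  obtain ⟨h₂, h₃⟩ := List.getElem?_eq_some_iff.1 h₁
  rw [← h₃]
  simp

/-- What the verifier finds out about an instance and a certificate -/
def verifierFlags (I : RatInstance) (y : List Bool) : Flags :=
  (verifier.run ⟨{}, Function.update (fun _ => []) .inp
    (encodeWithCertificate encode (I, y))⟩).reg.flags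

theorem verifierFlags_eq (I : RatInstance) (y : List Bool) :
    I.verifierFlags y = ((List.finRange I.m).foldl (serverStep (List.finRange I.d)
      (List.finRange I.q) (fun l k => (I.levelNum l k).bits) (fun l => (I.qoeNum l).bits)
      (List.finRange I.n) (fun j k => (I.capNum j k).bits) I.covers
      (fun j i l => I.decodeAllocation y i j l))
      (⟨fun _ => [], I.thresholdNum.bits, {}⟩, fun _ => false)).1.flags := by
  have hinp : encodeWithCertificate encode (I, y) =
      (encodeUnary (List.finRange I.n).length).map .inl ++
        ((encodeUnary (List.finRange I.m).length).map .inl ++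
        ((encodeUnary (List.finRange I.d).length).map .inl ++
        ((encodeUnary (List.finRange I.q).length).map .inl ++
        (encodeBits (I.unit : ℕ).bits ++ (encodeBits (I.qoeUnit : ℕ).bits ++
        ((List.finRange I.m).flatMap
          (fun j => (List.finRange I.n).map fun i => .inl (some (I.covers j i))) ++
        ((List.finRange I.m).flatMap
          (fun j => (List.finRange I.d).flatMap fun k => encodeBits (I.capNum j k).bits) ++
        ((List.finRange I.q).flatMap
          (fun l => (List.finRange I.d).flatMap fun k => encodeBits (I.levelNum l k).bits) ++
        ((List.finRange I.q).flatMap (fun l => encodeBits (I.qoeNum l).bits) ++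
        (encodeBits I.thresholdNum.bits ++ y.map .inr)))))))))) := by
    simp only [encodeWithCertificate, encode, List.map_append, List.map_flatMap,
      map_inl_encodeBinary, List.map_map, List.length_finRange, List.append_assoc]
    rfl
  have hparse := run_parseProg (List.finRange I.n) (List.finRange I.m) (List.finRange I.d)
    (List.finRange I.q) (I.unit : ℕ).bits (I.qoeUnit : ℕ).bits I.covers
    (fun j k => (I.capNum j k).bits) (fun l k => (I.levelNum l k).bits)
    (fun l => (I.qoeNum l).bits) I.thresholdNum.bits (y.map .inr) {}
  rw [verifierFlags, hinp, verifier, Cmd.run.eq_5, hparse]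
  refine run_each_serverProg (List.finRange I.d) (List.finRange I.q)
    (fun l k => (I.levelNum l k).bits) (fun l => (I.qoeNum l).bits) (List.finRange I.n)
    (List.finRange I.m) (fun j k => (I.capNum j k).bits) I.covers
    (fun j i l => I.decodeAllocation y i j l) ⟨fun _ => [], I.thresholdNum.bits, {}⟩ y _ ?_
    rfl rfl rfl rfl rfl rfl rfl rfl rfl rfl rfl rfl rfl rfl rfl rfl rfl rfl rfl
  intro pre' j suf' hj pre i suf hi pre'' l suf'' hl
  rw [length_of_append_eq_finRange hj, length_of_append_eq_finRange hi,
    length_of_append_eq_finRange hl]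
  simp [decodeAllocation, List.getD_eq_getElem?_getD]

theorem accept_verifierFlags_iff (I : RatInstance) (y : List Bool) :
    (I.verifierFlags y).accept = true ↔
      I.toEUA.IsSolution I.qoe (I.decodeAllocation y) := by
  rw [isSolution_iff, Flags.accept]
  simp only [Bool.and_eq_true, Bool.not_eq_true', and_assoc]
  rw [verifierFlags_eq, badCov_foldl, badOnce_foldl, badCap_foldl]
  have hthr := ThrRel.foldl (List.finRange I.d) (List.finRange I.q)
    (fun l k => (I.levelNum l k).bits) (fun l => (I.qoeNum l).bits) (List.finRange I.n)
    (t := I.thresholdNum) (W := 0)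
    (List.finRange I.m) (fun j k => (I.capNum j k).bits) I.covers
    (fun j i l => I.decodeAllocation y i j l)
    (p := (⟨fun _ => [], I.thresholdNum.bits, {}⟩, fun _ => false))
    ⟨fun _ => by simp [bitsVal_bits], fun h => by simp at h⟩
  simp only [List.mem_finRange, true_imp_iff, true_and, bitsVal_bits, ← Fin.sum_univ_def,
    Bool.toNat_false, zero_add] at hthr ⊢
  refine and_congr ⟨fun h i j l => h j i l, fun h j i l => h i j l⟩
    (and_congr_right fun _ => and_congr_right fun _ => ⟨hthr.2, fun h => ?_⟩)
  -- Without a borrow the whole QoE has been subtracted exactly from the threshold, so it cannot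
  -- exceed it.
  by_contra hex
  have := hthr.1 (by simpa using hex)
  omega

theorem exists_certificate (I : RatInstance) (x : Allocation I.n I.m I.q) :
    ∃ y : List Bool, y.length = I.m * (I.n * I.q) ∧ I.decodeAllocation y = x := by
  refine ⟨(List.finRange I.m).flatMap fun j => (List.finRange I.n).flatMap fun i =>
    (List.finRange I.q).map fun l => x i j l, ?_, ?_⟩
  · simp [List.length_flatMap]
  · funext i j l
    have hlt : i.val * I.q + l.val < I.n * I.q := by
      have := i.2
      have := l.2
      nlinarith
    rw [decodeAllocation, List.getD_eq_getElem?_getD,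
      show (j.val * I.n + i.val) * I.q + l.val = j.val * (I.n * I.q) + (i.val * I.q + l.val) by
        ring,
      List.getElem?_flatMap_of_length (by simp [List.length_flatMap]) _ _ hlt]
    simp only [List.getElem?_eq_getElem, List.length_finRange, j.2, List.getElem_finRange,
      Option.bind_some, Fin.cast_mk]
    rw [List.getElem?_flatMap_of_length (by simp) _ _ l.2]
    simp

/-- This is where the unary sizes matter: they make the certificate polynomially short. -/
theorem length_encode_ge (I : RatInstance) : I.n + I.m + I.q ≤ I.encode.length := by
  simp only [encode, encodeUnary, List.length_append, List.length_replicate]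
  omega

theorem inNP_decision : InNP encode (fun I => I.toEUA.Decision I.qoe) := by
  refine ⟨Polynomial.X ^ 3, fun p => (p.1.verifierFlags p.2).accept,
    Cmd.nonempty_computableInPolyTime tame_verifier .inp {} (fun v => v.flags.accept) _ _
      (fun _ => rfl), fun I => ⟨?_, ?_⟩⟩
  · rintro ⟨x, hx⟩
    obtain ⟨y, hy, rfl⟩ := I.exists_certificate x
    refine ⟨y, ?_, (I.accept_verifierFlags_iff y).2 hx⟩
    have h := I.length_encode_ge
    rw [hy, Polynomial.eval_pow, Polynomial.eval_X]
    calc I.m * (I.n * I.q) ≤ I.encode.length * (I.encode.length * I.encode.length) :=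
          Nat.mul_le_mul (by omega) (Nat.mul_le_mul (by omega) (by omega))
      _ = I.encode.length ^ 3 := by ring
  · rintro ⟨y, -, hy⟩
    exact ⟨_, (I.accept_verifierFlags_iff y).1 hy⟩

end RatInstance

/-- Restricting a problem in NP to a subset of the instances gives a problem in NP. -/
theorem InNP.comp {α β Γ : Type} {enc : α → List Γ} {P : α → Prop} (h : InNP enc P) (f : β → α)
    {Q : β → Prop} (hQ : ∀ b, Q b ↔ P (f b)) : InNP (fun b => enc (f b)) Q := by
  obtain ⟨p, V, ⟨M⟩, hV⟩ := h
  exact ⟨p, fun b => V (f b.1, b.2),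
    -- An instance and its image have the same encoding, so the machine is unchanged.
    ⟨{ M with outputsFun := fun b => M.outputsFun (f b.1, b.2) }⟩,
    fun b => (hQ b).trans (hV (f b))⟩

/-- Precision makes the solutions for the two kinds of QoE values coincide, so the machine for
rational values decides the exact problem without meeting an irrational number. -/
theorem RatInstance.inNP_logistic (L α β : ℝ) :
    InNP (fun I : {I : RatInstance // I.PreciseFor (I.toEUA.logisticQoE L α β)} => I.1.encode)
      (fun I => I.1.toEUA.Decision (I.1.toEUA.logisticQoE L α β)) :=
  RatInstance.inNP_decision.comp Subtype.val fun I =>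
    exists_congr fun x => and_congr_right fun hx => (I.2 x hx).symm

/-! ### Structured programs for the random access machine -/

namespace RealRAM

/-- The memory of the machine -/
structure Mem where
  I : ℕ → ℕ
  R : ℕ → ℝ

/-- The machine goes from the first state to the second one in `t` steps. -/
def Steps (prog : List Instr) (inp : Input) (t : ℕ) (s s' : State) : Prop :=
  ∀ r, runFrom prog inp (t + r) s = runFrom prog inp r s'

section Steps

variable {prog : List Instr} {inp : Input}

theorem Steps.refl (s : State) : Steps prog inp 0 s s := fun r => by rw [zero_add]

theorem Steps.trans {t₁ t₂ : ℕ} {s₁ s₂ s₃ : State} (h₁ : Steps prog inp t₁ s₁ s₂)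
    (h₂ : Steps prog inp t₂ s₂ s₃) : Steps prog inp (t₁ + t₂) s₁ s₃ := fun r => by
  rw [add_assoc, h₁, h₂]

theorem Steps.single {s s' : State} {i : Instr} (hi : prog[s.pc]? = some i)
    (h : exec inp s i = .inl s') : Steps prog inp 1 s s' := fun r => by
  rw [add_comm, runFrom, step, hi]
  simp only [h]

end Steps

/-- The instruction changes the memory and goes on to the next instruction. -/
def Instr.basic : Instr → Bool
  | .jumpLT _ _ _ => false
  | .rjumpLT _ _ _ => false
  | .halt _ => false
  | _ => true

/-- The effect of a basic instruction on the memory -/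
noncomputable def act (inp : Input) (m : Mem) (i : Instr) : Mem :=
  match exec inp ⟨0, m.I, m.R⟩ i with
  | .inl s => ⟨s.I, s.R⟩
  | .inr _ => m

/-- The effect on the memory does not depend on the address, so `act` may evaluate it at address
`0`. -/
theorem exec_of_basic {i : Instr} (hi : i.basic = true) (inp : Input) (m : Mem) (pc : ℕ) :
    exec inp ⟨pc, m.I, m.R⟩ i = .inl ⟨pc + 1, (act inp m i).I, (act inp m i).R⟩ := by
  cases i <;> first | rfl | simp [Instr.basic] at hi

/-- Structured programs. Loops and conditionals use the integer registers `0` and `1`. -/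
inductive Code
  /-- a sequence of basic instructions -/
  | block (is : List Instr)
  | seq (c₁ c₂ : Code)
  /-- for `I[a]` from `0` to `I[b] - 1` -/
  | loop (a b : ℕ) (body : Code)
  /-- if `R[a] < R[b]` -/
  | cond (a b : ℕ) (body : Code)

namespace Code

infixr:60 " ;; " => Code.seq

/-- The number of instructions of a program -/
def size : Code → ℕ
  | block is => is.length
  | seq c₁ c₂ => c₁.size + c₂.size
  | loop _ _ body => body.size + 7
  | cond _ _ body => body.size + 4

/-- The machine program, when it is placed at `off` -/
def compile : Code → ℕ → List Instr
  | block is, _ => is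
  | seq c₁ c₂, off => c₁.compile off ++ c₂.compile (off + c₁.size)
  | loop a b body, off =>
    -- Comparing `0 < 1` serves as the unconditional jump. It leads to the test behind the body, so
    -- that no round is made when the bound is zero.
    [.const 0 0, .const 1 1, .const a 0, .jumpLT 0 1 (off + 4 + body.size + 2)] ++
      body.compile (off + 4) ++ [.const 1 1, .add a a 1, .jumpLT a b (off + 4)]
  | cond a b body, off =>
    [.rjumpLT a b (off + 4), .const 0 0, .const 1 1, .jumpLT 0 1 (off + 4 + body.size)] ++
      body.compile (off + 4)

theorem length_compile (c : Code) (off : ℕ) : (c.compile off).length = c.size := by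
  induction c generalizing off with
  | block is => rfl
  | seq c₁ c₂ h₁ h₂ => simp [compile, size, h₁, h₂]
  | loop a b body ih => simp [compile, size, ih]
  | cond a b body ih => simp [compile, size, ih]

end Code

/-! ### Total correctness with time bounds. -/

/-- The list `code` is a part of the program, starting at `off`. -/
def CodeAt (prog : List Instr) (off : ℕ) (code : List Instr) : Prop :=
  ∀ i, i < code.length → prog[off + i]? = code[i]?

theorem CodeAt.left {prog c₁ c₂ : List Instr} {off : ℕ} (h : CodeAt prog off (c₁ ++ c₂)) :
    CodeAt prog off c₁ := fun i hi => by
  rw [h i (by simp; omega), List.getElem?_append_left hi]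

theorem CodeAt.right {prog c₁ c₂ : List Instr} {off : ℕ} (h : CodeAt prog off (c₁ ++ c₂)) :
    CodeAt prog (off + c₁.length) c₂ := fun i hi => by
  rw [add_assoc, h _ (by simp; omega), List.getElem?_append_right (by omega)]
  simp

/-- From the memory `m`, the program takes at most `T` steps, and then the memory satisfies
`Q`. -/
def Ends (inp : Input) (c : Code) (T : ℕ) (m : Mem) (Q : Mem → Prop) : Prop :=
  ∀ prog off, CodeAt prog off (c.compile off) → ∃ t ≤ T, ∃ m', Q m' ∧
    Steps prog inp t ⟨off, m.I, m.R⟩ ⟨off + c.size, m'.I, m'.R⟩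

variable {inp : Input} {c c₁ c₂ : Code} {T T₁ T₂ : ℕ} {m : Mem} {Q : Mem → Prop}

theorem Ends.block {is : List Instr} (his : is.all Instr.basic = true)
    (hQ : Q (is.foldl (act inp) m)) : Ends inp (.block is) is.length m Q := by
  intro prog off hc
  refine ⟨is.length, le_rfl, _, hQ, ?_⟩
  simp only [Code.compile, Code.size] at hc ⊢
  clear hQ
  induction is generalizing m off with
  | nil => exact .refl _
  | cons i is ih =>
    simp only [List.all_cons, Bool.and_eq_true] at his
    have h₁ : Steps prog inp 1 ⟨off, m.I, m.R⟩ ⟨off + 1, (act inp m i).I, (act inp m i).R⟩ :=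
      .single (by simpa using hc 0 (by simp)) (exec_of_basic his.1 inp m off)
    have h₂ := ih (m := act inp m i) his.2 (off + 1)
      (CodeAt.right (c₁ := [i]) (c₂ := is) (by simpa using hc))
    have := h₁.trans h₂
    rw [List.length_cons, List.foldl_cons, add_comm is.length 1, ← add_assoc]
    exact this

/-- The postcondition of `c₁` is the whole claim about `c₂`, so programs are verified forwards
without stating intermediate assertions. -/
theorem Ends.seq (h : Ends inp c₁ T₁ m fun m' => Ends inp c₂ T₂ m' Q) :
    Ends inp (.seq c₁ c₂) (T₁ + T₂) m Q := by
  intro prog off hc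
  rw [Code.compile] at hc
  obtain ⟨t₁, ht₁, m₁, h₁, hs₁⟩ := h prog off hc.left
  have hr := hc.right
  rw [Code.length_compile] at hr
  obtain ⟨t₂, ht₂, m₂, h₂, hs₂⟩ := h₁ prog (off + c₁.size) hr
  refine ⟨t₁ + t₂, by omega, m₂, h₂, ?_⟩
  rw [Code.size, ← add_assoc]
  exact hs₁.trans hs₂

/-- Write a value to a cell of the integer memory. -/
def Mem.setI (m : Mem) (a v : ℕ) : Mem := ⟨Function.update m.I a v, m.R⟩

/-- The memory at the start of a loop -/
def Mem.startLoop (m : Mem) (a : ℕ) : Mem := ((m.setI 0 0).setI 1 1).setI a 0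

/-- The memory after a round of a loop -/
def Mem.nextRound (m : Mem) (a : ℕ) : Mem := (m.setI 1 1).setI a (m.I a + 1)

/-- The invariant is asserted at the test. A round takes one jump, the body and two instructions for
the counter; four initial instructions and the failing test make up the `5`. -/
theorem Ends.loop {a b N : ℕ} (ha : 1 < a) (Inv : ℕ → Mem → Prop)
    (h₀ : Inv 0 (m.startLoop a))
    (hN : ∀ r m, Inv r m → m.I a = r ∧ m.I b = N)
    (hstep : ∀ r m, r < N → Inv r m → Ends inp c T m fun m' => Inv (r + 1) (m'.nextRound a))
    (hQ : ∀ m, Inv N m → Q m) : Ends inp (.loop a b c) (N * (T + 3) + 5) m Q := by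
  intro prog off hc
  rw [Code.compile] at hc
  have hhead := hc.left.left
  have hbody := hc.left.right
  have hlast := hc.right
  simp only [List.length_append, List.length_cons, List.length_nil, Code.length_compile] at hlast
  rw [show off + (0 + 1 + 1 + 1 + 1 + c.size) = off + 4 + c.size by ring] at hlast
  set test := off + 4 + c.size + 2 with htest
  have hstart : Steps prog inp 4 ⟨off, m.I, m.R⟩ ⟨test, (m.startLoop a).I, (m.startLoop a).R⟩ := by
    refine (((Steps.single (i := .const 0 0) (hhead 0 (by simp)) rfl).trans
      (.single (i := .const 1 1) (hhead 1 (by simp)) rfl)).trans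
      (.single (i := .const a 0) (hhead 2 (by simp)) rfl)).trans
      (.single (i := .jumpLT 0 1 test) (hhead 3 (by simp)) ?_)
    simp [exec, State.setI, Mem.startLoop, Mem.setI, show (1 : ℕ) ≠ a by omega,
      show (0 : ℕ) ≠ a by omega]
  have hround : ∀ k r m₁, r + k = N → Inv r m₁ → ∃ t ≤ k * (T + 3) + 1, ∃ m₂, Inv N m₂ ∧
      Steps prog inp t ⟨test, m₁.I, m₁.R⟩ ⟨test + 1, m₂.I, m₂.R⟩ := by
    have hjump : prog[test]? = some (.jumpLT a b (off + 4)) := hlast 2 (by simp)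
    intro k
    induction k with
    | zero =>
      intro r m₁ hr hinv
      obtain rfl : r = N := by omega
      refine ⟨1, by omega, m₁, hinv, .single hjump ?_⟩
      simp [exec, (hN _ _ hinv).1, (hN _ _ hinv).2]
    | succ k ih =>
      intro r m₁ hr hinv
      obtain ⟨t₁, ht₁, m₂, hinv₂, hs₁⟩ := hstep r m₁ (by omega) hinv prog (off + 4)
        (by simpa using hbody)
      obtain ⟨t₂, ht₂, m₃, hinv₃, hs₂⟩ := ih (r + 1) _ (by omega) hinv₂
      have hgo : Steps prog inp 1 ⟨test, m₁.I, m₁.R⟩ ⟨off + 4, m₁.I, m₁.R⟩ := by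
        refine .single hjump ?_
        simp only [exec, (hN _ _ hinv).1, (hN _ _ hinv).2]
        rw [if_pos (by omega)]
      have hnext : Steps prog inp 2 ⟨off + 4 + c.size, m₂.I, m₂.R⟩
          ⟨test, (m₂.nextRound a).I, (m₂.nextRound a).R⟩ := by
        have e₁ : prog[off + 4 + c.size]? = some (.const 1 1) := hlast 0 (by simp)
        have e₂ : prog[off + 4 + c.size + 1]? = some (.add a a 1) := hlast 1 (by simp)
        refine (Steps.single e₁ rfl).trans (.single e₂ ?_)
        simp [exec, State.setI, Mem.nextRound, Mem.setI, show a ≠ 1 by omega, htest]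
      refine ⟨1 + t₁ + 2 + t₂, ?_, m₃, hinv₃, ((hgo.trans hs₁).trans hnext).trans hs₂⟩
      rw [add_mul]
      omega
  obtain ⟨t, ht, m₂, hinv, hs⟩ := hround N 0 _ (by omega) h₀
  refine ⟨4 + t, by omega, m₂, hQ m₂ hinv, ?_⟩
  rw [show off + (Code.loop a b c).size = test + 1 by rw [Code.size]; omega]
  exact hstart.trans hs

/-- Skipping the body takes four instructions and overwrites the scratch registers `0` and `1`. -/
theorem Ends.cond {a b : ℕ} (h₁ : m.R a < m.R b → Ends inp c T m Q)
    (h₂ : ¬m.R a < m.R b → Q ((m.setI 0 0).setI 1 1)) :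
    Ends inp (.cond a b c) (T + 4) m Q := by
  intro prog off hc
  rw [Code.compile] at hc
  have hhead := hc.left
  have hbody := hc.right
  have hjump : prog[off]? = some (.rjumpLT a b (off + 4)) := hhead 0 (by simp)
  by_cases h : m.R a < m.R b
  · obtain ⟨t, ht, m', hm', hs⟩ := h₁ h prog (off + 4) (by simpa using hbody)
    refine ⟨1 + t, by omega, m', hm', ?_⟩
    rw [show off + (Code.cond a b c).size = off + 4 + c.size by rw [Code.size]; omega]
    exact (Steps.single hjump (by simp [exec, h])).trans hs
  · refine ⟨4, by omega, _, h₂ h, ?_⟩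
    refine (((Steps.single (s' := ⟨off + 1, m.I, m.R⟩) hjump (by simp [exec, h])).trans
      (.single (i := .const 0 0) (hhead 1 (by simp)) rfl)).trans
      (.single (i := .const 1 1) (hhead 2 (by simp)) rfl)).trans
      (.single (i := .jumpLT 0 1 (off + 4 + c.size)) (hhead 3 (by simp)) ?_)
    simp [exec, State.setI, Mem.setI, Code.size]
    omega

/-- The program that executes `c` and accepts if in the end `I[a] < I[b]`. -/
def decider (c : Code) (a b : ℕ) : List Instr :=
  c.compile 0 ++ [.jumpLT a b (c.size + 2), .halt false, .halt true]

theorem run_decider {a b : ℕ} {P : Prop}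
    (h : Ends inp c T ⟨fun _ => 0, fun _ => 0⟩ fun m => m.I a < m.I b ↔ P) {T' : ℕ}
    (hT : T + 2 ≤ T') :
    ∃ answer, run (decider c a b) inp T' = some answer ∧ (answer = true ↔ P) := by
  have hcode : CodeAt (decider c a b) 0 (decider c a b) := fun i _ => by rw [zero_add]
  obtain ⟨t, ht, m, hm, hs⟩ := h (decider c a b) 0 hcode.left
  have hlast := hcode.right
  rw [Code.length_compile] at hlast
  have e₁ : (decider c a b)[c.size]? = some (.jumpLT a b (c.size + 2)) := by
    simpa using hlast 0 (by simp)
  have e₂ : (decider c a b)[c.size + 1]? = some (.halt false) := by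
    simpa using hlast 1 (by simp)
  have e₃ : (decider c a b)[c.size + 2]? = some (.halt true) := by
    simpa using hlast 2 (by simp)
  rw [zero_add] at hs
  -- One step for the last jump, one for halting, and `r` steps to spare.
  obtain ⟨r, rfl⟩ : ∃ r, T' = t + (1 + (r + 1)) := ⟨T' - t - 2, by omega⟩
  rw [run, State.init, hs]
  by_cases hlt : m.I a < m.I b
  · refine ⟨true, ?_, by simp [← hm, hlt]⟩
    rw [Steps.single (s := ⟨c.size, m.I, m.R⟩) (s' := ⟨c.size + 2, m.I, m.R⟩) e₁
      (by simp [exec, hlt]), runFrom, step, e₃]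
    rfl
  · refine ⟨false, ?_, by simp [← hm, hlt]⟩
    rw [Steps.single (s := ⟨c.size, m.I, m.R⟩) (s' := ⟨c.size + 1, m.I, m.R⟩) e₁
      (by simp [exec, hlt]), runFrom, step, e₂]
    rfl

end RealRAM

/-! ### The verifier on the random access machine -/

set_option linter.unusedSimpArgs false

namespace RealRAM

/-- The part of the memory that does not change after the initialization, for an input with the
sizes `n`, `m`, `d`, `q` -/
structure Ready (inp : Input) (n m d q : ℕ) (M : Mem) : Prop where
  users : M.I 2 = n
  servers : M.I 3 = m
  dims : M.I 4 = d
  qos : M.I 5 = q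
  alloc : M.I 6 = 4 + n * m
  levels : M.I 7 = 4 + m * d
  stride : M.I 8 = m * q
  one : M.I 23 = 1
  zero : M.I 25 = 0
  threshold : M.R 1 = inp.reals.getD 0 0
  scale : M.R 2 = inp.reals.getD 1 0
  slope : M.R 3 = inp.reals.getD 2 0
  center : M.R 4 = inp.reals.getD 3 0
  rzero : M.R 5 = 0
  rone : M.R 6 = 1
  rd : M.R 7 = d

theorem Ready.congr {inp : Input} {n m d q : ℕ} {M M' : Mem} (h : Ready inp n m d q M)
    (hI : ∀ a ∈ [2, 3, 4, 5, 6, 7, 8, 23, 25], M'.I a = M.I a)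
    (hR : ∀ a ∈ [1, 2, 3, 4, 5, 6, 7], M'.R a = M.R a) : Ready inp n m d q M' := by
  simp only [List.forall_mem_cons, List.forall_mem_nil, and_true] at hI hR
  obtain ⟨h₁, h₂, h₃, h₄, h₅, h₆, h₇, h₈, h₉, -⟩ := hI
  obtain ⟨g₁, g₂, g₃, g₄, g₅, g₆, g₇, -⟩ := hR
  exact ⟨h₁.trans h.users, h₂.trans h.servers, h₃.trans h.dims, h₄.trans h.qos, h₅.trans h.alloc,
    h₆.trans h.levels, h₇.trans h.stride, h₈.trans h.one, h₉.trans h.zero, g₁.trans h.threshold,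
    g₂.trans h.scale, g₃.trans h.slope, g₄.trans h.center, g₅.trans h.rzero, g₆.trans h.rone,
    g₇.trans h.rd⟩

/-- Entry `(i, j, l)` of the allocation in the input of the verifier -/
def inX (inp : Input) (n m q i j l : ℕ) : ℕ := inp.ints.getD (4 + n * m + ((i * m + j) * q + l)) 0

/-- Entry `(i, j)` of the coverage matrix in the input of the verifier -/
def inCover (inp : Input) (m i j : ℕ) : ℕ := inp.ints.getD (4 + (i * m + j)) 0

/-- The capacity of server `j` in dimension `k` in the input of the verifier -/
def inCap (inp : Input) (d j k : ℕ) : ℝ := inp.reals.getD (4 + (j * d + k)) 0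

/-- The amount of level `l` in dimension `k` in the input of the verifier -/
def inLevel (inp : Input) (m d l k : ℕ) : ℝ := inp.reals.getD (4 + m * d + (l * d + k)) 0

/-- The logistic QoE of level `l`, computed from the input of the verifier -/
noncomputable def inQoE (inp : Input) (m d l : ℕ) : ℝ :=
  inp.reals.getD 1 0 / (1 + Real.exp ((0 - inp.reals.getD 2 0) *
    ((∑ k ∈ Finset.range d, inLevel inp m d l k) / (d : ℝ) - inp.reals.getD 3 0)))

open Code

/-- Add `I[b] * I[c]` to `I[z]`, with the counter `I[a]`. -/
def addMul (z a b c : ℕ) : Code := .loop a b (.block [.add z z c])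

/-- Read the sizes and parameters and compute the addresses of the arrays. -/
def setup : Code :=
  .block [.const 23 1, .read 2 25, .read 3 23, .const 24 2, .read 4 24, .const 24 3, .read 5 24,
    .rread 1 25, .rread 2 23, .const 24 2, .rread 3 24, .const 24 3, .rread 4 24,
    .cast 6 23, .cast 7 4, .const 6 4, .const 7 4] ;;
  addMul 6 11 2 3 ;; addMul 7 12 3 4 ;; addMul 8 12 3 5

/-- Count violations of the coverage and of the rule that a user has at most one server and
level. -/
def checkUsers : Code :=
  .block [.const 18 4, .add 19 6 25] ;;
  .loop 11 2
    (.block [.const 15 0] ;;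
    .loop 12 3
      (.block [.read 16 18, .add 18 18 23] ;;
      .loop 13 5
        (.block [.read 17 19, .add 19 19 23, .add 15 15 17, .sub 24 17 16, .add 9 9 24])) ;;
    .block [.sub 24 15 23, .add 9 9 24])

/-- Count violations of the capacities. -/
def checkCapacities : Code :=
  .block [.const 18 4, .add 19 6 25] ;;
  .loop 12 3
    (.block [.add 20 7 25] ;;
    .loop 14 4
      (.block [.rread 8 18, .add 18 18 23, .add 21 19 25] ;;
      .loop 11 2
        (.block [.add 22 21 25, .add 26 20 25] ;;
        .loop 13 5
          (.block [.read 17 22, .add 22 22 23, .rread 10 26, .add 26 26 4, .cast 9 17,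
            .rmul 10 10 9, .rsub 8 8 10]) ;;
        .block [.add 21 21 8]) ;;
      .cond 8 5 (.block [.add 9 9 23]) ;;
      .block [.add 20 20 23]) ;;
    .block [.add 19 19 5])

/-- Add up the logistic QoE of all users. -/
def sumQoE : Code :=
  .block [.add 19 6 25, .add 20 7 25] ;;
  .loop 13 5
    (.block [.cast 8 25] ;;
    .loop 14 4 (.block [.rread 10 20, .add 20 20 23, .radd 8 8 10]) ;;
    .block [.rdiv 8 8 7, .rsub 8 8 4, .rsub 12 5 3, .rmul 8 12 8, .rexp 8 8, .radd 8 6 8,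
      .rdiv 8 2 8, .add 21 19 25] ;;
    .loop 11 2
      (.loop 12 3
        (.block [.read 17 21, .add 21 21 5, .cast 9 17, .rmul 9 8 9, .radd 0 0 9])) ;;
    .block [.add 19 19 23])

/-- The verifier; it accepts if in the end `I[9] < I[10]`. -/
def verifierCode : Code :=
  setup ;; checkUsers ;; checkCapacities ;; sumQoE ;; .block [.const 10 0] ;;
    .cond 1 0 (.block [.const 10 1])

/-! ### Analysis of the subroutines. -/

open Finset

variable {inp : Input} {n m d q : ℕ} {M : Mem} {Q : Mem → Prop}

/-- Natural numbers can only be added and subtracted, so products are repeated additions. Products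
are needed only for a few addresses at the start, at cost `O(n + m)`. -/
theorem Ends.addMul {z a b c N K : ℕ} (ha : 1 < a) (hz : 1 < z) (hb : 1 < b) (hc : 1 < c)
    (haz : a ≠ z) (hab : a ≠ b) (hac : a ≠ c) (hzb : z ≠ b) (hzc : z ≠ c)
    (hN : M.I b = N) (hK : M.I c = K)
    (hQ : ∀ M' : Mem, M'.R = M.R → M'.I z = M.I z + N * K →
      (∀ r, 1 < r → r ≠ a → r ≠ z → M'.I r = M.I r) → Q M') :
    Ends inp (RealRAM.addMul z a b c) (N * 4 + 5) M Q := by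
  refine Ends.loop (N := N) ha (fun r M' => M'.I a = r ∧ M'.R = M.R ∧ M'.I z = M.I z + r * K ∧
      (∀ r, 1 < r → r ≠ a → r ≠ z → M'.I r = M.I r)) ?_ ?_ ?_ ?_
  · refine ⟨by simp [Mem.startLoop, Mem.setI], rfl, ?_, fun r h₁ h₂ h₃ => ?_⟩
    · simp [Mem.startLoop, Mem.setI, haz.symm, show z ≠ 0 by omega, show z ≠ 1 by omega]
    · simp [Mem.startLoop, Mem.setI, h₂, show r ≠ 0 by omega, show r ≠ 1 by omega]
  · rintro r M' ⟨h₁, h₂, h₃, h₄⟩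
    exact ⟨h₁, by rw [h₄ b hb hab.symm hzb.symm, hN]⟩
  · rintro r M' hr ⟨h₁, h₂, h₃, h₄⟩
    refine Ends.block rfl ⟨?_, h₂, ?_, fun s h₁ h₂ h₃ => ?_⟩
    · simp [act, exec, State.setI, Mem.nextRound, Mem.setI, haz, h₁, show a ≠ 1 by omega]
    · simp only [List.foldl, act, exec, State.setI, Mem.nextRound, Mem.setI]
      rw [Function.update_of_ne haz.symm, Function.update_of_ne (by omega), Function.update_self,
        h₃, h₄ c hc hac.symm hzc.symm, hK]
      ring
    · simp [act, exec, State.setI, Mem.nextRound, Mem.setI, h₂, h₃, show s ≠ 1 by omega, h₄ s h₁]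
  · rintro M' ⟨h₁, h₂, h₃, h₄⟩
    exact hQ M' h₂ h₃ h₄

theorem Ends.setup (hn : inp.ints.getD 0 0 = n) (hm : inp.ints.getD 1 0 = m)
    (hd : inp.ints.getD 2 0 = d) (hq : inp.ints.getD 3 0 = q)
    (hQ : ∀ M, Ready inp n m d q M → M.I 9 = 0 → M.R 0 = 0 → Q M) :
    Ends inp RealRAM.setup (17 + ((n * 4 + 5) + ((m * 4 + 5) + (m * 4 + 5))))
      ⟨fun _ => 0, fun _ => 0⟩ Q := by
  refine Ends.seq (Ends.block (by decide) ?_)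
  generalize hM : List.foldl (act inp) ⟨fun _ => 0, fun _ => 0⟩ _ = M
  have key : M.I 2 = n ∧ M.I 3 = m ∧ M.I 4 = d ∧ M.I 5 = q ∧ M.I 6 = 4 ∧ M.I 7 = 4 ∧ M.I 8 = 0 ∧
      M.I 9 = 0 ∧ M.I 23 = 1 ∧ M.I 25 = 0 ∧ M.R 0 = 0 ∧ M.R 1 = inp.reals.getD 0 0 ∧
      M.R 2 = inp.reals.getD 1 0 ∧ M.R 3 = inp.reals.getD 2 0 ∧ M.R 4 = inp.reals.getD 3 0 ∧
      M.R 5 = 0 ∧ M.R 6 = 1 ∧ M.R 7 = d := by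
    subst hM hn hm hd hq
    simp [act, exec, State.setI, State.setR]
  clear hM
  obtain ⟨k₁, k₂, k₃, k₄, k₅, k₆, k₇, k₈, k₉, k₁₀, k₁₁, k₁₂, k₁₃, k₁₄, k₁₅, k₁₆, k₁₇, k₁₈⟩ := key
  refine Ends.seq (Ends.addMul (N := n) (K := m) (by decide) (by decide) (by decide) (by decide)
    (by decide) (by decide) (by decide) (by decide) (by decide) k₁ k₂ fun M₁ e₁ e₂ e₃ => ?_)
  refine Ends.seq (Ends.addMul (N := m) (K := d) (by decide) (by decide) (by decide) (by decide)
    (by decide) (by decide) (by decide) (by decide) (by decide) (by simp [e₃, k₂])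
    (by simp [e₃, k₃]) fun M₂ f₁ f₂ f₃ => ?_)
  refine Ends.addMul (N := m) (K := q) (by decide) (by decide) (by decide) (by decide)
    (by decide) (by decide) (by decide) (by decide) (by decide) (by simp [e₃, f₃, k₂])
    (by simp [e₃, f₃, k₄]) fun M₃ g₁ g₂ g₃ => hQ M₃ ?_ ?_ ?_
  · constructor <;> simp [*]
  · simp [*]
  · simp [*]

/-- Truncated subtraction measures a violation and gives `0` when there is none, so no branching is
needed. The scan follows the order of both input arrays, and the pointers in registers `18` and `19`
only move forward. -/
theorem Ends.checkUsers (hM : Ready inp n m d q M) (h9 : M.I 9 = 0) (h0 : M.R 0 = 0)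
    (hQ : ∀ M, Ready inp n m d q M → M.R 0 = 0 → M.I 9 = ∑ i ∈ range n,
      ((∑ j ∈ range m, ∑ l ∈ range q, (inX inp n m q i j l - inCover inp m i j)) +
        ((∑ j ∈ range m, ∑ l ∈ range q, inX inp n m q i j l) - 1)) → Q M) :
    Ends inp RealRAM.checkUsers
      (2 + (n * ((1 + ((m * ((2 + (q * (5 + 3) + 5)) + 3) + 5) + 2)) + 3) + 5)) M Q := by
  refine Ends.seq (Ends.block (by decide) ?_)
  refine Ends.loop (N := n) (by decide) (fun i M => M.I 11 = i ∧ Ready inp n m d q M ∧ M.R 0 = 0 ∧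
    M.I 18 = 4 + i * m ∧ M.I 19 = 4 + n * m + i * m * q ∧ M.I 9 = ∑ i ∈ range i,
      ((∑ j ∈ range m, ∑ l ∈ range q, (inX inp n m q i j l - inCover inp m i j)) +
        ((∑ j ∈ range m, ∑ l ∈ range q, inX inp n m q i j l) - 1))) ?_
    (fun i M h => ⟨h.1, h.2.1.users⟩) ?_ (fun M h => hQ M h.2.1 h.2.2.1 h.2.2.2.2.2)
  · refine ⟨?_, hM.congr ?_ ?_, ?_, ?_, ?_, ?_⟩ <;>
      simp [act, exec, State.setI, Mem.startLoop, Mem.setI, hM.alloc, hM.zero, h9, h0]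
  rintro i M₁ - ⟨h₁, hM₁, h₃, h₄, h₅, h₆⟩
  refine Ends.seq (Ends.block (by decide) ?_)
  refine Ends.seq (Ends.loop (N := m) (by decide) (fun j M => M.I 12 = j ∧ M.I 11 = i ∧
    Ready inp n m d q M ∧ M.R 0 = 0 ∧ M.I 18 = 4 + (i * m + j) ∧
    M.I 19 = 4 + n * m + (i * m + j) * q ∧
    M.I 15 = ∑ j ∈ range j, ∑ l ∈ range q, inX inp n m q i j l ∧
    M.I 9 = M₁.I 9 +
      ∑ j ∈ range j, ∑ l ∈ range q, (inX inp n m q i j l - inCover inp m i j)) ?_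
    (fun j M h => ⟨h.1, h.2.2.1.servers⟩) ?_ ?_)
  · refine ⟨?_, ?_, hM₁.congr ?_ ?_, ?_, ?_, ?_, ?_, ?_⟩ <;>
      simp [act, exec, State.setI, Mem.startLoop, Mem.setI, h₁, h₃, h₄, h₅]
  · rintro j M₂ - ⟨g₁, g₂, hM₂, g₃, g₄, g₅, g₆, g₇⟩
    refine Ends.seq (Ends.block (by decide) ?_)
    refine Ends.loop (N := q) (by decide) (fun l M => M.I 13 = l ∧ M.I 12 = j ∧ M.I 11 = i ∧
      Ready inp n m d q M ∧ M.R 0 = 0 ∧ M.I 16 = inCover inp m i j ∧ M.I 18 = 4 + (i * m + j) + 1 ∧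
      M.I 19 = 4 + n * m + ((i * m + j) * q + l) ∧
      M.I 15 = M₂.I 15 + ∑ l ∈ range l, inX inp n m q i j l ∧
      M.I 9 = M₂.I 9 + ∑ l ∈ range l, (inX inp n m q i j l - inCover inp m i j)) ?_
      (fun j M h => ⟨h.1, h.2.2.2.1.qos⟩) ?_ ?_
    · refine ⟨?_, ?_, ?_, hM₂.congr ?_ ?_, ?_, ?_, ?_, ?_, ?_, ?_⟩ <;>
        simp [act, exec, State.setI, Mem.startLoop, Mem.setI, inCover, hM₂.one, g₁, g₂, g₃, g₄, g₅]
    · rintro l M₃ - ⟨f₁, f₂, f₃, hM₃, f₄, f₅, f₆, f₇, f₈, f₉⟩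
      refine Ends.block (by decide) ?_
      refine ⟨?_, ?_, ?_, hM₃.congr ?_ ?_, ?_, ?_, ?_, ?_, ?_, ?_⟩ <;>
        simp [act, exec, State.setI, Mem.nextRound, Mem.setI, sum_range_succ, inX,
          add_assoc, hM₃.one, f₁, f₂, f₃, f₄, f₅, f₆, f₇, f₈, f₉]
    · rintro M₃ ⟨f₁, f₂, f₃, hM₃, f₄, f₅, f₆, f₇, f₈, f₉⟩
      refine ⟨?_, ?_, hM₃.congr ?_ ?_, ?_, ?_, ?_, ?_, ?_⟩ <;>
        simp [Mem.nextRound, Mem.setI, sum_range_succ, add_assoc, add_mul, f₂, f₃, f₄, f₆, f₇, f₈,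
          f₉, g₆, g₇]
  · rintro M₂ ⟨g₁, g₂, hM₂, g₃, g₄, g₅, g₆, g₇⟩
    refine Ends.block (by decide) ?_
    refine ⟨?_, hM₂.congr ?_ ?_, ?_, ?_, ?_, ?_⟩ <;>
      simp [act, exec, State.setI, Mem.nextRound, Mem.setI, sum_range_succ, add_assoc,
        add_mul, hM₂.one, g₂, g₃, g₄, g₅, g₆, g₇, h₆]

/-- With the server outermost, the entries needed are not contiguous: register `19` marks the block
of server `j` for the first user, and adding the stride `m * q` leads to the next user. The level
pointer advances by `d` to stay in dimension `k`. -/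
theorem Ends.checkCapacities {b : ℕ} (hM : Ready inp n m d q M) (h9 : M.I 9 = b) (h0 : M.R 0 = 0)
    (hQ : ∀ M, Ready inp n m d q M → M.R 0 = 0 → M.I 9 = b + ∑ j ∈ range m, ∑ k ∈ range d,
      (if inCap inp d j k - ∑ i ∈ range n, ∑ l ∈ range q,
        inLevel inp m d l k * (inX inp n m q i j l : ℝ) < 0 then 1 else 0) → Q M) :
    Ends inp RealRAM.checkCapacities
      (2 + (m * ((1 + ((d * ((3 + ((n * ((2 + ((q * (7 + 3) + 5) + 1)) + 3) + 5) +
        ((1 + 4) + 1))) + 3) + 5) + 1)) + 3) + 5)) M Q := by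
  refine Ends.seq (Ends.block (by decide) ?_)
  refine Ends.loop (N := m) (by decide) (fun j M => M.I 12 = j ∧ Ready inp n m d q M ∧ M.R 0 = 0 ∧
    M.I 18 = 4 + j * d ∧ M.I 19 = 4 + n * m + j * q ∧
    M.I 9 = b + ∑ j ∈ range j, ∑ k ∈ range d,
      (if inCap inp d j k - ∑ i ∈ range n, ∑ l ∈ range q,
        inLevel inp m d l k * (inX inp n m q i j l : ℝ) < 0 then 1 else 0)) ?_
    (fun j M h => ⟨h.1, h.2.1.servers⟩) ?_ (fun M h => hQ M h.2.1 h.2.2.1 h.2.2.2.2.2)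
  · refine ⟨?_, hM.congr ?_ ?_, ?_, ?_, ?_, ?_⟩ <;>
      simp [act, exec, State.setI, Mem.startLoop, Mem.setI, hM.alloc, hM.zero, h9, h0]
  rintro j M₁ - ⟨h₁, hM₁, h₃, h₄, h₅, h₆⟩
  refine Ends.seq (Ends.block (by decide) ?_)
  refine Ends.seq (Ends.loop (N := d) (by decide) (fun k M => M.I 14 = k ∧ M.I 12 = j ∧
    Ready inp n m d q M ∧ M.R 0 = 0 ∧ M.I 18 = 4 + (j * d + k) ∧ M.I 19 = 4 + n * m + j * q ∧
    M.I 20 = 4 + m * d + k ∧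
    M.I 9 = M₁.I 9 + ∑ k ∈ range k,
      (if inCap inp d j k - ∑ i ∈ range n, ∑ l ∈ range q,
        inLevel inp m d l k * (inX inp n m q i j l : ℝ) < 0 then 1 else 0)) ?_
    (fun k M h => ⟨h.1, h.2.2.1.dims⟩) ?_ ?_)
  · refine ⟨?_, ?_, hM₁.congr ?_ ?_, ?_, ?_, ?_, ?_, ?_⟩ <;>
      simp [act, exec, State.setI, Mem.startLoop, Mem.setI, hM₁.levels, hM₁.zero, h₁, h₃, h₄, h₅]
  · rintro k M₂ - ⟨g₁, g₂, hM₂, g₃, g₄, g₅, g₆, g₇⟩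
    refine Ends.seq (Ends.block (by decide) ?_)
    refine Ends.seq (Ends.loop (N := n) (by decide) (fun i M => M.I 11 = i ∧ M.I 14 = k ∧
      M.I 12 = j ∧ Ready inp n m d q M ∧ M.R 0 = 0 ∧ M.I 18 = 4 + (j * d + k) + 1 ∧
      M.I 19 = 4 + n * m + j * q ∧ M.I 20 = 4 + m * d + k ∧
      M.I 21 = 4 + n * m + (i * m + j) * q ∧ M.I 9 = M₂.I 9 ∧
      M.R 8 = inCap inp d j k - ∑ i ∈ range i, ∑ l ∈ range q,
        inLevel inp m d l k * (inX inp n m q i j l : ℝ)) ?_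
      (fun i M h => ⟨h.1, h.2.2.2.1.users⟩) ?_ ?_)
    · refine ⟨?_, ?_, ?_, hM₂.congr ?_ ?_, ?_, ?_, ?_, ?_, ?_, ?_, ?_⟩ <;>
        simp [act, exec, State.setI, State.setR, Mem.startLoop, Mem.setI, inCap, hM₂.one, hM₂.zero,
          g₁, g₂, g₃, g₄, g₅, g₆]
    · rintro i M₃ - ⟨f₁, f₂, f₃, hM₃, f₄, f₅, f₆, f₇, f₈, f₉, f₁₀⟩
      refine Ends.seq (Ends.block (by decide) ?_)
      refine Ends.seq (Ends.loop (N := q) (by decide) (fun l M => M.I 13 = l ∧ M.I 11 = i ∧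
        M.I 14 = k ∧ M.I 12 = j ∧ Ready inp n m d q M ∧ M.R 0 = 0 ∧
        M.I 18 = 4 + (j * d + k) + 1 ∧ M.I 19 = 4 + n * m + j * q ∧ M.I 20 = 4 + m * d + k ∧
        M.I 21 = 4 + n * m + (i * m + j) * q ∧ M.I 9 = M₂.I 9 ∧
        M.I 22 = 4 + n * m + ((i * m + j) * q + l) ∧ M.I 26 = 4 + m * d + (l * d + k) ∧
        M.R 8 = M₃.R 8 - ∑ l ∈ range l,
          inLevel inp m d l k * (inX inp n m q i j l : ℝ)) ?_
        (fun l M h => ⟨h.1, h.2.2.2.2.1.qos⟩) ?_ ?_)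
      · refine ⟨?_, ?_, ?_, ?_, hM₃.congr ?_ ?_, ?_, ?_, ?_, ?_, ?_, ?_, ?_, ?_, ?_⟩ <;>
          simp [act, exec, State.setI, State.setR, Mem.startLoop, Mem.setI, hM₃.zero,
            f₁, f₂, f₃, f₄, f₅, f₆, f₇, f₈, f₉]
      · rintro l M₄ - ⟨e₁, e₂, e₃, e₄, hM₄, e₅, e₆, e₇, e₈, e₉, e₁₀, e₁₁, e₁₂, e₁₃⟩
        refine Ends.block (by decide) ?_
        refine ⟨?_, ?_, ?_, ?_, hM₄.congr ?_ ?_, ?_, ?_, ?_, ?_, ?_, ?_, ?_, ?_, ?_⟩ <;>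
          simp [act, exec, State.setI, State.setR, Mem.nextRound, Mem.setI, inLevel, inX,
            sum_range_succ, hM₄.one, hM₄.dims, e₁, e₂, e₃, e₄, e₅, e₆, e₇, e₈, e₉, e₁₀, e₁₁, e₁₂,
            e₁₃] <;> ring
      · rintro M₄ ⟨e₁, e₂, e₃, e₄, hM₄, e₅, e₆, e₇, e₈, e₉, e₁₀, e₁₁, e₁₂, e₁₃⟩
        refine Ends.block (by decide) ?_
        refine ⟨?_, ?_, ?_, hM₄.congr ?_ ?_, ?_, ?_, ?_, ?_, ?_, ?_, ?_⟩ <;>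
          simp [act, exec, State.setI, State.setR, Mem.nextRound, Mem.setI, sum_range_succ,
            hM₄.stride, e₂, e₃, e₄, e₅, e₆, e₇, e₈, e₉, e₁₀, e₁₃, f₁₀] <;> ring
    · rintro M₃ ⟨f₁, f₂, f₃, hM₃, f₄, f₅, f₆, f₇, f₈, f₉, f₁₀⟩
      refine Ends.seq (Ends.cond (fun h => ?_) fun h => ?_)
      · rw [f₁₀, hM₃.rzero] at h
        refine Ends.block (by decide) (Ends.block (by decide) ?_)
        refine ⟨?_, ?_, hM₃.congr ?_ ?_, ?_, ?_, ?_, ?_, ?_⟩ <;>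
          simp [act, exec, State.setI, State.setR, Mem.nextRound, Mem.setI, sum_range_succ, h,
            hM₃.one, f₂, f₃, f₄, f₅, f₆, f₇, f₉, g₇, add_assoc, -sub_neg, -sum_boole]
      · rw [f₁₀, hM₃.rzero] at h
        refine Ends.block (by decide) ?_
        refine ⟨?_, ?_, hM₃.congr ?_ ?_, ?_, ?_, ?_, ?_, ?_⟩ <;>
          simp [act, exec, State.setI, State.setR, Mem.nextRound, Mem.setI, sum_range_succ, h,
            hM₃.one, f₂, f₃, f₄, f₅, f₆, f₇, f₉, g₇, add_assoc, -sub_neg, -sum_boole]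
  · rintro M₂ ⟨g₁, g₂, hM₂, g₃, g₄, g₅, g₆, g₇⟩
    refine Ends.block (by decide) ?_
    refine ⟨?_, hM₂.congr ?_ ?_, ?_, ?_, ?_, ?_⟩ <;>
      simp [act, exec, State.setI, Mem.nextRound, Mem.setI, sum_range_succ, add_assoc,
        add_mul, hM₂.qos, g₂, g₃, g₄, g₅, g₇, h₆]

/-- The level is outermost, so each logistic value is computed once and kept in `R[8]`; with the
level fixed, steps of length `q` run through all users and servers. -/
theorem Ends.sumQoE {b : ℕ} (hM : Ready inp n m d q M) (h9 : M.I 9 = b) (h0 : M.R 0 = 0)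
    (hQ : ∀ M, Ready inp n m d q M → M.I 9 = b →
      M.R 0 = ∑ l ∈ range q, ∑ i ∈ range n, ∑ j ∈ range m,
        inQoE inp m d l * (inX inp n m q i j l : ℝ) → Q M) :
    Ends inp RealRAM.sumQoE
      (2 + (q * ((1 + ((d * (3 + 3) + 5) + (8 + ((n * ((m * (5 + 3) + 5) + 3) + 5) + 1)))) + 3) + 5))
      M Q := by
  refine Ends.seq (Ends.block (by decide) ?_)
  refine Ends.loop (N := q) (by decide) (fun l M => M.I 13 = l ∧ Ready inp n m d q M ∧ M.I 9 = b ∧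
    M.I 19 = 4 + n * m + l ∧ M.I 20 = 4 + m * d + l * d ∧
    M.R 0 = ∑ l ∈ range l, ∑ i ∈ range n, ∑ j ∈ range m,
        inQoE inp m d l * (inX inp n m q i j l : ℝ)) ?_
    (fun j M h => ⟨h.1, h.2.1.qos⟩) ?_ (fun M h => hQ M h.2.1 h.2.2.1 h.2.2.2.2.2)
  · refine ⟨?_, hM.congr ?_ ?_, ?_, ?_, ?_, ?_⟩ <;>
      simp [act, exec, State.setI, Mem.startLoop, Mem.setI, hM.alloc, hM.levels, hM.zero, h9, h0]
  rintro l M₁ - ⟨h₁, hM₁, h₃, h₄, h₅, h₆⟩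
  refine Ends.seq (Ends.block (by decide) ?_)
  refine Ends.seq (Ends.loop (N := d) (by decide) (fun k M => M.I 14 = k ∧ M.I 13 = l ∧
    Ready inp n m d q M ∧ M.I 9 = b ∧ M.I 19 = 4 + n * m + l ∧ M.I 20 = 4 + m * d + (l * d + k) ∧
    M.R 0 = M₁.R 0 ∧ M.R 8 = ∑ k ∈ range k, inLevel inp m d l k) ?_
    (fun k M h => ⟨h.1, h.2.2.1.dims⟩) ?_ ?_)
  · refine ⟨?_, ?_, hM₁.congr ?_ ?_, ?_, ?_, ?_, ?_, ?_⟩ <;>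
      simp [act, exec, State.setI, State.setR, Mem.startLoop, Mem.setI, hM₁.zero, h₁, h₃, h₄, h₅]
  · rintro k M₂ - ⟨g₁, g₂, hM₂, g₃, g₄, g₅, g₆, g₇⟩
    refine Ends.block (by decide) ?_
    refine ⟨?_, ?_, hM₂.congr ?_ ?_, ?_, ?_, ?_, ?_, ?_⟩ <;>
      simp [act, exec, State.setI, State.setR, Mem.nextRound, Mem.setI, sum_range_succ, inLevel,
        hM₂.one, g₁, g₂, g₃, g₄, g₅, g₆, g₇, add_assoc]
  rintro M₂ ⟨g₁, g₂, hM₂, g₃, g₄, g₅, g₆, g₇⟩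
  refine Ends.seq (Ends.block (by decide) ?_)
  refine Ends.seq (Ends.loop (N := n) (by decide) (fun i M => M.I 11 = i ∧ M.I 13 = l ∧
    Ready inp n m d q M ∧ M.I 9 = b ∧ M.I 19 = 4 + n * m + l ∧ M.I 20 = 4 + m * d + (l * d + d) ∧
    M.I 21 = 4 + n * m + (i * m * q + l) ∧ M.R 8 = inQoE inp m d l ∧
    M.R 0 = M₁.R 0 + ∑ i ∈ range i, ∑ j ∈ range m,
      inQoE inp m d l * (inX inp n m q i j l : ℝ)) ?_
    (fun i M h => ⟨h.1, h.2.2.1.users⟩) ?_ ?_)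
  · refine ⟨?_, ?_, hM₂.congr ?_ ?_, ?_, ?_, ?_, ?_, ?_, ?_⟩ <;>
      simp [act, exec, State.setI, State.setR, Mem.startLoop, Mem.setI, inQoE, hM₂.zero, hM₂.rd,
        hM₂.center, hM₂.rzero, hM₂.slope, hM₂.rone, hM₂.scale, g₂, g₃, g₄, g₅, g₆, g₇]
  · rintro i M₃ - ⟨f₁, f₂, hM₃, f₃, f₄, f₅, f₆, f₇, f₈⟩
    refine Ends.loop (N := m) (by decide) (fun j M => M.I 12 = j ∧ M.I 11 = i ∧ M.I 13 = l ∧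
      Ready inp n m d q M ∧ M.I 9 = b ∧ M.I 19 = 4 + n * m + l ∧
      M.I 20 = 4 + m * d + (l * d + d) ∧
      M.I 21 = 4 + n * m + ((i * m + j) * q + l) ∧ M.R 8 = inQoE inp m d l ∧
      M.R 0 = M₃.R 0 + ∑ j ∈ range j, inQoE inp m d l * (inX inp n m q i j l : ℝ)) ?_
      (fun j M h => ⟨h.1, h.2.2.2.1.servers⟩) ?_ ?_
    · refine ⟨?_, ?_, ?_, hM₃.congr ?_ ?_, ?_, ?_, ?_, ?_, ?_, ?_⟩ <;>
        simp [Mem.startLoop, Mem.setI, f₁, f₂, f₃, f₄, f₅, f₆, f₇]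
    · rintro j M₄ - ⟨e₁, e₂, e₃, hM₄, e₄, e₅, e₆, e₇, e₈, e₉⟩
      refine Ends.block (by decide) ?_
      refine ⟨?_, ?_, ?_, hM₄.congr ?_ ?_, ?_, ?_, ?_, ?_, ?_, ?_⟩ <;>
        simp [act, exec, State.setI, State.setR, Mem.nextRound, Mem.setI, inX, sum_range_succ,
          hM₄.qos, e₁, e₂, e₃, e₄, e₅, e₆, e₇, e₈, e₉] <;> ring
    · rintro M₄ ⟨e₁, e₂, e₃, hM₄, e₄, e₅, e₆, e₇, e₈, e₉⟩
      refine ⟨?_, ?_, hM₄.congr ?_ ?_, ?_, ?_, ?_, ?_, ?_, ?_⟩ <;>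
        simp [Mem.nextRound, Mem.setI, sum_range_succ, add_mul, add_assoc, e₂, e₃, e₄,
          e₅, e₆, e₇, e₈, e₉, f₈]
  · rintro M₃ ⟨f₁, f₂, hM₃, f₃, f₄, f₅, f₆, f₇, f₈⟩
    refine Ends.block (by decide) ?_
    refine ⟨?_, hM₃.congr ?_ ?_, ?_, ?_, ?_, ?_⟩ <;>
      simp [act, exec, State.setI, Mem.nextRound, Mem.setI, sum_range_succ, add_assoc,
        add_mul, hM₃.one, f₂, f₃, f₄, f₅, f₈, h₆]

/-! ### The acceptance criterion and the total running time. -/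

/-- What the verifier checks, in terms of its input -/
def Accepts (inp : Input) (n m d q : ℕ) : Prop :=
  (∀ i < n, (∀ j < m, ∀ l < q, inX inp n m q i j l ≤ inCover inp m i j) ∧
    (∑ j ∈ range m, ∑ l ∈ range q, inX inp n m q i j l) ≤ 1) ∧
  (∀ j < m, ∀ k < d, ∑ i ∈ range n, ∑ l ∈ range q,
    inLevel inp m d l k * (inX inp n m q i j l : ℝ) ≤ inCap inp d j k) ∧
  inp.reals.getD 0 0 < ∑ l ∈ range q, ∑ i ∈ range n, ∑ j ∈ range m,
    inQoE inp m d l * (inX inp n m q i j l : ℝ)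

/-- A sum of natural numbers vanishes only if every term does, so one counter records all the
checks. -/
theorem accepts_iff : Accepts inp n m d q ↔
    (∑ i ∈ range n,
      ((∑ j ∈ range m, ∑ l ∈ range q, (inX inp n m q i j l - inCover inp m i j)) +
        ((∑ j ∈ range m, ∑ l ∈ range q, inX inp n m q i j l) - 1)) +
      ∑ j ∈ range m, ∑ k ∈ range d, (if inCap inp d j k - ∑ i ∈ range n, ∑ l ∈ range q,
        inLevel inp m d l k * (inX inp n m q i j l : ℝ) < 0 then 1 else 0) = 0) ∧
    inp.reals.getD 0 0 < ∑ l ∈ range q, ∑ i ∈ range n, ∑ j ∈ range m,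
      inQoE inp m d l * (inX inp n m q i j l : ℝ) := by
  simp only [Accepts, ← and_assoc, Nat.add_eq_zero_iff, sum_eq_zero_iff, mem_range,
    Nat.sub_eq_zero_iff_le, ite_eq_right_iff, one_ne_zero, imp_false, not_lt, sub_nonneg]

/-- The running time of the verifier -/
def verifierTime (n m d q : ℕ) : ℕ :=
  (17 + ((n * 4 + 5) + ((m * 4 + 5) + (m * 4 + 5)))) +
  ((2 + (n * ((1 + ((m * ((2 + (q * (5 + 3) + 5)) + 3) + 5) + 2)) + 3) + 5)) +
  ((2 + (m * ((1 + ((d * ((3 + ((n * ((2 + ((q * (7 + 3) + 5) + 1)) + 3) + 5) +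
        ((1 + 4) + 1))) + 3) + 5) + 1)) + 3) + 5)) +
  ((2 + (q * ((1 + ((d * (3 + 3) + 5) + (8 + ((n * ((m * (5 + 3) + 5) + 3) + 5) + 1)))) + 3) + 5)) +
  (1 + (1 + 4)))))

theorem Ends.verifierCode (hn : inp.ints.getD 0 0 = n) (hm : inp.ints.getD 1 0 = m)
    (hd : inp.ints.getD 2 0 = d) (hq : inp.ints.getD 3 0 = q) :
    Ends inp verifierCode (verifierTime n m d q) ⟨fun _ => 0, fun _ => 0⟩ fun M =>
      M.I 9 < M.I 10 ↔ Accepts inp n m d q := by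
  simp only [accepts_iff]
  refine Ends.seq (Ends.setup hn hm hd hq fun M₁ hM₁ g₁ g₂ => ?_)
  refine Ends.seq (Ends.checkUsers hM₁ g₁ g₂ fun M₂ hM₂ g₃ g₄ => ?_)
  refine Ends.seq (Ends.checkCapacities hM₂ g₄ g₃ fun M₃ hM₃ g₅ g₆ => ?_)
  refine Ends.seq (Ends.sumQoE hM₃ g₆ g₅ fun M₄ hM₄ g₇ g₈ => ?_)
  refine Ends.seq (Ends.block (by decide) ?_)
  -- `I[9]` holds the total of the violations and `I[10]` becomes `0` or `1` by the comparison with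
  -- the threshold, so `I[9] < I[10]` says that both tests are passed.
  rw [← g₇, ← g₈, ← hM₄.threshold]
  refine Ends.cond (fun h => ?_) fun h => ?_
  · refine Ends.block (by decide) ?_
    have h' : M₄.R 1 < M₄.R 0 := h
    simp [act, exec, State.setI, h']
  · have h' : ¬M₄.R 1 < M₄.R 0 := h
    simp [act, exec, State.setI, Mem.setI, h']

theorem verifierTime_le (d q : ℕ) : ∃ C : ℕ, ∀ n m : ℕ, 0 < n → 0 < m →
    verifierTime n m d q + 2 ≤ C * (m * n) := by
  have hlin (c₀ c₁ c₂ c₃ : ℕ) {n m : ℕ} (hn : 0 < n) (hm : 0 < m) :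
      c₀ + c₁ * n + c₂ * m + c₃ * (m * n) ≤ (c₀ + c₁ + c₂ + c₃) * (m * n) := by
    rw [add_mul, add_mul, add_mul]
    gcongr
    · exact Nat.le_mul_of_pos_right _ (Nat.mul_pos hm hn)
    · exact Nat.le_mul_of_pos_left n hm
    · exact Nat.le_mul_of_pos_right m hn
  -- The coefficients of `1`, `n`, `m` and `m * n` in the expanded running time, including the two
  -- final steps.
  refine ⟨_, fun n m hn hm => le_of_eq_of_le ?_ (hlin (61 + q * (6 * d + 23)) (15 + 8 * q)
    (18 + 17 * d) (16 * q + 10 + d * (10 * q + 11)) hn hm)⟩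
  rw [verifierTime]
  ring

/-! ### Addressing the input arrays. -/

section VerifierInput

variable (I : EUA n m d q) (L α β : ℝ) (x : Allocation n m q)

theorem length_flatMap_of_length {α β : Type*} {f : α → List β} {w : ℕ}
    (hf : ∀ a, (f a).length = w) (l : List α) : (l.flatMap f).length = l.length * w := by
  simp [List.length_flatMap, hf]

theorem inCover_verifierInput (i : Fin n) (j : Fin m) :
    inCover (verifierInput I L α β x) m i j = (I.covers j i).toNat := by
  have hlt : (i : ℕ) * m + j < n * m := by
    nlinarith [Nat.mul_le_mul_right m (show (i : ℕ) + 1 ≤ n from i.2), j.2]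
  rw [inCover, verifierInput, List.getD_eq_getElem?_getD, List.append_assoc,
    List.getElem?_append_right (by simp), List.getElem?_append_left (by
      rw [length_flatMap_of_length (w := m) (by simp)]; simpa using hlt)]
  rw [show 4 + ((i : ℕ) * m + j) - [n, m, d, q].length = i * m + j by simp,
    List.getElem?_flatMap_of_length (by simp) _ _ j.2]
  simp

theorem inX_verifierInput (i : Fin n) (j : Fin m) (l : Fin q) :
    inX (verifierInput I L α β x) n m q i j l = (x i j l).toNat := by
  have hlt : (j : ℕ) * q + l < m * q := by
    nlinarith [Nat.mul_le_mul_right q (show (j : ℕ) + 1 ≤ m from j.2), l.2]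
  rw [inX, verifierInput, List.getD_eq_getElem?_getD, List.getElem?_append_right (by
    rw [List.length_append, length_flatMap_of_length (w := m) (by simp)]; simp)]
  rw [List.length_append, length_flatMap_of_length (w := m) (by simp), List.length_finRange,
    show 4 + n * m + (((i : ℕ) * m + j) * q + l) - ([n, m, d, q].length + n * m) =
      i * (m * q) + (j * q + l) by simp; ring,
    List.getElem?_flatMap_of_length (w := m * q)
      (fun _ => by rw [length_flatMap_of_length (w := q) (by simp)]; simp) _ _ hlt]
  rw [show (List.finRange n)[(i : ℕ)]? = some i by simp, Option.bind_some,
    List.getElem?_flatMap_of_length (by simp) _ _ l.2]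
  simp

theorem inCap_verifierInput (j : Fin m) (k : Fin d) :
    inCap (verifierInput I L α β x) d j k = I.cap j k := by
  have hlt : (j : ℕ) * d + k < m * d := by
    nlinarith [Nat.mul_le_mul_right d (show (j : ℕ) + 1 ≤ m from j.2), k.2]
  rw [inCap, verifierInput, List.getD_eq_getElem?_getD, List.append_assoc [I.threshold, L, α, β],
    List.getElem?_append_right (by simp), List.getElem?_append_left (by
      rw [length_flatMap_of_length (w := d) (by simp)]; simpa using hlt)]
  rw [show 4 + ((j : ℕ) * d + k) - [I.threshold, L, α, β].length = j * d + k by simp,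
    List.getElem?_flatMap_of_length (by simp) _ _ k.2]
  simp

theorem inLevel_verifierInput (l : Fin q) (k : Fin d) :
    inLevel (verifierInput I L α β x) m d l k = I.level l k := by
  rw [inLevel, verifierInput, List.getD_eq_getElem?_getD, List.getElem?_append_right (by
    rw [List.length_append, length_flatMap_of_length (w := d) (by simp)]; simp)]
  rw [List.length_append, length_flatMap_of_length (w := d) (by simp), List.length_finRange,
    show 4 + m * d + ((l : ℕ) * d + k) - ([I.threshold, L, α, β].length + m * d) =
      l * d + k by simp,
    List.getElem?_flatMap_of_length (by simp) _ _ k.2]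
  simp

theorem inQoE_verifierInput (l : Fin q) :
    inQoE (verifierInput I L α β x) m d l = I.logisticQoE L α β l := by
  rw [inQoE, EUA.logisticQoE, ← Fin.sum_univ_eq_sum_range]
  simp only [inLevel_verifierInput]
  simp [verifierInput]

/-- On bits, an inequality is an implication, a product with a bit is a conditional term, and a sum
is the number of chosen pairs; the rest is reindexing and exchanging sums. -/
theorem accepts_verifierInput :
    Accepts (verifierInput I L α β x) n m d q ↔ I.IsSolution (I.logisticQoE L α β) x := by
  have hmul (r : ℝ) (b : Bool) : r * (b.toNat : ℝ) = if b = true then r else 0 := by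
    cases b <;> simp
  have hle (b c : Bool) : b.toNat ≤ c.toNat ↔ (b = true → c = true) := by
    cases b <;> cases c <;> simp
  have hone (i : Fin n) : ∑ j : Fin m, ∑ l : Fin q, (x i j l).toNat =
      (Finset.univ.filter fun p : Fin m × Fin q => x i p.1 p.2 = true).card := by
    rw [Finset.card_filter, Fintype.sum_prod_type]
    refine sum_congr rfl fun j _ => sum_congr rfl fun l _ => ?_
    cases x i j l <;> simp
  have hthr : (verifierInput I L α β x).reals.getD 0 0 = I.threshold := rfl
  have hagg : ∑ l : Fin q, ∑ i : Fin n, ∑ j : Fin m,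
      (if x i j l = true then I.logisticQoE L α β l else 0) =
      EUA.aggregateQoE (I.logisticQoE L α β) x := by
    rw [EUA.aggregateQoE, sum_comm]
    exact sum_congr rfl fun i _ => sum_comm
  simp only [Accepts, EUA.IsSolution, ← Fin.sum_univ_eq_sum_range, hthr, inX_verifierInput,
    inQoE_verifierInput, hmul, hagg]
  rw [← and_assoc]
  refine and_congr_left' ⟨fun h => ⟨fun i j l hx => ?_, fun i => ?_, fun j k => ?_⟩,
    fun h => ⟨fun i hi => ⟨fun j hj l hl => ?_, ?_⟩, fun j hj k hk => ?_⟩⟩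
  · have := (h.1 i i.2).1 j j.2 l l.2
    rw [inX_verifierInput, inCover_verifierInput, hle] at this
    exact this hx
  · have := (h.1 i i.2).2
    simp only [inX_verifierInput, hone] at this
    exact this
  · have := h.2 j j.2 k k.2
    simp only [inX_verifierInput, inLevel_verifierInput, inCap_verifierInput, hmul] at this
    exact this
  · have := inX_verifierInput I L α β x ⟨i, hi⟩ ⟨j, hj⟩ ⟨l, hl⟩
    rw [this, inCover_verifierInput I L α β x ⟨i, hi⟩ ⟨j, hj⟩, hle]
    exact h.covered _ _ _
  · have := h.atMostOne ⟨i, hi⟩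
    rw [← hone] at this
    simpa only [← inX_verifierInput I L α β x] using this
  · have := h.capacity ⟨j, hj⟩ ⟨k, hk⟩
    simpa only [← hmul, ← inX_verifierInput I L α β x, ← inLevel_verifierInput I L α β x,
      ← inCap_verifierInput I L α β x] using this

end VerifierInput

/-- The verifier decides in time `O(m n)` whether an allocation is a solution. -/
theorem exists_run_verifier (d q : ℕ) : ∃ C : ℕ, ∀ n m : ℕ, 0 < n → 0 < m →
    ∀ (I : EUA n m d q) (L α β : ℝ) (x : Allocation n m q), ∃ answer : Bool,
      run (decider verifierCode 9 10) (verifierInput I L α β x) (C * (m * n)) = some answer ∧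
        (answer = true ↔ I.IsSolution (I.logisticQoE L α β) x) := by
  obtain ⟨C, hC⟩ := verifierTime_le d q
  refine ⟨C, fun n m hn hm I L α β x => ?_⟩
  rw [← accepts_verifierInput]
  exact run_decider (Ends.verifierCode rfl rfl rfl rfl) (hC n m hn hm)

end RealRAM

theorem theorem1 :
    -- the decision problem with pre-calculated rational QoE values is in NP
    InNP RatInstance.encode (fun I => I.toEUA.Decision I.qoe) ∧
    -- so is the one for the exact logistic QoE, when the values supplied are precise enough
    (∀ L α β : ℝ,
      InNP (fun I : {I : RatInstance // I.PreciseFor (I.toEUA.logisticQoE L α β)} => I.1.encode)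
        (fun I => I.1.toEUA.Decision (I.1.toEUA.logisticQoE L α β))) ∧
    -- one program checks proposed allocations in time `O(m n)`, for fixed `d` and `q`
    (∃ prog : List RealRAM.Instr, ∀ d q : ℕ, 0 < d → ∃ C : ℕ,
      ∀ (n m : ℕ), 0 < n → 0 < m →
        ∀ (I : EUA n m d q) (L α β : ℝ) (x : Allocation n m q),
          ∃ answer : Bool,
            RealRAM.run prog (verifierInput I L α β x) (C * (m * n)) = some answer ∧
            (answer = true ↔ I.IsSolution (I.logisticQoE L α β) x)) :=
  ⟨RatInstance.inNP_decision, RatInstance.inNP_logistic,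
    RealRAM.decider RealRAM.verifierCode 9 10, fun d q _ => RealRAM.exists_run_verifier d q⟩
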